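/- Let $n\ge 1$ and $d_1,\dots,d_n\ge 1$ be integers and put $t_n:=\sum_{i=1}^n(d_i-1)$. Let $A:=\mathbb Z[a_{\alpha_i}]_{|\alpha_i|=d_i,\ i=1,\dots,n}$ and let $$f_i:=\sum_{|\alpha_i|=d_i}a_{\alpha_i}X^{\alpha_i}\in A[X_1,\dots,X_n]\qquad(i=1,\dots,n)$$ be the generic forms of degrees $d_1,\dots,d_n$. Let $\mathrm{Res}_{d_1,\dots,d_n}(f_1,\dots,f_n)\in A$ be their resultant, i.e. the irreducible polynomial in $A$ that vanishes at a system of coefficients in an algebraically closed field exactly when the corresponding forms have a common root in projective space, normalized to take the value $1$ at $X_1^{d_1},\dots,X_n^{d_n}$. *Bezoutian.* For $1\le i,j\le n$ let $$\Delta_{ij}(X,Y):=\frac{f_i(Y_1,\dots,Y_{j-1},X_j,\dots,X_n)-f_i(Y_1,\dots,Y_j,X_{j+1},\dots,X_n)}{X_j-Y_j}\in A[X,Y],$$ and write $\Delta(X,Y):=\det(\Delta_{ij}(X,Y))=\sum_{|\gamma|\le t_n}\Delta_\gamma(X)\,Y^\gamma$. *Blocks.* For an integer $u$ let $S_u$ be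 the free $A$-module on the monomials of degree $u$ in $X_1,\dots,X_n$ ($S_u=0$ if $u<0$), and let $$S^{u,j}:=\langle X^\gamma:\ |\gamma|=u-d_j,\ \gamma_1<d_1,\dots,\gamma_{j-1}<d_{j-1}\rangle,\qquad E^{u,j}:=\langle X^\gamma\in S^{u,j}:\ \gamma_i\ge d_i\text{ for some }i\ne j\rangle .$$ Let $D_u$ be the matrix, in the monomial bases, of the map $S^{u,1}\oplus\dots\oplus S^{u,n}\to S_u$, $(g_1,\dots,g_n)\mapsto\sum_i g_if_i$. Let $E_u$ be the submatrix of $D_u$ whose columns are indexed by the monomials of $E^{u,1},\dots,E^{u,n}$ (there are none in $E^{u,n}$) and whose rows are indexed by the monomials $X^\gamma\in S_u$ for which there are two different indices $i,j$ with $\gamma_i\ge d_i$ and $\gamma_j\ge d_j$. Let $\Delta_t$ be the matrix, in the monomial bases and their duals, of the map $S_{t_n-t}^*\to S_t$ that sends the element $T_\gamma$ of the dual monomial basis to $\Delta_\gamma(X)$. For an integer $t\ge 0$ put $$M_t:=\begin{bmatrix}\Delta_t & D_t\\ {}^{\mathbf t}D_{t_n-t} & 0\end{bmatrix},\qquad \mathbb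 E_t:=\begin{bmatrix} * & E_t\\ {}^{\mathbf t}E_{t_n-t} & 0\end{bmatrix},$$ where $\mathbb E_t$ is the submatrix of $M_t$ formed by the rows and columns that belong to $E_t$ and ${}^{\mathbf t}E_{t_n-t}$ (so $*$ is a submatrix of $\Delta_t$). The determinants below are formed with respect to any orderings of the monomial bases; another choice affects only their signs. The determinant of an empty matrix is $1$. **Theorem.** For every $t\ge 0$ the matrices $M_t$ and $\mathbb E_t$ are square, $\det(M_t)\ne 0$ and $\det(\mathbb E_t)\ne 0$, and $$\mathrm{Res}_{d_1,\dots,d_n}(f_1,\dots,f_n)=\pm\,\frac{\det(M_t)}{\det(\mathbb E_t)}$$ (as an identity in the field of fractions of $A$). -/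

import Mathlib

open MvPolynomial

noncomputable section

namespace MacaulayBezout

/-- Exponents `γ ∈ ℕⁿ` with `|γ| = u`: the monomial basis of `S_u`. It is empty for `u < 0`. -/
abbrev Mon (n : ℕ) (u : ℤ) : Type := {γ : Fin n →₀ ℕ // (γ.degree : ℤ) = u}

theorem finite_degree_eq (n : ℕ) (u : ℤ) : {γ : Fin n →₀ ℕ | (γ.degree : ℤ) = u}.Finite :=
  (Finsupp.finite_of_degree_le (σ := Fin n) u.toNat).subset fun γ hγ => by
    change (γ.degree : ℤ) = u at hγ
    change γ.degree ≤ u.toNat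
    omega

instance instFintypeMon (n : ℕ) (u : ℤ) : Fintype (Mon n u) :=
  (finite_degree_eq n u).fintype

variable {n : ℕ} (d : Fin n → ℕ)

/-- Indices of the indeterminate coefficients `a_{α_i}`, `|α_i| = d_i`, `i = 1, …, n`. -/
abbrev CoeffIdx : Type := Σ i : Fin n, Mon n (d i)

/-- The ring `A = ℤ[a_{α_i}]`. -/
abbrev CoeffRing : Type := MvPolynomial (CoeffIdx d) ℤ

/-- The generic form `f_i = ∑_{|α| = d_i} a_{α} X^α` of degree `d_i`. -/
def genericForm (i : Fin n) : MvPolynomial (Fin n) (CoeffRing d) :=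
  ∑ α : Mon n (d i), monomial α.1 (X ⟨i, α⟩)

/-- The critical degree `t_n = ∑ (d_i - 1)`. -/
def critDegree : ℤ := ∑ i, ((d i : ℤ) - 1)

/-! ### The resultant -/

/-- The form `f_i(a)` obtained from `f_i` by giving the coefficients the values `a`. -/
def specializedForm {k : Type} [CommRing k] (a : CoeffIdx d → k) (i : Fin n) :
    MvPolynomial (Fin n) k :=
  map (aeval a : CoeffRing d →ₐ[ℤ] k).toRingHom (genericForm d i)

/-- The coefficients of the forms `X_1^{d_1}, …, X_n^{d_n}`. -/
def powerCoeff (c : CoeffIdx d) : ℤ :=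
  if c.2.1 = Finsupp.single c.1 (d c.1) then 1 else 0

/-- `R` is an irreducible polynomial over `ℤ` in the coefficients of `f_1, …, f_n` that vanishes
at a system of coefficients in an algebraically closed field exactly when the specialized forms
have a common root in projective space, with the usual normalization of the sign. -/
structure IsResultant (R : CoeffRing d) : Prop where
  irreducible : Irreducible R
  vanishes_iff : ∀ (k : Type) [Field k] [IsAlgClosed k] (a : CoeffIdx d → k),
    aeval a R = 0 ↔ ∃ p : Fin n → k, p ≠ 0 ∧ ∀ i, eval p (specializedForm d a i) = 0
  normalized : eval (powerCoeff d) R = 1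

open Classical in
/-- The resultant `Res_{d_1,…,d_n}(f_1,…,f_n)`: the polynomial characterized by `IsResultant`
(with the value `0` in case there is none, for which the quotient formula would fail). -/
def resultant : CoeffRing d :=
  if h : ∃ R, IsResultant d R then h.choose else 0

/-! ### The Bezoutian -/

/-- The ring `A[X, Y]`; `X` are the left variables and `Y` the right ones. -/
abbrev XYRing : Type := MvPolynomial (Fin n ⊕ Fin n) (CoeffRing d)

/-- The numerator `f_i(Y_1,…,Y_{j-1},X_j,…,X_n) - f_i(Y_1,…,Y_j,X_{j+1},…,X_n)`. -/
def incrementNum (i j : Fin n) : XYRing d :=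
  aeval (fun l : Fin n => if l < j then (X (Sum.inr l) : XYRing d) else X (Sum.inl l))
      (genericForm d i) -
    aeval (fun l : Fin n => if l ≤ j then (X (Sum.inr l) : XYRing d) else X (Sum.inl l))
      (genericForm d i)

theorem dvd_incrementNum (i j : Fin n) :
    (X (Sum.inl j) - X (Sum.inr j) : XYRing d) ∣ incrementNum d i j := by
  have h (p : MvPolynomial (Fin n) (CoeffRing d)) :
      (X (Sum.inl j) - X (Sum.inr j) : XYRing d) ∣
        aeval (fun l : Fin n => if l < j then (X (Sum.inr l) : XYRing d) else X (Sum.inl l)) p -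
        aeval (fun l : Fin n => if l ≤ j then (X (Sum.inr l) : XYRing d) else X (Sum.inl l)) p := by
    induction p using MvPolynomial.induction_on with
    | C a => simp only [aeval_C, sub_self, dvd_zero]
    | add p q hp hq =>
      rw [map_add, map_add, add_sub_add_comm]
      exact dvd_add hp hq
    | mul_X p l hp =>
      rw [map_mul, map_mul, aeval_X, aeval_X]
      refine dvd_mul_sub_mul hp ?_
      rcases lt_trichotomy l j with h | h | h
      · simp only [h, h.le, if_true, sub_self, dvd_zero]
      · subst h; simp only [lt_irrefl, le_refl, if_true, if_false, dvd_refl]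
      · simp only [not_lt.2 h.le, not_le.2 h, if_false, sub_self, dvd_zero]
  exact h (genericForm d i)

/-- The incremental quotient `Δ_{ij}(X, Y)`: the exact quotient of the numerator above by
`X_j - Y_j`. -/
def incrementQuot (i j : Fin n) : XYRing d := (dvd_incrementNum d i j).choose

theorem mul_incrementQuot (i j : Fin n) :
    (X (Sum.inl j) - X (Sum.inr j)) * incrementQuot d i j = incrementNum d i j :=
  (dvd_incrementNum d i j).choose_spec.symm

/-- The Bezoutian `Δ(X, Y) = det (Δ_{ij}(X, Y))`. -/
def bezoutian : XYRing d := (Matrix.of (incrementQuot d)).det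

/-- The block `Δ_t`: the columns are indexed by the `T_γ` with `|γ| = t_n - t`, the rows by the
monomials `X^λ` with `|λ| = t`, and the entry is the coefficient of `X^λ` in `Δ_γ(X)`, that is,
the coefficient of `X^λ Y^γ` in `Δ(X, Y)`. -/
def bezoutBlock (t : ℤ) : Matrix (Mon n t) (Mon n (critDegree d - t)) (CoeffRing d) :=
  Matrix.of fun lam γ => coeff (Finsupp.sumElim lam.1 γ.1) (bezoutian d)

/-! ### The Sylvester map -/

/-- The monomial basis of `S^{u,1} ⊕ ⋯ ⊕ S^{u,n}`, where `S^{u,j}` is spanned by the `X^γ` with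
`|γ| = u - d_j` and `γ_i < d_i` for `i < j`. -/
abbrev SylIdx (u : ℤ) : Type :=
  Σ j : Fin n, {γ : Mon n (u - d j) // ∀ i < j, γ.1 i < d i}

instance instFintypeSylIdx (u : ℤ) : Fintype (SylIdx d u) := inferInstance
instance instDecidableEqSylIdx (u : ℤ) : DecidableEq (SylIdx d u) := inferInstance

/-- The matrix `D_u` of `(g_1, …, g_n) ↦ ∑ g_j f_j` from `S^{u,1} ⊕ ⋯ ⊕ S^{u,n}` to `S_u`. -/
def sylvester (u : ℤ) : Matrix (Mon n u) (SylIdx d u) (CoeffRing d) :=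
  Matrix.of fun lam c => coeff lam.1 (monomial c.2.1.1 1 * genericForm d c.1)

/-! ### The matrix `M_t` -/

/-- Rows of `M_t`: the basis of `S_t ⊕ (S^{t_n-t,1} ⊕ ⋯ ⊕ S^{t_n-t,n})^*`. -/
abbrev MRow (t : ℤ) : Type := Mon n t ⊕ SylIdx d (critDegree d - t)

/-- Columns of `M_t`: the basis of `S_{t_n-t}^* ⊕ (S^{t,1} ⊕ ⋯ ⊕ S^{t,n})`. -/
abbrev MCol (t : ℤ) : Type := Mon n (critDegree d - t) ⊕ SylIdx d t

/-- The matrix `M_t` of `Ψ_t`, with blocks `Δ_t`, `D_t`, the transpose of `D_{t_n-t}`, and `0`. -/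
def matM (t : ℤ) : Matrix (MRow d t) (MCol d t) (CoeffRing d) :=
  Matrix.fromBlocks (bezoutBlock d t) (sylvester d t)
    (sylvester d (critDegree d - t)).transpose 0

/-! ### The submatrix `𝔼_t` -/

/-- Monomials `X^γ` in `S_u` with `γ_i ≥ d_i`, `γ_j ≥ d_j` for two different indices `i, j`. -/
abbrev ExtRow (u : ℤ) : Type :=
  {γ : Mon n u // ∃ i j : Fin n, i ≠ j ∧ d i ≤ γ.1 i ∧ d j ≤ γ.1 j}

/-- The monomial bases of the `E^{u,j}`: the `X^γ` in `S^{u,j}` such that `γ_i ≥ d_i` for some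
`i ≠ j`. There is no such monomial for `j = n`. -/
abbrev ExtCol (u : ℤ) : Type :=
  {c : SylIdx d u // ∃ i : Fin n, i ≠ c.1 ∧ d i ≤ c.2.1.1 i}

instance instFintypeExtRow (u : ℤ) : Fintype (ExtRow d u) := inferInstance
instance instDecidableEqExtRow (u : ℤ) : DecidableEq (ExtRow d u) := inferInstance
instance instFintypeExtCol (u : ℤ) : Fintype (ExtCol d u) := inferInstance
instance instDecidableEqExtCol (u : ℤ) : DecidableEq (ExtCol d u) := inferInstance

/-- The block `E_u`, a submatrix of `D_u`. -/
def extBlock (u : ℤ) : Matrix (ExtRow d u) (ExtCol d u) (CoeffRing d) :=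
  (sylvester d u).submatrix Subtype.val Subtype.val

/-- Rows of `𝔼_t`. -/
abbrev EERow (t : ℤ) : Type := ExtRow d t ⊕ ExtCol d (critDegree d - t)

/-- Columns of `𝔼_t`. -/
abbrev EECol (t : ℤ) : Type := ExtRow d (critDegree d - t) ⊕ ExtCol d t

/-- The submatrix `𝔼_t` of `M_t`. -/
def matE (t : ℤ) : Matrix (EERow d t) (EECol d t) (CoeffRing d) :=
  (matM d t).submatrix (Sum.map Subtype.val Subtype.val) (Sum.map Subtype.val Subtype.val)

theorem matE_eq_fromBlocks (t : ℤ) :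
    matE d t = Matrix.fromBlocks ((bezoutBlock d t).submatrix Subtype.val Subtype.val)
      (extBlock d t) (extBlock d (critDegree d - t)).transpose 0 := by
  ext (r | r) (c | c) <;> rfl

/-- The determinant of `M_t`, for the matching `e` of its rows and columns that is given by the
chosen orders of the monomial bases. Changing the orders can only change the sign. -/
def detM (t : ℤ) (e : MRow d t ≃ MCol d t) : CoeffRing d :=
  ((matM d t).submatrix id e).det

/-- The determinant of `𝔼_t`, for a matching `e` of its rows and columns. It is `1` if the index
sets are empty. -/
def detE (t : ℤ) (e : EERow d t ≃ EECol d t) : CoeffRing d :=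
  ((matE d t).submatrix id e).det

end MacaulayBezout

end

/-!
The proof goes by induction on the number of forms. Signs are handled by comparing elements of
`A = ℤ[a_{α_i}]` up to associates, since the units of `A` are `±1`. A prime `P` of `A` has a generic
zero (`exists_generic_zero`): a system over an algebraically closed field at which exactly the
multiples of `P` vanish. So a divisibility by `P` can be checked on systems.

*The resultant* exists (`exists_isResultant`). The polynomials in the coefficients that vanish at
the generic system with a common zero form a prime ideal, and an elimination argument shows that it
is principal. A system without a common zero is recognized by a maximal minor of its Sylvester map,
by the Nullstellensatz. The resultant is homogeneous of degree `∏_{i ≠ l} d_i` in the coefficients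
of the `l`-th form (`IsResultant.homogIn`): it divides a determinant of Macaulay of this degree, and
it has that many zeros on a line of systems for which the other forms are products of linear forms.

*The resultant divides `det M_t`* (`IsResultant.dvd_det_hat`). At a system with a common zero `p`
the vector of the monomials of degree `t` at `p` kills the columns of `D_t`. It maps `Δ_t` to the
component of degree `t_n - t` of `Δ(p, Y)`. This component lies in the ideal of the forms, because
modulo this ideal `Δ(p, Y)` is annihilated by all `p_j - Y_j`. So it is a combination of the rows
of the transpose of `D_{t_n - t}`, because the restrictions on the multipliers in the Sylvester map
do not change its image (`fullSpan_le_sylSpan`), and the rows of `M_t` are linearly dependent.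

*The quotient* of `det M_t` by the resultant does not involve the last form: a count of monomials
shows that the degree of `det M_t` in its coefficients is at most `∏_{i < n} d_i`
(`homogIn_zero_of_det_hat_eq`). So the quotient can be computed with `X_n^{d_n}` in place of `f_n`.
There the matrices are block triangular with respect to the exponent of `X_n`. Each of the blocks
is either a block of one of the two matrices `E`, or the matrix `M` of the first `n - 1` forms
restricted to `X_n = 0` (`associated_det_hat_of_restrict`); the latter occurs for the `d_n`
exponents less than `d_n`. The resultant becomes the `d_n`-th power of that of the restricted forms
(`IsResultant.associated_evalSys_powLast`). By the induction hypothesis the quotient is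
`± det E_t · det E_{t_n - t} = ± det 𝔼_t`.
-/

noncomputable section

namespace MacaulayBezout

/-! ### Systems of forms -/

section Systems

variable {n : ℕ} {d : Fin n → ℕ} {B C : Type*} [CommRing B] [CommRing C]

/-- The `i`-th form of the system with coefficients `a`. -/
def form (a : CoeffIdx d → B) (i : Fin n) : MvPolynomial (Fin n) B :=
  ∑ α : Mon n (d i), monomial α.1 (a ⟨i, α⟩)

theorem map_form (φ : B →+* C) (a : CoeffIdx d → B) (i : Fin n) :
    map φ (form a i) = form (φ ∘ a) i := by
  simp [form, map_sum, map_monomial]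

theorem form_X : form (X : CoeffIdx d → CoeffRing d) = genericForm d := rfl

theorem specializedForm_eq_form {k : Type} [CommRing k] (a : CoeffIdx d → k) (i : Fin n) :
    specializedForm d a i = form a i := by
  rw [specializedForm, ← form_X, map_form]
  congr 1
  funext v
  simp

theorem coeff_form (a : CoeffIdx d → B) (i : Fin n) (β : Mon n (d i)) :
    coeff β.1 (form a i) = a ⟨i, β⟩ := by
  classical
  rw [form, coeff_sum, Finset.sum_eq_single β]
  · simp
  · intro α _ h
    rw [coeff_monomial, if_neg]
    exact fun h' => h (Subtype.ext h')
  · simp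

theorem form_isHomogeneous (a : CoeffIdx d → B) (i : Fin n) : (form a i).IsHomogeneous (d i) := by
  refine IsHomogeneous.sum _ _ _ fun α _ => isHomogeneous_monomial _ ?_
  exact_mod_cast α.2

/-- A homogeneous polynomial of degree `d i` is the form given by its coefficients. -/
theorem form_eq_of_coeff {a : CoeffIdx d → B} {i : Fin n} {f : MvPolynomial (Fin n) B}
    (hf : f.IsHomogeneous (d i)) (h : ∀ α : Mon n (d i), a ⟨i, α⟩ = coeff α.1 f) :
    form a i = f := by
  ext β
  by_cases hβ : β.degree = d i
  · rw [coeff_form a i ⟨β, by exact_mod_cast hβ⟩, h]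
  · rw [(form_isHomogeneous a i).coeff_eq_zero hβ, hf.coeff_eq_zero hβ]

/-- The coefficients of a family of polynomials. -/
def sysOf (F : Fin n → MvPolynomial (Fin n) B) : CoeffIdx d → B := fun v => coeff v.2.1 (F v.1)

theorem form_sysOf {F : Fin n → MvPolynomial (Fin n) B} {i : Fin n}
    (hF : (F i).IsHomogeneous (d i)) : form (sysOf F : CoeffIdx d → B) i = F i :=
  form_eq_of_coeff hF fun _ => rfl

/-- The system obtained from `a` by replacing its `l`-th form by `g`. -/
def setForm (a : CoeffIdx d → B) (l : Fin n) (g : MvPolynomial (Fin n) B) : CoeffIdx d → B :=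
  fun v => if v.1 = l then coeff v.2.1 g else a v

theorem form_setForm_self (a : CoeffIdx d → B) {l : Fin n} {g : MvPolynomial (Fin n) B}
    (hg : g.IsHomogeneous (d l)) : form (setForm a l g) l = g :=
  form_eq_of_coeff hg fun _ => by simp [setForm]

theorem form_setForm_of_ne (a : CoeffIdx d → B) {l i : Fin n} (g : MvPolynomial (Fin n) B)
    (h : i ≠ l) : form (setForm a l g) i = form a i := by
  simp [form, setForm, h]

theorem comp_setForm (φ : B →+* C) (a : CoeffIdx d → B) (l : Fin n)
    (g : MvPolynomial (Fin n) B) : φ ∘ setForm a l g = setForm (φ ∘ a) l (map φ g) := by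
  funext v
  simp only [setForm, Function.comp_apply, coeff_map]
  split_ifs <;> rfl

/-- The system `X_1^{d_1}, …, X_n^{d_n}`. -/
def powSys (d : Fin n → ℕ) (B : Type*) [CommRing B] : CoeffIdx d → B :=
  sysOf fun i => X i ^ d i

theorem form_powSys (i : Fin n) : form (powSys d B) i = X i ^ d i :=
  form_sysOf (isHomogeneous_X_pow i _)

theorem comp_powSys (φ : B →+* C) : φ ∘ powSys d B = powSys d C := by
  funext v
  simp [powSys, sysOf, ← coeff_map]

/-- The value of a polynomial in the coefficients at a system. -/
def evalSys (a : CoeffIdx d → B) : CoeffRing d →+* B := eval₂Hom (Int.castRingHom B) a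

theorem aeval_eq_evalSys [Algebra ℤ B] (a : CoeffIdx d → B) (F : CoeffRing d) :
    aeval a F = evalSys a F := by
  rw [aeval_def, evalSys, coe_eval₂Hom]
  congr 1
  exact RingHom.ext_int _ _

theorem evalSys_X (a : CoeffIdx d → B) (v : CoeffIdx d) : evalSys a (X v) = a v :=
  eval₂_X _ _ _

theorem evalSys_comp_X (a : CoeffIdx d → B) : evalSys a ∘ X = a := funext (evalSys_X a)

theorem map_evalSys (φ : B →+* C) (a : CoeffIdx d → B) (F : CoeffRing d) :
    φ (evalSys a F) = evalSys (φ ∘ a) F := by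
  rw [evalSys, evalSys, coe_eval₂Hom, coe_eval₂Hom, eval₂_comp_left]
  congr 1
  exact RingHom.ext_int _ _

theorem evalSys_X_left (F : CoeffRing d) : evalSys (X : CoeffIdx d → CoeffRing d) F = F := by
  rw [← aeval_eq_evalSys, aeval_X_left_apply]

theorem map_eq_evalSys (φ : CoeffRing d →+* B) (F : CoeffRing d) : φ F = evalSys (φ ∘ X) F := by
  rw [← map_evalSys, evalSys_X_left]

theorem evalSys_powSys (R : CoeffRing d) :
    evalSys (powSys d B) R = ((eval (powerCoeff d) R : ℤ) : B) := by
  classical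
  have : powSys d B = Int.castRingHom B ∘ powerCoeff d := by
    funext v
    simp only [powSys, sysOf, powerCoeff, coeff_X_pow, Function.comp_apply]
    by_cases h : Finsupp.single v.1 (d v.1) = v.2.1
    · simp [h]
    · rw [if_neg h, if_neg (fun h' => h h'.symm)]; simp
  rw [this, ← map_evalSys, eq_intCast, ← aeval_eq_evalSys]
  rfl

/-- The system obtained from `a` by multiplying the `i`-th form by `s i`. -/
def scale (s : Fin n → B) (a : CoeffIdx d → B) : CoeffIdx d → B := fun v => s v.1 * a v

theorem form_scale (s : Fin n → B) (a : CoeffIdx d → B) (i : Fin n) :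
    form (scale s a) i = MvPolynomial.C (s i) * form a i := by
  simp [form, scale, Finset.mul_sum, C_mul_monomial]

/-- The value of the monomial with exponent `γ` at `p`. -/
def pw (p : Fin n → B) (γ : Fin n →₀ ℕ) : B := ∏ i, p i ^ γ i

theorem eval_monomial_pw (p : Fin n → B) (γ : Fin n →₀ ℕ) (b : B) :
    eval p (monomial γ b) = b * pw p γ := by
  rw [eval_monomial, pw, Finsupp.prod_fintype _ _ (by simp)]

/-- `f` has only monomials of degree `w`; the degree is an integer, as in the index types. -/
def HomDeg (f : MvPolynomial (Fin n) B) (w : ℤ) : Prop :=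
  ∀ γ : Fin n →₀ ℕ, coeff γ f ≠ 0 → (γ.degree : ℤ) = w

theorem eval_eq_sum_mon {f : MvPolynomial (Fin n) B} {w : ℤ} (hf : HomDeg f w)
    (p : Fin n → B) : eval p f = ∑ γ : Mon n w, coeff γ.1 f * pw p γ.1 := by
  classical
  have h1 : f = ∑ γ : Mon n w, monomial γ.1 (coeff γ.1 f) := by
    ext β
    rw [coeff_sum]
    simp only [coeff_monomial]
    by_cases hβ : (β.degree : ℤ) = w
    · rw [Finset.sum_eq_single (⟨β, hβ⟩ : Mon n w)]
      · simp
      · intro γ _ h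
        exact if_neg fun h' => h (Subtype.ext h')
      · simp
    · rw [Finset.sum_eq_zero]
      · by_contra h; exact hβ (hf β h)
      · rintro γ _
        exact if_neg fun (h' : γ.1 = β) => hβ (h' ▸ γ.2)
  conv_lhs => rw [h1]
  simp [map_sum, eval_monomial_pw]

/-- The forms of the system have a common zero in projective space. -/
def Rooted (a : CoeffIdx d → B) : Prop := ∃ p : Fin n → B, p ≠ 0 ∧ ∀ i, eval p (form a i) = 0

end Systems

/-! ### Macaulay matrices -/

section Macaulay

variable {n : ℕ} {d : Fin n → ℕ} {B C : Type*} [CommRing B] [CommRing C]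

/-- The coefficient of `X^r` in `X^s / X_c^{d_c}` times the `c`-th form. It is used only if
`d c ≤ s c`, so that the subtraction is exact. -/
def entry (a : CoeffIdx d → B) (c : Fin n) (r s : Fin n →₀ ℕ) : B :=
  coeff r (monomial (s - Finsupp.single c (d c)) 1 * form a c)

theorem map_entry (φ : B →+* C) (a : CoeffIdx d → B) (c : Fin n) (r s : Fin n →₀ ℕ) :
    φ (entry a c r s) = entry (φ ∘ a) c r s := by
  simp [entry, ← coeff_map, map_form]

theorem single_le_of_le {c : Fin n} {k : ℕ} {s : Fin n →₀ ℕ} (h : k ≤ s c) :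
    Finsupp.single c k ≤ s := by
  classical
  intro i
  rw [Finsupp.single_apply]
  split_ifs with hi
  · exact hi ▸ h
  · exact Nat.zero_le _

theorem sub_single_add {c : Fin n} {k : ℕ} {s : Fin n →₀ ℕ} (h : k ≤ s c) :
    s - Finsupp.single c k + Finsupp.single c k = s :=
  tsub_add_cancel_of_le (single_le_of_le h)

theorem degree_sub_single {c : Fin n} {k : ℕ} {s : Fin n →₀ ℕ} (h : k ≤ s c) :
    (s - Finsupp.single c k).degree + k = s.degree := by
  conv_rhs => rw [← sub_single_add h]
  rw [map_add, Finsupp.degree_single]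

theorem homDeg_monomial_mul_form (a : CoeffIdx d → B) (c : Fin n) {γ : Fin n →₀ ℕ} {w : ℤ}
    (h : (γ.degree : ℤ) + d c = w) : HomDeg (monomial γ 1 * form a c) w := by
  intro β hβ
  have := ((isHomogeneous_monomial (1 : B) (rfl : γ.degree = γ.degree)).mul
    (form_isHomogeneous a c)) hβ
  rw [show Finsupp.weight 1 β = β.degree from
    (congrArg (· β) (Finsupp.degree_eq_weight_one (R := ℕ) (σ := Fin n))).symm] at this
  rw [this]; push_cast; exact h

theorem entry_pow {a : CoeffIdx d → B} {c : Fin n} (ha : form a c = X c ^ d c)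
    {r s : Fin n →₀ ℕ} (hs : d c ≤ s c) : entry a c r s = if r = s then 1 else 0 := by
  classical
  rw [entry, ha, X_pow_eq_monomial, monomial_mul, sub_single_add hs, coeff_monomial, one_mul]
  simp only [eq_comm]

theorem entry_congr {a a' : CoeffIdx d → B} {c : Fin n} (h : form a c = form a' c)
    (r s : Fin n →₀ ℕ) : entry a c r s = entry a' c r s := by
  rw [entry, h, entry]

theorem entry_scale (u : Fin n → B) (a : CoeffIdx d → B) (c : Fin n) (r s : Fin n →₀ ℕ) :
    entry (scale u a) c r s = u c * entry a c r s := by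
  rw [entry, form_scale, mul_left_comm, coeff_C_mul, entry]

theorem sum_pw_mul_coeff_eq_zero {a : CoeffIdx d → B} {p : Fin n → B} {c : Fin n}
    (hp : eval p (form a c) = 0) {w : ℤ} {γ : Fin n →₀ ℕ} (h : (γ.degree : ℤ) + d c = w) :
    ∑ r : Mon n w, pw p r.1 * coeff r.1 (monomial γ 1 * form a c) = 0 := by
  have := eval_eq_sum_mon (homDeg_monomial_mul_form a c h) p
  rw [map_mul, hp, mul_zero] at this
  rw [this]
  exact Finset.sum_congr rfl fun _ _ => mul_comm _ _

variable {ι : Type*}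

/-- The square matrix of the products `X^{b s} / X_{c s}^{d_{c s}} · f_{c s}` with respect to
the monomials `X^{b r}`. -/
def mac (a : CoeffIdx d → B) (b : ι → Fin n →₀ ℕ) (c : ι → Fin n) : Matrix ι ι B :=
  Matrix.of fun r s => entry a (c s) (b r) (b s)

theorem map_mac (φ : B →+* C) (a : CoeffIdx d → B) (b : ι → Fin n →₀ ℕ) (c : ι → Fin n) :
    (mac a b c).map φ = mac (φ ∘ a) b c := by
  ext r s
  exact map_entry _ _ _ _ _

theorem map_det_mac [Fintype ι] [DecidableEq ι] (φ : B →+* C) (a : CoeffIdx d → B)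
    (b : ι → Fin n →₀ ℕ) (c : ι → Fin n) :
    φ (mac a b c).det = (mac (φ ∘ a) b c).det := by
  rw [RingHom.map_det, RingHom.mapMatrix_apply, map_mac]

theorem mac_congr {a a' : CoeffIdx d → B} {b : ι → Fin n →₀ ℕ} {c : ι → Fin n}
    (h : ∀ s, form a (c s) = form a' (c s)) : mac a b c = mac a' b c := by
  ext r s
  exact entry_congr (h s) _ _

theorem mac_pow [DecidableEq ι] {a : CoeffIdx d → B} {b : ι → Fin n →₀ ℕ} {c : ι → Fin n}
    (ha : ∀ s, form a (c s) = X (c s) ^ d (c s)) (hb : Function.Injective b)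
    (hc : ∀ s, d (c s) ≤ b s (c s)) : mac a b c = 1 := by
  ext r s
  rw [mac, Matrix.of_apply, entry_pow (ha s) (hc s), Matrix.one_apply]
  simp only [hb.eq_iff]

theorem det_mac_scale [Fintype ι] [DecidableEq ι] (u : Fin n → B) (a : CoeffIdx d → B)
    (b : ι → Fin n →₀ ℕ) (c : ι → Fin n) :
    (mac (scale u a) b c).det = (∏ s, u (c s)) * (mac a b c).det := by
  rw [← Matrix.det_mul_row]
  congr 1
  ext r s
  exact entry_scale _ _ _ _ _

/-- A common zero is a linear relation between the rows of a matrix of products `X^γ f_i` that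
has a row for every monomial of their degree. -/
theorem det_products_eq_zero [IsDomain B] {a : CoeffIdx d → B} (ha : Rooted a) {w : ℕ}
    {γ : Mon n w → Fin n →₀ ℕ} {c : Mon n w → Fin n}
    (hc : ∀ s, ((γ s).degree : ℤ) + d (c s) = w) :
    (Matrix.of fun r s : Mon n w => coeff r.1 (monomial (γ s) 1 * form a (c s))).det = 0 := by
  obtain ⟨p, hp0, hp⟩ := ha
  obtain ⟨l, hl⟩ := Function.ne_iff.1 hp0
  rw [← Matrix.exists_vecMul_eq_zero_iff]
  refine ⟨fun r => pw p r.1, Function.ne_iff.2 ⟨⟨Finsupp.single l w, by simp⟩, ?_⟩, ?_⟩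
  · classical
    rw [Pi.zero_apply, pw, Finset.prod_ne_zero_iff]
    intro i _
    rw [Finsupp.single_apply]
    split_ifs with h
    · exact pow_ne_zero _ (h ▸ hl)
    · simp
  · funext s
    exact sum_pw_mul_coeff_eq_zero (hp (c s)) (hc s)

theorem det_mac_eq_zero [IsDomain B] {a : CoeffIdx d → B} (ha : Rooted a) {w : ℕ}
    {c : Mon n w → Fin n} (hc : ∀ s, d (c s) ≤ s.1 (c s)) :
    (mac a (fun s : Mon n w => s.1) c).det = 0 := by
  refine det_products_eq_zero ha (γ := fun s => s.1 - Finsupp.single (c s) (d (c s)))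
    (c := c) fun s => ?_
  have := degree_sub_single (hc s)
  have h2 := s.2
  omega

end Macaulay

/-! ### Exponents and the index sets of the Sylvester map -/

section Indices

variable {n : ℕ} {d : Fin n → ℕ}

theorem exists_first_exceeding {β : Fin n →₀ ℕ} (h : ∃ i, d i ≤ β i) :
    ∃ j, d j ≤ β j ∧ ∀ i < j, β i < d i := by
  obtain ⟨j, hj, hmin⟩ := WellFounded.has_min (wellFounded_lt (α := Fin n)) {i | d i ≤ β i} h
  exact ⟨j, hj, fun i hi => not_le.1 fun h' => hmin i h' hi⟩

/-- The first index `j` with `β_j ≥ d_j`. -/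
def firstExc {β : Fin n →₀ ℕ} (h : ∃ i, d i ≤ β i) : Fin n := (exists_first_exceeding h).choose

theorem le_firstExc {β : Fin n →₀ ℕ} (h : ∃ i, d i ≤ β i) : d (firstExc h) ≤ β (firstExc h) :=
  (exists_first_exceeding h).choose_spec.1

theorem lt_of_lt_firstExc {β : Fin n →₀ ℕ} (h : ∃ i, d i ≤ β i) {i : Fin n}
    (hi : i < firstExc h) : β i < d i :=
  (exists_first_exceeding h).choose_spec.2 i hi

theorem firstExc_le {β : Fin n →₀ ℕ} (h : ∃ i, d i ≤ β i) {i : Fin n} (hi : d i ≤ β i) :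
    firstExc h ≤ i :=
  not_lt.1 fun h' => (lt_of_lt_firstExc h h').not_ge hi

theorem firstExc_eq {β : Fin n →₀ ℕ} (h : ∃ i, d i ≤ β i) {j : Fin n} (hj : d j ≤ β j)
    (hlt : ∀ i < j, β i < d i) : firstExc h = j :=
  le_antisymm (firstExc_le h hj) (not_lt.1 fun h' => (hlt _ h').not_ge (le_firstExc h))

variable (d)

/-- Monomials of degree `u` that are divisible by some `X_i^{d_i}`. -/
abbrev Exc (u : ℤ) : Type := {γ : Mon n u // ∃ i, d i ≤ γ.1 i}

/-- Monomials of degree `u` that are divisible by no `X_i^{d_i}`. -/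
abbrev Red (u : ℤ) : Type := {γ : Mon n u // ∀ i, γ.1 i < d i}

/-- Monomials of degree `w` that are divisible by `X_i^{d_i}` for some `i < j`. -/
abbrev PartExc (j : Fin n) (w : ℤ) : Type := {γ : Mon n w // ∃ i < j, d i ≤ γ.1 i}

variable {d}

theorem sylIdx_ext {u : ℤ} {c c' : SylIdx d u} (h : c.1 = c'.1) (h2 : c.2.1.1 = c'.2.1.1) :
    c = c' := by
  obtain ⟨j, ⟨γ, h⟩, h'⟩ := c
  obtain ⟨j', ⟨γ', g⟩, g'⟩ := c'
  obtain rfl : j = j' := h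
  obtain rfl : γ = γ' := h2
  rfl

variable (d) in
/-- The column of `X^γ f_j` in the Sylvester matrix corresponds to the monomial
`X^γ X_j^{d_j}`, and every monomial that is divisible by some `X_i^{d_i}` arises once. -/
def excEquiv (u : ℤ) : SylIdx d u ≃ Exc d u where
  toFun c := ⟨⟨c.2.1.1 + Finsupp.single c.1 (d c.1), by
    have := c.2.1.2
    rw [map_add, Finsupp.degree_single]
    push_cast
    omega⟩, c.1, by simp⟩
  invFun γ := ⟨firstExc γ.2, ⟨γ.1.1 - Finsupp.single (firstExc γ.2) (d (firstExc γ.2)), by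
    have := degree_sub_single (le_firstExc γ.2)
    have h2 := γ.1.2
    omega⟩, fun i hi => by
    have := lt_of_lt_firstExc γ.2 hi
    simp only [Finsupp.coe_tsub, Pi.sub_apply]
    omega⟩
  left_inv c := by
    have h : ∃ i, d i ≤ (c.2.1.1 + Finsupp.single c.1 (d c.1)) i := ⟨c.1, by simp⟩
    have h1 : firstExc h = c.1 := by
      refine firstExc_eq h (by simp) fun i hi => ?_
      have := c.2.2 i hi
      rw [Finsupp.add_apply, Finsupp.single_eq_of_ne hi.ne]
      exact this
    refine sylIdx_ext h1 ?_
    change c.2.1.1 + Finsupp.single c.1 (d c.1) -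
      Finsupp.single (firstExc h) (d (firstExc h)) = c.2.1.1
    rw [h1, add_tsub_cancel_right]
  right_inv γ := by
    refine Subtype.ext (Subtype.ext ?_)
    exact sub_single_add (le_firstExc γ.2)

theorem excEquiv_coe {u : ℤ} (c : SylIdx d u) :
    (excEquiv d u c).1.1 = c.2.1.1 + Finsupp.single c.1 (d c.1) := rfl

end Indices

/-! ### The degree components of the ideal of a system -/

section Image

variable {n : ℕ} {d : Fin n → ℕ} {B C : Type*} [CommRing B] [CommRing C]

/-- The minor of the products `X^γ f_i`, `i < j`, of degree `w`, with `X^γ` reduced with respect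
to the preceding forms, at the monomials that are divisible by some `X_i^{d_i}`, `i < j`. -/
def partDet (a : CoeffIdx d → B) (j : Fin n) (w : ℤ) : B :=
  (mac a (fun s : PartExc d j w => s.1.1)
    (fun s => firstExc (s.2.imp fun _ h => h.2 : ∃ i, d i ≤ s.1.1 i))).det

theorem firstExc_lt_of_partExc {j : Fin n} {w : ℤ} (s : PartExc d j w) :
    firstExc (s.2.imp fun _ h => h.2 : ∃ i, d i ≤ s.1.1 i) < j := by
  obtain ⟨i, hi, hd⟩ := s.2
  exact (firstExc_le _ hd).trans_lt hi

theorem map_partDet (φ : B →+* C) (a : CoeffIdx d → B) (j : Fin n) (w : ℤ) :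
    φ (partDet a j w) = partDet (φ ∘ a) j w :=
  map_det_mac _ _ _ _

theorem partDet_eq_one {a : CoeffIdx d → B} {j : Fin n}
    (ha : ∀ i < j, form a i = X i ^ d i) (w : ℤ) : partDet a j w = 1 := by
  rw [partDet, mac_pow (fun s => ha _ (firstExc_lt_of_partExc s))
    (fun s s' h => Subtype.ext (Subtype.ext h)) (fun s => le_firstExc _), Matrix.det_one]

variable {K : Type*} [Field K]

/-- The span of the products `X^γ f_i` of degree `u`. -/
def fullSpan (a : CoeffIdx d → K) (u : ℤ) : Submodule K (MvPolynomial (Fin n) K) :=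
  Submodule.span K {f | ∃ (i : Fin n) (γ : Fin n →₀ ℕ), (γ.degree : ℤ) + d i = u ∧
    f = monomial γ 1 * form a i}

/-- The span of the columns of the Sylvester matrix of degree `u`. -/
def sylSpan (a : CoeffIdx d → K) (u : ℤ) : Submodule K (MvPolynomial (Fin n) K) :=
  Submodule.span K (Set.range fun c : SylIdx d u => monomial c.2.1.1 1 * form a c.1)

theorem homogeneousComponent_mem_fullSpan {a : CoeffIdx d → K} {g : MvPolynomial (Fin n) K}
    (hg : g ∈ Ideal.span (Set.range (form a))) (u : ℕ) :
    homogeneousComponent u g ∈ fullSpan a u := by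
  obtain ⟨h, rfl⟩ := Ideal.mem_span_range_iff_exists_fun.1 hg
  rw [map_sum]
  refine Submodule.sum_mem _ fun i _ => ?_
  induction h i using MvPolynomial.induction_on' with
  | add p q hp hq =>
    rw [add_mul, map_add]
    exact Submodule.add_mem _ hp hq
  | monomial γ b =>
    have hmem : (monomial γ b * form a i) ∈ homogeneousSubmodule (Fin n) K (γ.degree + d i) :=
      (isHomogeneous_monomial b rfl).mul (form_isHomogeneous a i)
    rw [homogeneousComponent_of_mem hmem]
    split_ifs with hu
    · have : monomial γ b * form a i = b • (monomial γ 1 * form a i) := by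
        rw [← smul_mul_assoc, smul_monomial, smul_eq_mul, mul_one]
      rw [this]
      exact Submodule.smul_mem _ _ (Submodule.subset_span ⟨i, γ, by exact_mod_cast hu.symm, rfl⟩)
    · exact Submodule.zero_mem _

theorem eq_sum_mon {B : Type*} [CommRing B] {f : MvPolynomial (Fin n) B} {w : ℤ}
    (hf : HomDeg f w) : f = ∑ γ : Mon n w, coeff γ.1 f • monomial γ.1 1 := by
  classical
  ext β
  simp only [coeff_sum, coeff_smul, coeff_monomial, smul_eq_mul]
  by_cases hβ : (β.degree : ℤ) = w
  · rw [Finset.sum_eq_single (⟨β, hβ⟩ : Mon n w)]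
    · simp
    · intro γ _ h
      rw [if_neg fun h' => h (Subtype.ext h'), mul_zero]
    · simp
  · rw [Finset.sum_eq_zero]
    · by_contra h; exact hβ (hf β h)
    · rintro γ _
      rw [if_neg fun (h' : γ.1 = β) => hβ (h' ▸ γ.2), mul_zero]

/-- Modulo the products of `f_i`, `i < j`, every monomial is a combination of monomials that are
reduced with respect to `X_i^{d_i}`, `i < j`. -/
theorem monomial_mem_of_partDet_ne_zero {a : CoeffIdx d → K} {j : Fin n} {w : ℤ}
    (hG : partDet a j w ≠ 0) (V : Submodule K (MvPolynomial (Fin n) K))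
    (hV : ∀ i < j, ∀ δ : Fin n →₀ ℕ, (δ.degree : ℤ) + d i = w → monomial δ 1 * form a i ∈ V)
    (hV' : ∀ δ : Mon n w, (∀ i < j, δ.1 i < d i) → monomial δ.1 1 ∈ V)
    (γ : Mon n w) : monomial γ.1 1 ∈ V := by
  classical
  by_cases hγ : ∃ i < j, d i ≤ γ.1 i
  swap
  · push Not at hγ
    exact hV' γ hγ
  set N := mac a (fun s : PartExc d j w => s.1.1)
    (fun s => firstExc (s.2.imp fun _ h => h.2 : ∃ i, d i ≤ s.1.1 i)) with hN
  have hdet : IsUnit N.det := isUnit_iff_ne_zero.2 hG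
  -- the part of each column of `N` at the monomials of `PartExc` lies in `V`
  have key : ∀ s : PartExc d j w, ∑ r : PartExc d j w, N r s • monomial r.1.1 (1 : K) ∈ V := by
    intro s
    have hle := le_firstExc (s.2.imp fun _ h => h.2 : ∃ i, d i ≤ s.1.1 i)
    have hdeg : (((s.1.1 - Finsupp.single (firstExc (s.2.imp fun _ h => h.2)) (d (firstExc
        (s.2.imp fun _ h => h.2))) : Fin n →₀ ℕ).degree : ℤ) +
        d (firstExc (s.2.imp fun _ h => h.2 : ∃ i, d i ≤ s.1.1 i))) = w := by
      refine Eq.trans ?_ s.1.2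
      exact_mod_cast degree_sub_single hle
    have h1 := hV _ (firstExc_lt_of_partExc s) _ hdeg
    rw [eq_sum_mon (homDeg_monomial_mul_form a _ hdeg),
      ← Fintype.sum_subtype_add_sum_subtype (fun γ : Mon n w => ∃ i < j, d i ≤ γ.1 i)] at h1
    refine (Submodule.add_mem_iff_left _ (Submodule.sum_mem _ fun r _ => ?_)).1 h1
    refine Submodule.smul_mem _ _ (hV' _ ?_)
    have := r.2
    push Not at this
    exact this
  have : monomial γ.1 (1 : K) = ∑ s : PartExc d j w, N⁻¹ s ⟨γ, hγ⟩ •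
      ∑ r : PartExc d j w, N r s • monomial r.1.1 (1 : K) := by
    simp only [Finset.smul_sum, smul_smul]
    rw [Finset.sum_comm]
    simp only [← Finset.sum_smul]
    rw [Finset.sum_eq_single (⟨γ, hγ⟩ : PartExc d j w)]
    · have : ∑ s, N⁻¹ s ⟨γ, hγ⟩ * N ⟨γ, hγ⟩ s = (N * N⁻¹) ⟨γ, hγ⟩ ⟨γ, hγ⟩ := by
        rw [Matrix.mul_apply]; exact Finset.sum_congr rfl fun _ _ => mul_comm _ _
      rw [this, Matrix.mul_nonsing_inv _ hdet, Matrix.one_apply_eq, one_smul]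
    · intro r _ hr
      have : ∑ s, N⁻¹ s ⟨γ, hγ⟩ * N r s = (N * N⁻¹) r ⟨γ, hγ⟩ := by
        rw [Matrix.mul_apply]; exact Finset.sum_congr rfl fun _ _ => mul_comm _ _
      rw [this, Matrix.mul_nonsing_inv _ hdet, Matrix.one_apply_ne hr, zero_smul]
    · simp
  rw [this]
  exact Submodule.sum_mem _ fun s _ => Submodule.smul_mem _ _ (key s)

/-- If the minors `partDet` do not vanish, the Sylvester map has the same image as the map
without restrictions on the multipliers. -/
theorem fullSpan_le_sylSpan {a : CoeffIdx d → K} {u : ℤ} (hG : ∀ j, partDet a j (u - d j) ≠ 0) :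
    fullSpan a u ≤ sylSpan a u := by
  refine Submodule.span_le.2 ?_
  rintro _ ⟨j, γ, hγ, rfl⟩
  induction j using WellFoundedLT.induction generalizing γ with
  | ind j ih =>
  refine monomial_mem_of_partDet_ne_zero (hG j)
    ((sylSpan a u).comap (LinearMap.mulRight K (form a j))) ?_ ?_ ⟨γ, by omega⟩
  · intro i hi δ hδ
    rw [Submodule.mem_comap, LinearMap.mulRight_apply, mul_right_comm,
      eq_sum_mon (homDeg_monomial_mul_form a j (rfl : (δ.degree : ℤ) + d j = _)), Finset.sum_mul]
    refine Submodule.sum_mem _ fun ε _ => ?_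
    rw [smul_mul_assoc]
    refine Submodule.smul_mem _ _ (ih i hi _ ?_)
    rw [ε.2]; omega
  · intro δ hδ
    exact Submodule.subset_span ⟨⟨j, δ, hδ⟩, rfl⟩

theorem exists_monomial_mem_of_not_rooted [IsAlgClosed K] {a : CoeffIdx d → K}
    (ha : ¬ Rooted a) : ∃ N : ℕ, ∀ γ : Fin n →₀ ℕ, N ≤ γ.degree →
      monomial γ (1 : K) ∈ Ideal.span (Set.range (form a)) := by
  classical
  set I := Ideal.span (Set.range (form a)) with hI
  have hX : ∀ i, ∃ N, (X i : MvPolynomial (Fin n) K) ^ N ∈ I := by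
    intro i
    have : (X i : MvPolynomial (Fin n) K) ∈ I.radical := by
      rw [← vanishingIdeal_zeroLocus_eq_radical (K := K), mem_vanishingIdeal_iff]
      intro p hp
      rw [aeval_X]
      by_contra h
      refine ha ⟨p, fun h' => h (by rw [h']; rfl), fun i => ?_⟩
      exact (mem_zeroLocus_iff.1 hp) _ (Ideal.subset_span ⟨i, rfl⟩)
    exact this
  choose N hN using hX
  refine ⟨∑ i, N i + 1, fun γ hγ => ?_⟩
  have : ∃ i, N i ≤ γ i := by
    by_contra h
    push Not at h
    rw [Finsupp.degree_eq_sum] at hγ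
    have := Finset.sum_le_sum fun i (_ : i ∈ Finset.univ) => (h i).le
    omega
  obtain ⟨i, hi⟩ := this
  rw [← sub_single_add hi, ← one_mul (1 : K), ← monomial_mul, ← X_pow_eq_monomial]
  exact I.mul_mem_left _ (hN i)

theorem rooted_of_partDet_ne_zero [IsAlgClosed K] (hd : ∀ i, 0 < d i) {a : CoeffIdx d → K}
    {l : Fin n} (hl : form a l = 0) (hG : ∀ j w, partDet a j w ≠ 0) : Rooted a := by
  classical
  by_contra ha
  obtain ⟨N, hN⟩ := exists_monomial_mem_of_not_rooted ha
  let v : {c : SylIdx d (N : ℤ) // c.1 ≠ l} → MvPolynomial (Fin n) K :=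
    fun c => monomial c.1.2.1.1 1 * form a c.1.1
  have hmem : ∀ γ : Mon n N, monomial γ.1 (1 : K) ∈ Submodule.span K (Set.range v) := by
    intro γ
    have hγ : γ.1.degree = N := by exact_mod_cast γ.2
    have h1 := homogeneousComponent_mem_fullSpan (hN γ.1 hγ.ge) N
    rw [homogeneousComponent_of_mem (isHomogeneous_monomial _ rfl : _ ∈ homogeneousSubmodule _ _ _),
      if_pos hγ.symm] at h1
    refine (Submodule.span_le.2 ?_) (fullSpan_le_sylSpan (fun j => hG j _) h1)
    rintro _ ⟨c, rfl⟩
    by_cases hc : c.1 = l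
    · simp [hc, hl]
    · exact Submodule.subset_span ⟨⟨c, hc⟩, rfl⟩
  have hli : LinearIndependent K (fun γ : Mon n N => monomial γ.1 (1 : K)) := by
    have := (basisMonomials (Fin n) K).linearIndependent.comp
      (fun γ : Mon n N => γ.1) Subtype.val_injective
    simpa [Function.comp_def] using this
  have hcard : Fintype.card (Mon n N) ≤ Fintype.card {c : SylIdx d (N : ℤ) // c.1 ≠ l} := by
    refine (linearIndependent_le_span_aux' _ hli (Set.range v) ?_).trans
      (Fintype.card_le_of_surjective _ Set.rangeFactorization_surjective)
    rintro _ ⟨γ, rfl⟩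
    exact hmem γ
  refine hcard.not_gt (Fintype.card_lt_of_injective_not_surjective
    (fun c => (excEquiv d N c.1).1) ?_ ?_)
  · intro c c' h
    exact Subtype.ext ((excEquiv d N).injective (Subtype.ext h))
  · intro hs
    obtain ⟨c, hc⟩ := hs ⟨Finsupp.single l N, by simp⟩
    have := congrArg (fun γ : Mon n N => γ.1 c.1.1) hc
    simp only [excEquiv_coe, Finsupp.add_apply, Finsupp.single_eq_same,
      Finsupp.single_eq_of_ne c.2] at this
    have := hd c.1.1
    omega

end Image

/-! ### Systems with a common zero -/

section Param

variable {n : ℕ} {d : Fin n → ℕ} {B C : Type*} [CommRing B] [CommRing C]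

theorem pw_smul (s : B) (p : Fin n → B) (γ : Fin n →₀ ℕ) :
    pw (s • p) γ = s ^ γ.degree * pw p γ := by
  simp [pw, mul_pow, Finset.prod_mul_distrib, Finset.prod_pow_eq_pow_sum, Finsupp.degree_eq_sum]

theorem eval_smul_form (a : CoeffIdx d → B) (i : Fin n) (s : B) (p : Fin n → B) :
    eval (s • p) (form a i) = s ^ d i * eval p (form a i) := by
  simp only [form, map_sum, eval_monomial_pw, pw_smul, Finset.mul_sum]
  refine Finset.sum_congr rfl fun α _ => ?_
  rw [show α.1.degree = d i by exact_mod_cast α.2]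
  ring

/-- The system obtained from `a` by changing the coefficient of `X_j^{d_i}` in the `i`-th form so
that all forms vanish at `p`, provided that `p_j = 1`. -/
def solve (j : Fin n) (p : Fin n → B) (a : CoeffIdx d → B) : CoeffIdx d → B :=
  open Classical in
  fun v => if v.2.1 = Finsupp.single j (d v.1) then a v - eval p (form a v.1) else a v

theorem form_solve (j : Fin n) (p : Fin n → B) (a : CoeffIdx d → B) (i : Fin n) :
    form (solve j p a) i = form a i - MvPolynomial.C (eval p (form a i)) * X j ^ d i := by
  refine form_eq_of_coeff ((form_isHomogeneous a i).sub (isHomogeneous_C_mul_X_pow _ _ _))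
    fun α => ?_
  classical
  rw [coeff_sub, coeff_form, coeff_C_mul, coeff_X_pow, solve]
  by_cases h : α.1 = Finsupp.single j (d i)
  · simp [h]
  · simp [h, Ne.symm h]

theorem eval_form_solve {j : Fin n} {p : Fin n → B} (hp : p j = 1) (a : CoeffIdx d → B)
    (i : Fin n) : eval p (form (solve j p a) i) = 0 := by
  simp [form_solve, hp]

theorem solve_eq_self {j : Fin n} {p : Fin n → B} {a : CoeffIdx d → B}
    (h : ∀ i, eval p (form a i) = 0) : solve j p a = a := by
  funext v
  simp [solve, h]

theorem eval_comp_form (φ : B →+* C) (p : Fin n → B) (a : CoeffIdx d → B) (i : Fin n) :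
    eval (φ ∘ p) (form (φ ∘ a) i) = φ (eval p (form a i)) := by
  rw [← map_form, eval_map, eval₂_comp, ← coe_eval₂Hom, coe_eval₂Hom]

theorem comp_solve (φ : B →+* C) (j : Fin n) (p : Fin n → B) (a : CoeffIdx d → B) :
    φ ∘ solve j p a = solve j (φ ∘ p) (φ ∘ a) := by
  funext v
  simp only [solve, Function.comp_apply, apply_ite φ, map_sub, eval_comp_form]

variable (d)

/-- The ring of the universal system that vanishes at a point with one coordinate `1`. -/
abbrev ParamRing : Type := MvPolynomial (CoeffIdx d ⊕ Fin n) ℤ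

/-- The generic point with `j`-th coordinate `1`. -/
def paramPoint (j : Fin n) : Fin n → ParamRing d := fun i => if i = j then 1 else X (Sum.inr i)

/-- The universal system that vanishes at `paramPoint d j`. -/
def paramSys (j : Fin n) : CoeffIdx d → ParamRing d :=
  solve j (paramPoint d j) fun v => X (Sum.inl v)

variable {d}

theorem paramPoint_self (j : Fin n) : paramPoint d j j = 1 := by simp [paramPoint]

theorem paramPoint_ne_zero (j i : Fin n) : paramPoint d j i ≠ 0 := by
  unfold paramPoint
  split_ifs
  · exact one_ne_zero
  · exact X_ne_zero _

theorem evalSys_eq_zero_of_param {j : Fin n} {F : CoeffRing d}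
    (hF : evalSys (paramSys d j) F = 0) {a : CoeffIdx d → B} {p : Fin n → B} (hj : p j = 1)
    (hp : ∀ i, eval p (form a i) = 0) : evalSys a F = 0 := by
  let φ : ParamRing d →+* B := (aeval (Sum.elim a p) : ParamRing d →ₐ[ℤ] B).toRingHom
  have h1 : φ ∘ paramPoint d j = p := by
    funext i
    by_cases hi : i = j
    · subst hi; simp [paramPoint, hj]
    · simp [paramPoint, hi, φ]
  have h2 : φ ∘ (fun v => X (Sum.inl v)) = a := by
    funext v
    simp [φ]
  have h3 : φ ∘ paramSys d j = a := by
    rw [paramSys, comp_solve, h1, h2, solve_eq_self hp]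
  rw [← h3, ← map_evalSys, hF, map_zero]

theorem evalSys_eq_zero_of_param_of_ne_zero {K : Type*} [Field K] {j : Fin n} {F : CoeffRing d}
    (hF : evalSys (paramSys d j) F = 0) {a : CoeffIdx d → K} {p : Fin n → K} (hj : p j ≠ 0)
    (hp : ∀ i, eval p (form a i) = 0) : evalSys a F = 0 := by
  refine evalSys_eq_zero_of_param hF (p := (p j)⁻¹ • p) (by simp [hj]) fun i => ?_
  rw [eval_smul_form, hp, mul_zero]

theorem param_eq_zero_iff (i j : Fin n) {F : CoeffRing d}
    (hF : evalSys (paramSys d i) F = 0) : evalSys (paramSys d j) F = 0 := by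
  let φ := algebraMap (ParamRing d) (FractionRing (ParamRing d))
  have hφ : Function.Injective φ := IsFractionRing.injective _ _
  apply hφ
  rw [map_evalSys, map_zero]
  refine evalSys_eq_zero_of_param_of_ne_zero hF (p := φ ∘ paramPoint d j) ?_ fun k => ?_
  · exact (map_ne_zero_iff φ hφ).2 (paramPoint_ne_zero j i)
  · rw [eval_comp_form, paramSys, eval_form_solve (paramPoint_self j), map_zero]

/-- A polynomial that vanishes at the universal system with a zero at which one coordinate is `1`
vanishes at all systems with a common zero. -/
theorem evalSys_eq_zero_of_rooted {K : Type*} [Field K] {j : Fin n} {F : CoeffRing d}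
    (hF : evalSys (paramSys d j) F = 0) {a : CoeffIdx d → K} (ha : Rooted a) : evalSys a F = 0 := by
  obtain ⟨p, hp0, hp⟩ := ha
  obtain ⟨l, hl⟩ := Function.ne_iff.1 hp0
  exact evalSys_eq_zero_of_param_of_ne_zero (param_eq_zero_iff j l hF) hl hp

theorem rooted_paramSys (j : Fin n) : Rooted (paramSys d j) :=
  ⟨paramPoint d j, fun h => paramPoint_ne_zero (d := d) j j (congrFun h j), fun i =>
    eval_form_solve (paramPoint_self j) _ i⟩

end Param

/-! ### Existence of the resultant -/

section Gauss

open Polynomial in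
/-- A prime element of the kernel of `A₀[X] → L` generates the kernel if `A₀` embeds in `L`. -/
theorem dvd_of_mem_ker {A₀ L : Type*} [CommRing A₀] [IsDomain A₀] [UniqueFactorizationMonoid A₀]
    [Field L] (θ : Polynomial A₀ →+* L)
    (hθ : Function.Injective (θ.comp (Polynomial.C : A₀ →+* Polynomial A₀)))
    {r f : Polynomial A₀} (hr : Prime r) (hr0 : θ r = 0) (hf0 : θ f = 0) : r ∣ f := by
  classical
  have := Classical.choice (inferInstance : Nonempty (NormalizedGCDMonoid A₀))
  let K₀ := FractionRing A₀
  have hdeg : r.natDegree ≠ 0 := by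
    intro h
    rw [Polynomial.natDegree_eq_zero] at h
    obtain ⟨c, rfl⟩ := h
    have : c = 0 := hθ (by simpa using hr0)
    exact hr.ne_zero (by rw [this, Polynomial.C_0])
  have hirr : Irreducible (r.map (algebraMap A₀ K₀)) :=
    ((hr.irreducible.isPrimitive hdeg).irreducible_iff_irreducible_map_fraction_map).1
      hr.irreducible
  let ψ : Polynomial K₀ →+* L := Polynomial.eval₂RingHom (IsFractionRing.lift hθ) (θ X)
  have hψ : ∀ g : Polynomial A₀, ψ (g.map (algebraMap A₀ K₀)) = θ g := by
    intro g
    have : ψ.comp (Polynomial.mapRingHom (algebraMap A₀ K₀)) = θ := by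
      ext x
      · simp [ψ, IsFractionRing.lift_algebraMap]
      · simp [ψ]
    exact congrArg (fun h : Polynomial A₀ →+* L => h g) this
  have hdvd : r.map (algebraMap A₀ K₀) ∣ f.map (algebraMap A₀ K₀) := by
    by_contra h
    obtain ⟨u, v, huv⟩ := (hirr.coprime_iff_not_dvd).2 h
    have := congrArg ψ huv
    rw [map_add, map_mul, map_mul, hψ, hψ, hr0, hf0, map_one] at this
    simp at this
  obtain ⟨q, hq⟩ := hdvd
  obtain ⟨b, hbM, hb⟩ := IsLocalization.integerNormalization_spec (nonZeroDivisors A₀) q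
  have hb0 : b ≠ 0 := nonZeroDivisors.ne_zero hbM
  have hmul : Polynomial.C b * f =
      r * IsLocalization.integerNormalization (nonZeroDivisors A₀) q := by
    apply Polynomial.map_injective (algebraMap A₀ K₀) (IsFractionRing.injective _ _)
    rw [Polynomial.map_mul, Polynomial.map_mul, hb, hq, Polynomial.map_C, Algebra.smul_def]
    rw [show algebraMap A₀ (Polynomial K₀) b = Polynomial.C (algebraMap A₀ K₀ b) from rfl]
    ring
  rcases hr.dvd_or_dvd (Dvd.intro _ hmul.symm) with h | h
  · have := Polynomial.natDegree_le_of_dvd h (by simp [hb0])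
    rw [Polynomial.natDegree_C] at this
    omega
  · exact h

end Gauss

section Existence

variable {n : ℕ} {d : Fin n → ℕ}

theorem exists_exceeding_of_degree (hn : 0 < n) {γ : Fin n →₀ ℕ}
    (hγ : ∑ i, d i ≤ γ.degree) : ∃ i, d i ≤ γ i := by
  by_contra h
  push Not at h
  rw [Finsupp.degree_eq_sum] at hγ
  have : Nonempty (Fin n) := ⟨⟨0, hn⟩⟩
  exact hγ.not_gt (Finset.sum_lt_sum_of_nonempty Finset.univ_nonempty fun i _ => h i)

/-- The generic point: the coefficients as elements of an algebraic closure of the field of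
fractions of `A`. -/
abbrev GenField (d : Fin n → ℕ) : Type := AlgebraicClosure (FractionRing (CoeffRing d))

theorem algebraMap_genField_injective :
    Function.Injective (algebraMap (CoeffRing d) (GenField d)) := by
  rw [IsScalarTower.algebraMap_eq (CoeffRing d) (FractionRing (CoeffRing d)) (GenField d)]
  exact (algebraMap (FractionRing (CoeffRing d)) (GenField d)).injective.comp
    (IsFractionRing.injective _ _)

/-- A polynomial in the coefficients of the generic system that takes a nonzero value at some
specialization is nonzero at the generic point. -/
theorem partDet_setForm_ne_zero (l : Fin n) (hl : ∀ i, i ≤ l) (j : Fin n) (w : ℤ) :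
    partDet (setForm (algebraMap (CoeffRing d) (GenField d) ∘ X) l 0) j w ≠ 0 := by
  have h0 : (0 : MvPolynomial (Fin n) (GenField d)) =
      map (algebraMap (CoeffRing d) (GenField d)) 0 := by rw [map_zero]
  rw [h0, ← comp_setForm, ← map_partDet, map_ne_zero_iff _ algebraMap_genField_injective]
  intro h
  have := congrArg (evalSys (powSys d ℚ)) h
  rw [map_partDet, map_zero, partDet_eq_one] at this
  · exact one_ne_zero this
  · intro i hi
    have hne : i ≠ l := (hi.trans_le (hl j)).ne
    rw [comp_setForm, form_setForm_of_ne _ _ hne]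
    rw [evalSys_comp_X, form_powSys]

/-- A polynomial that vanishes at all systems with a common zero, and that does not involve the
coefficient of `X_l^{d_l}` in the last form `f_l`, vanishes: for generic `f_i`, `i ≠ l`, this
coefficient can be chosen such that a common zero of the `f_i`, `i ≠ l`, is a zero of `f_l`. -/
theorem eq_zero_of_agree (hd : ∀ i, 0 < d i) (l : Fin n) (hl : ∀ i, i ≤ l) {F : CoeffRing d}
    (hF : evalSys (paramSys d l) F = 0)
    (hFv : ∀ a a' : CoeffIdx d → GenField d,
      (∀ v, v.2.1 ≠ Finsupp.single l (d l) ∨ v.1 ≠ l → a v = a' v) → evalSys a F = evalSys a' F) :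
    F = 0 := by
  classical
  have hn : 0 < n := l.pos
  let K := GenField d
  let ι := algebraMap (CoeffRing d) K
  let g : CoeffIdx d → K := ι ∘ X
  have hg : evalSys g F = ι F := (map_eq_evalSys ι F).symm
  obtain ⟨p, hp0, hp⟩ := rooted_of_partDet_ne_zero hd
    (form_setForm_self (ι ∘ X) (isHomogeneous_zero _ _ _))
    (fun j w => partDet_setForm_ne_zero l hl j w)
  have hpi : ∀ i, i ≠ l → eval p (form g i) = 0 := fun i hi => by
    rw [← hp i, form_setForm_of_ne _ _ hi]
  have hpl : p l ≠ 0 := by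
    intro h
    have hroot : Rooted (setForm g l (X l ^ d l)) := by
      refine ⟨p, hp0, fun i => ?_⟩
      by_cases hi : i = l
      · subst hi
        rw [form_setForm_self _ (isHomogeneous_X_pow _ _), map_pow, eval_X, h,
          zero_pow (hd i).ne']
      · rw [form_setForm_of_ne _ _ hi, hpi i hi]
    have hex : ∀ s : Mon n ((∑ i, d i : ℕ) : ℤ), ∃ i, d i ≤ s.1 i := fun s =>
      exists_exceeding_of_degree hn (by have := s.2; exact_mod_cast this.ge)
    have h1 := det_mac_eq_zero hroot (c := fun s => firstExc (hex s)) fun s => le_firstExc _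
    have h2 : (X l ^ d l : MvPolynomial (Fin n) K) = map ι (X l ^ d l) := by simp
    rw [h2, ← comp_setForm, ← map_det_mac,
      map_eq_zero_iff _ algebraMap_genField_injective] at h1
    have h3 := congrArg (evalSys (powSys d ℚ)) h1
    rw [map_det_mac, map_zero, mac_pow, Matrix.det_one] at h3
    · exact one_ne_zero h3
    · intro s
      rw [comp_setForm]
      by_cases hi : firstExc (hex s) = l
      · rw [hi, form_setForm_self]
        · simp
        · rw [map_pow, map_X]; exact isHomogeneous_X_pow _ _
      · rw [form_setForm_of_ne _ _ hi]
        rw [evalSys_comp_X, form_powSys]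
    · exact fun s s' h => Subtype.ext h
    · exact fun s => le_firstExc _
  set q := (p l)⁻¹ • p with hq
  have hql : q l = 1 := by simp [hq, hpl]
  have h1 := evalSys_eq_zero_of_param hF hql (eval_form_solve hql g)
  rw [hFv (solve l q g) g, hg] at h1
  · exact (map_eq_zero_iff _ algebraMap_genField_injective).1 h1
  · intro v hv
    by_cases hvl : v.1 = l
    · have : v.2.1 ≠ Finsupp.single l (d v.1) := by
        have h2 := hv.resolve_right (not_not.2 hvl)
        rwa [← congrArg d hvl] at h2
      simp [solve, this]
    · have : eval q (form g v.1) = 0 := by rw [hq, eval_smul_form, hpi _ hvl, mul_zero]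
      simp [solve, this]

/-- The polynomials that vanish at all systems with a common zero are the multiples of any prime
among them. -/
theorem dvd_of_param_eq_zero (hd : ∀ i, 0 < d i) (l : Fin n) (hl : ∀ i, i ≤ l)
    {R F : CoeffRing d} (hR : Prime R) (hR0 : evalSys (paramSys d l) R = 0)
    (hF : evalSys (paramSys d l) F = 0) : R ∣ F := by
  classical
  let v : CoeffIdx d := ⟨l, ⟨Finsupp.single l (d l), by simp⟩⟩
  let L := FractionRing (ParamRing d)
  let e : CoeffRing d ≃ₐ[ℤ] Polynomial (MvPolynomial {b // b ≠ v} ℤ) :=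
    (renameEquiv ℤ (Equiv.optionSubtypeNe v).symm).trans (optionEquivLeft ℤ {b // b ≠ v})
  let θ₀ : CoeffRing d →+* L := (algebraMap (ParamRing d) L).comp
    (evalSys (paramSys d l))
  have hθ₀ : ∀ G, θ₀ G = 0 ↔ evalSys (paramSys d l) G = 0 := fun G =>
    map_eq_zero_iff (algebraMap (ParamRing d) L) (IsFractionRing.injective _ _)
  let θ := θ₀.comp e.symm.toAlgHom.toRingHom
  have hθe : ∀ G, θ (e G) = θ₀ G := fun G => congrArg θ₀ (e.symm_apply_apply G)
  have hC : ∀ c : MvPolynomial {b // b ≠ v} ℤ,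
      e.symm (Polynomial.C c) = rename Subtype.val c := by
    intro c
    rw [AlgEquiv.symm_apply_eq]
    simp only [e, AlgEquiv.trans_apply, renameEquiv_apply, rename_rename]
    have : (⇑(Equiv.optionSubtypeNe v).symm ∘ Subtype.val : {b // b ≠ v} → _) = some := by
      funext b
      simp [Equiv.optionSubtypeNe_symm_of_ne b.2]
    rw [this]
    induction c using MvPolynomial.induction_on with
    | C a => simp
    | add p q hp hq => simp [hp, hq]
    | mul_X p i hp => rw [Polynomial.C_mul, hp, map_mul, map_mul, rename_X, optionEquivLeft_X_some]
  have hinj : Function.Injective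
      (θ.comp (Polynomial.C : MvPolynomial {b // b ≠ v} ℤ →+* _)) := by
    rw [injective_iff_map_eq_zero]
    intro c hc
    have h1 : θ₀ (rename Subtype.val c) = 0 := by
      rw [← hC]; exact hc
    have h2 := eq_zero_of_agree hd l hl ((hθ₀ _).1 h1) fun a a' haa' => by
      rw [← aeval_eq_evalSys, ← aeval_eq_evalSys, aeval_rename, aeval_rename]
      congr 2
      funext b
      refine haa' _ ?_
      by_contra h
      push Not at h
      apply b.2
      obtain ⟨⟨i, ⟨β, hβ⟩⟩, hb⟩ := b
      obtain rfl : i = l := h.2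
      obtain rfl : β = Finsupp.single i (d i) := h.1
      rfl
    exact rename_injective _ Subtype.val_injective (by rw [h2, map_zero])
  have hdvd : e R ∣ e F := by
    refine dvd_of_mem_ker θ hinj ((MulEquiv.prime_iff e).2 hR) ?_ ?_
    · rw [hθe, hθ₀]; exact hR0
    · rw [hθe, hθ₀]; exact hF
  exact (map_dvd_iff e).1 hdvd

/-- If the forms have no common zero over an algebraically closed field, some polynomial that
vanishes at all systems with a common zero does not vanish at the given system: a maximal minor of
the matrix of all products `X^γ f_i` of a large degree. -/
theorem exists_minor_ne_zero {K : Type} [Field K] [IsAlgClosed K] {a : CoeffIdx d → K}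
    (ha : ¬ Rooted a) (l : Fin n) :
    ∃ F : CoeffRing d, evalSys (paramSys d l) F = 0 ∧ evalSys a F ≠ 0 := by
  classical
  obtain ⟨N, hN⟩ := exists_monomial_mem_of_not_rooted ha
  let ρ : MvPolynomial (Fin n) K →ₗ[K] (Mon n N → K) := LinearMap.pi fun r => lcoeff K r.1
  let S : Set (MvPolynomial (Fin n) K) := {f | ∃ (i : Fin n) (γ : Fin n →₀ ℕ),
    (γ.degree : ℤ) + d i = N ∧ f = monomial γ 1 * form a i}
  have hspan : Submodule.span K (ρ '' S) = ⊤ := by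
    rw [Submodule.span_image, eq_top_iff, ← (Pi.basisFun K (Mon n N)).span_eq,
      Submodule.span_le]
    rintro _ ⟨γ, rfl⟩
    have hγ : γ.1.degree = N := by exact_mod_cast γ.2
    have h1 := homogeneousComponent_mem_fullSpan (hN γ.1 hγ.ge) N
    rw [homogeneousComponent_of_mem (isHomogeneous_monomial _ rfl : _ ∈ homogeneousSubmodule _ _ _),
      if_pos hγ.symm] at h1
    refine ⟨_, h1, ?_⟩
    funext r
    simp only [ρ, LinearMap.pi_apply, lcoeff_apply, coeff_monomial, Pi.basisFun_apply,
      Pi.single_apply]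
    simp only [Subtype.ext_iff, eq_comm]
  obtain ⟨f, hfS, -, hfli⟩ := Submodule.exists_fun_fin_finrank_span_eq K (ρ '' S)
  have hcard : Fintype.card (Mon n N) = Module.finrank K (Submodule.span K (ρ '' S)) := by
    rw [hspan, finrank_top, Module.finrank_fintype_fun_eq_card]
  let e : Mon n N ≃ Fin (Module.finrank K (Submodule.span K (ρ '' S))) :=
    Fintype.equivFinOfCardEq hcard
  choose g hgS hg using hfS
  choose c γ hγ hgc using hgS
  let M {B : Type} [CommRing B] (b : CoeffIdx d → B) : Matrix (Mon n N) (Mon n N) B :=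
    Matrix.of fun r s => coeff r.1 (monomial (γ (e s)) 1 * form b (c (e s)))
  have hM : ∀ {B : Type} [CommRing B] (b : CoeffIdx d → B),
      evalSys b (M X).det = (M b).det := by
    intro B _ b
    rw [RingHom.map_det]
    congr 1
    ext r s
    simp only [M, RingHom.mapMatrix_apply, Matrix.map_apply, Matrix.of_apply]
    rw [← coeff_map, map_mul, map_form, evalSys_comp_X, map_monomial, map_one]
  refine ⟨(M X).det, ?_, ?_⟩
  · rw [hM]
    exact det_products_eq_zero (rooted_paramSys l) (γ := γ ∘ e) (c := c ∘ e) fun s => hγ (e s)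
  · have hcols : LinearIndependent K (M a).col := by
      have : (M a).col = f ∘ e := by
        funext s r
        rw [Function.comp_apply, ← hg (e s), hgc (e s)]
        rfl
      rw [this]
      exact hfli.comp _ e.injective
    rw [hM]
    exact ((Matrix.isUnit_iff_isUnit_det _).1
      (Matrix.linearIndependent_cols_iff_isUnit.1 hcols)).ne_zero

/-- The resultant exists. -/
theorem exists_isResultant (hn : 0 < n) (hd : ∀ i, 0 < d i) : ∃ R, IsResultant d R := by
  classical
  obtain ⟨m, rfl⟩ : ∃ m, n = m + 1 := ⟨n - 1, by omega⟩
  let l := Fin.last m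
  have hl : ∀ i, i ≤ l := Fin.le_last
  have hex : ∀ s : Mon (m + 1) ((∑ i, d i : ℕ) : ℤ), ∃ i, d i ≤ s.1 i := fun s =>
    exists_exceeding_of_degree hn (by have := s.2; exact_mod_cast this.ge)
  let Z : CoeffRing d := (mac X (fun s => s.1) (fun s => firstExc (hex s))).det
  have hZeval : ∀ {B : Type} [CommRing B] (a : CoeffIdx d → B),
      evalSys a Z = (mac a (fun s => s.1) (fun s => firstExc (hex s))).det := by
    intro B _ a
    rw [map_det_mac, evalSys_comp_X]
  have hZpow : evalSys (powSys d ℤ) Z = 1 := by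
    rw [hZeval, mac_pow (fun s => form_powSys _) (fun s s' h => Subtype.ext h)
      (fun s => le_firstExc _), Matrix.det_one]
  have hZ0 : Z ≠ 0 := by
    intro h
    rw [h, map_zero] at hZpow
    exact zero_ne_one hZpow
  have hZker : evalSys (paramSys d l) Z = 0 := by
    rw [hZeval]
    exact det_mac_eq_zero (rooted_paramSys l) fun s => le_firstExc _
  have hP : (RingHom.ker (evalSys (paramSys d l))).IsPrime := RingHom.ker_isPrime _
  obtain ⟨R, hRmem, hR⟩ := hP.exists_mem_prime_of_ne_bot
    (fun h => hZ0 (by rw [← Ideal.mem_bot, ← h]; exact hZker))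
  have hRdvd : ∀ F, evalSys (paramSys d l) F = 0 → R ∣ F := fun F hF =>
    dvd_of_param_eq_zero hd l hl hR hRmem hF
  have hunit : IsUnit (evalSys (powSys d ℤ) R) := by
    have := map_dvd (evalSys (powSys d ℤ)) (hRdvd Z hZker)
    rw [hZpow] at this
    exact isUnit_of_dvd_one this
  have hiff : ∀ (k : Type) [Field k] [IsAlgClosed k] (a : CoeffIdx d → k),
      evalSys a R = 0 ↔ Rooted a := by
    intro k _ _ a
    refine ⟨fun h => ?_, evalSys_eq_zero_of_rooted hRmem⟩
    by_contra hnr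
    obtain ⟨F, hF, hFa⟩ := exists_minor_ne_zero hnr l
    obtain ⟨G, rfl⟩ := hRdvd F hF
    rw [map_mul, h, zero_mul] at hFa
    exact hFa rfl
  have key : ∀ R' : CoeffRing d, Irreducible R' → evalSys (powSys d ℤ) R' = 1 →
      (∀ (k : Type) [Field k] [IsAlgClosed k] (a : CoeffIdx d → k),
        evalSys a R' = 0 ↔ Rooted a) → IsResultant d R' := by
    intro R' h1 h2 h3
    refine ⟨h1, fun k _ _ a => ?_, ?_⟩
    · rw [aeval_eq_evalSys, h3]
      simp only [specializedForm_eq_form]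
      rfl
    · rw [evalSys_powSys] at h2
      exact_mod_cast h2
  rcases Int.isUnit_iff.1 hunit with h | h
  · exact ⟨R, key R hR.irreducible h hiff⟩
  · refine ⟨-R, key (-R) hR.neg.irreducible (by rw [map_neg, h, neg_neg]) fun k _ _ a => ?_⟩
    rw [map_neg, neg_eq_zero, hiff]

end Existence

/-! ### Consequences of the characterization of the resultant -/

section Characterization

variable {n : ℕ} {d : Fin n → ℕ} {R : CoeffRing d}

theorem IsResultant.evalSys_eq_zero_iff (hR : IsResultant d R) {k : Type} [Field k]
    [IsAlgClosed k] (a : CoeffIdx d → k) : evalSys a R = 0 ↔ Rooted a := by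
  rw [← aeval_eq_evalSys, hR.vanishes_iff]
  simp only [specializedForm_eq_form]
  rfl

theorem IsResultant.prime (hR : IsResultant d R) : Prime R := hR.irreducible.prime

theorem IsResultant.evalSys_powSys (hR : IsResultant d R) (B : Type*) [CommRing B] :
    evalSys (powSys d B) R = 1 := by
  rw [MacaulayBezout.evalSys_powSys, hR.normalized, Int.cast_one]

/-- The generic point of the hypersurface `P = 0`. -/
theorem exists_generic_zero {P : CoeffRing d} (hP : Prime P) :
    ∃ (K : Type) (_ : Field K) (_ : IsAlgClosed K) (a : CoeffIdx d → K),
      ∀ G : CoeffRing d, evalSys a G = 0 ↔ P ∣ G := by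
  have : (Ideal.span {P}).IsPrime := (Ideal.span_singleton_prime hP.ne_zero).2 hP
  let Q := CoeffRing d ⧸ Ideal.span {P}
  let K := AlgebraicClosure (FractionRing Q)
  let φ : CoeffRing d →+* K := ((algebraMap (FractionRing Q) K).comp (algebraMap Q
    (FractionRing Q))).comp (Ideal.Quotient.mk _)
  refine ⟨K, inferInstance, inferInstance, φ ∘ X, fun G => ?_⟩
  rw [← map_eq_evalSys, RingHom.comp_apply, map_eq_zero_iff, Ideal.Quotient.eq_zero_iff_mem,
    Ideal.mem_span_singleton]
  rw [RingHom.coe_comp]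
  exact (algebraMap (FractionRing Q) K).injective.comp (IsFractionRing.injective _ _)

/-- A polynomial that vanishes at all systems with a common zero is a multiple of the
resultant. -/
theorem IsResultant.dvd (hR : IsResultant d R) {G : CoeffRing d}
    (hG : ∀ (K : Type) [Field K] [IsAlgClosed K] (a : CoeffIdx d → K),
      Rooted a → evalSys a G = 0) : R ∣ G := by
  obtain ⟨K, _, _, a, ha⟩ := exists_generic_zero hR.prime
  exact (ha G).1 (hG K a ((hR.evalSys_eq_zero_iff a).1 ((ha R).2 dvd_rfl)))

end Characterization

/-! ### The degrees of the resultant -/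

section Degrees

open Polynomial in
theorem eq_C_mul_X_pow_of_mul_eq {A : Type*} [CommRing A] [IsDomain A] {r s : A[X]} {z : A}
    {y : ℕ} (hz : z ≠ 0) (h : r * s = Polynomial.C z * Polynomial.X ^ y) :
    ∃ x ≤ y, ∃ r₀, r = Polynomial.C r₀ * Polynomial.X ^ x := by
  have h0 : Polynomial.C z * Polynomial.X ^ y ≠ 0 := by simp [hz]
  have hr : r ≠ 0 := by rintro rfl; exact h0 (by rw [← h, zero_mul])
  have hs : s ≠ 0 := by rintro rfl; exact h0 (by rw [← h, mul_zero])
  have h1 := congrArg natDegree h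
  rw [natDegree_mul hr hs, natDegree_C_mul_X_pow _ _ hz] at h1
  have h2 := congrArg natTrailingDegree h
  rw [natTrailingDegree_mul hr hs, natTrailingDegree_mul (by simpa using hz) (by simp),
    natTrailingDegree_C, natTrailingDegree_X_pow, zero_add] at h2
  have h3 := natTrailingDegree_le_natDegree r
  have h4 := natTrailingDegree_le_natDegree s
  refine ⟨r.natDegree, by omega, r.leadingCoeff, ?_⟩
  ext k
  rw [Polynomial.coeff_C_mul, Polynomial.coeff_X_pow]
  split_ifs with hk
  · rw [hk, mul_one]; rfl
  · rw [mul_zero]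
    rcases lt_or_gt_of_ne hk with hk | hk
    · exact coeff_eq_zero_of_lt_natTrailingDegree (by omega)
    · exact coeff_eq_zero_of_natDegree_lt hk

variable {n : ℕ} {d : Fin n → ℕ}

variable (d) in
/-- The generic system with its `l`-th form multiplied by a new variable. -/
def scaleSys (l : Fin n) : CoeffIdx d → Polynomial (CoeffRing d) :=
  scale (fun i => if i = l then Polynomial.X else 1) (Polynomial.C ∘ X)

theorem eval_one_scaleSys (l : Fin n) (F : CoeffRing d) :
    Polynomial.eval 1 (evalSys (scaleSys d l) F) = F := by
  rw [← Polynomial.coe_evalRingHom, map_evalSys]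
  conv_rhs => rw [← evalSys_X_left F]
  congr 2
  funext v
  simp only [scaleSys, scale, Function.comp_apply, Polynomial.coe_evalRingHom,
    Polynomial.eval_mul, Polynomial.eval_C]
  split_ifs <;> simp

/-- `F` is homogeneous of degree `x` in the coefficients of the `l`-th form. -/
def HomogIn (l : Fin n) (x : ℕ) (F : CoeffRing d) : Prop :=
  evalSys (scaleSys d l) F = Polynomial.C F * Polynomial.X ^ x

theorem HomogIn.of_dvd {l : Fin n} {y : ℕ} {F G : CoeffRing d} (hG : HomogIn l y G)
    (hG0 : G ≠ 0) (h : F ∣ G) : ∃ x ≤ y, HomogIn l x F := by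
  obtain ⟨S, rfl⟩ := h
  rw [HomogIn, map_mul] at hG
  obtain ⟨x, hx, r₀, hr⟩ := eq_C_mul_X_pow_of_mul_eq hG0 hG
  have := eval_one_scaleSys l F
  rw [hr] at this
  simp only [Polynomial.eval_mul, Polynomial.eval_C, Polynomial.eval_pow, Polynomial.eval_X,
    one_pow, mul_one] at this
  exact ⟨x, hx, by rw [HomogIn, hr, this]⟩

theorem homogIn_det_mac {ι : Type*} [Fintype ι] [DecidableEq ι] (l : Fin n)
    (b : ι → Fin n →₀ ℕ) (c : ι → Fin n) :
    HomogIn l (Finset.univ.filter fun s => c s = l).card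
      (mac (X : CoeffIdx d → CoeffRing d) b c).det := by
  rw [HomogIn, map_det_mac, evalSys_comp_X, scaleSys, det_mac_scale, ← map_det_mac, mul_comm,
    Finset.prod_ite, Finset.prod_const, Finset.prod_const_one, mul_one]

/-- The product of the degrees of the forms other than the `l`-th. -/
def prodOther (d : Fin n → ℕ) (l : Fin n) : ℕ := ∏ i, if i = l then 1 else d i

theorem exists_homogIn_le {R : CoeffRing d} (hR : IsResultant d R) (l : Fin n) :
    ∃ x ≤ prodOther d l, HomogIn l x R := by
  classical
  have hex : ∀ s : Mon n ((∑ i, d i : ℕ) : ℤ), ∃ j, d j ≤ s.1 j ∧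
      (j = l → ∀ i, i ≠ l → s.1 i < d i) := by
    intro s
    by_cases h : ∃ i, i ≠ l ∧ d i ≤ s.1 i
    · obtain ⟨i, hi, his⟩ := h
      exact ⟨i, his, fun h => absurd h hi⟩
    · push Not at h
      obtain ⟨j, hj⟩ := exists_exceeding_of_degree l.pos (γ := s.1) (d := d)
        (by have := s.2; exact_mod_cast this.ge)
      exact ⟨j, hj, fun _ => h⟩
  choose c hc hcl using hex
  let Z : CoeffRing d := (mac X (fun s => s.1) c).det
  have hZ : ∀ {B : Type} [CommRing B] (a : CoeffIdx d → B),
      evalSys a Z = (mac a (fun s => s.1) c).det := by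
    intro B _ a
    rw [map_det_mac, evalSys_comp_X]
  have hZ0 : Z ≠ 0 := by
    intro h
    have h1 := hZ (powSys d ℤ)
    rw [h, map_zero, mac_pow (fun s => form_powSys _) (fun s s' h => Subtype.ext h) hc,
      Matrix.det_one] at h1
    exact zero_ne_one h1
  have hdvd : R ∣ Z := hR.dvd fun K _ _ a ha => by rw [hZ, det_mac_eq_zero ha hc]
  obtain ⟨x, hx, h⟩ := (homogIn_det_mac l _ c).of_dvd hZ0 hdvd
  refine ⟨x, hx.trans ?_, h⟩
  have hlt : ∀ s : {s // c s = l}, ∀ i,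
      (if i = l then 0 else s.1.1 i) < if i = l then 1 else d i := by
    intro s i
    split_ifs with hi
    · exact one_pos
    · exact hcl s.1 s.2 i hi
  rw [← Fintype.card_subtype]
  have := Fintype.card_le_of_injective (β := ∀ i : Fin n, Fin (if i = l then 1 else d i))
    (fun (s : {s // c s = l}) i => ⟨if i = l then 0 else s.1.1 i, hlt s i⟩) ?_
  · simpa [prodOther] using this
  · intro s s' hss
    have hi : ∀ i, i ≠ l → s.1.1 i = s'.1.1 i := by
      intro i hi
      have := congrArg Fin.val (congrFun hss i)
      simpa [hi] using this
    refine Subtype.ext (Subtype.ext (Finsupp.ext fun i => ?_))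
    by_cases hil : i = l
    · have h1 : s.1.1.degree = s'.1.1.degree := by
        have := s.1.2.trans s'.1.2.symm; exact_mod_cast this
      rw [Finsupp.degree_eq_sum, Finsupp.degree_eq_sum,
        ← Finset.add_sum_erase _ _ (Finset.mem_univ l),
        ← Finset.add_sum_erase _ (fun i => s'.1.1 i) (Finset.mem_univ l)] at h1
      have h2 : ∑ i ∈ Finset.univ.erase l, s.1.1 i = ∑ i ∈ Finset.univ.erase l, s'.1.1 i :=
        Finset.sum_congr rfl fun i h => hi i (Finset.ne_of_mem_erase h)
      rw [hil]
      omega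
    · exact hi i hil

theorem HomogIn.sum_eq {l : Fin n} {x : ℕ} {F : CoeffRing d} (h : HomogIn l x F)
    {m : CoeffIdx d →₀ ℕ} (hm : coeff m F ≠ 0) : ∑ v, (if v.1 = l then m v else 0) = x := by
  classical
  have hmon : ∀ (m : CoeffIdx d →₀ ℕ) (b : ℤ), evalSys (scaleSys d l) (monomial m b) =
      Polynomial.C (monomial m b) *
        Polynomial.X ^ (∑ v, (if v.1 = l then m v else 0)) := by
    intro m b
    rw [evalSys, coe_eval₂Hom, eval₂_monomial, Finsupp.prod_fintype _ _ (by simp),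
      ← Finset.prod_pow_eq_pow_sum]
    simp only [scaleSys, scale, mul_pow, Finset.prod_mul_distrib, Function.comp_apply]
    rw [monomial_eq, Finsupp.prod_fintype _ _ (by simp)]
    simp only [map_mul, map_prod, map_pow]
    have h1 : ∀ v : CoeffIdx d, (if v.1 = l then Polynomial.X else 1 : Polynomial (CoeffRing d)) ^
        m v = Polynomial.X ^ (if v.1 = l then m v else 0) := by
      intro v; split_ifs <;> simp
    simp only [h1]
    have h2 : Int.castRingHom (Polynomial (CoeffRing d)) b =
        Polynomial.C (MvPolynomial.C b) := by
      rw [eq_intCast, ← Int.cast_id (n := b)]; simp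
    rw [h2]
    ring
  by_contra hne
  rw [HomogIn] at h
  have h1 := congrArg (fun q => coeff m (Polynomial.coeff q
    (∑ v, (if v.1 = l then m v else 0)))) h
  simp only [Polynomial.coeff_C_mul, Polynomial.coeff_X_pow, if_neg hne, mul_zero,
    coeff_zero] at h1
  conv_lhs at h1 => rw [← support_sum_monomial_coeff F]
  simp only [map_sum, hmon, Polynomial.finsetSum_coeff, Polynomial.coeff_C_mul,
    Polynomial.coeff_X_pow, coeff_sum, mul_ite, mul_one, mul_zero] at h1
  rw [Finset.sum_eq_single m] at h1
  · simp at h1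
    exact hm h1
  · intro m' _ hm'
    split_ifs
    · rw [coeff_monomial, if_neg hm']
    · exact coeff_zero _
  · intro hms
    simp [notMem_support_iff.1 hms]

theorem HomogIn.natDegree_le {l : Fin n} {x : ℕ} {F : CoeffRing d} (h : HomogIn l x F)
    {k : Type*} [Field k] {b : CoeffIdx d → Polynomial k}
    (hb : ∀ v, (b v).natDegree ≤ if v.1 = l then 1 else 0) :
    (evalSys b F).natDegree ≤ x := by
  conv_lhs => rw [← support_sum_monomial_coeff F]
  rw [map_sum]
  refine Polynomial.natDegree_sum_le_of_forall_le _ _ fun m hm => ?_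
  rw [evalSys, coe_eval₂Hom, eval₂_monomial, Finsupp.prod_fintype _ _ (by simp),
    ← h.sum_eq (mem_support_iff.1 hm), eq_intCast]
  refine Polynomial.natDegree_mul_le.trans ?_
  rw [Polynomial.natDegree_intCast, zero_add]
  refine (Polynomial.natDegree_prod_le _ _).trans (Finset.sum_le_sum fun v _ => ?_)
  refine Polynomial.natDegree_pow_le.trans ((Nat.mul_le_mul_left _ (hb v)).trans ?_)
  split_ifs <;> simp

/-- The degree of the resultant in the coefficients of `f_l` is at least the product of the
other degrees. For `f_i = ∏_{j < d_i} (X_i - j X_l)`, `i ≠ l`, and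
`f_l = (T X_l - ∑ e_i X_i) X_l^{d_l - 1}`, where the `e_i` are the place values of the mixed radix
system with the digits `0, …, d_i - 1` at the places `i ≠ l`, the resultant is a nonzero polynomial
in `T` that has the roots `0, 1, …, ∏_{i ≠ l} d_i - 1`. -/
theorem HomogIn.prodOther_le {R : CoeffRing d} (hR : IsResultant d R) (hd : ∀ i, 0 < d i)
    {l : Fin n} {x : ℕ} (h : HomogIn l x R) : prodOther d l ≤ x := by
  classical
  let k := AlgebraicClosure ℚ
  let r : Fin n → ℕ := fun i => if i = l then 1 else d i
  let e : Fin n → ℕ := fun i => if i = l then 0 else ∏ j : Fin i, r (Fin.castLE i.is_lt.le j)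
  let F : Fin n → MvPolynomial (Fin n) k := fun i =>
    ∏ j ∈ Finset.range (d i), (X i - MvPolynomial.C (j : k) * X l)
  let H : MvPolynomial (Fin n) k :=
    (∑ i, MvPolynomial.C (e i : k) * X i) * X l ^ (d l - 1)
  have hF : ∀ i, (F i).IsHomogeneous (d i) := by
    intro i
    have := IsHomogeneous.prod (Finset.range (d i))
      (fun j => (X i - MvPolynomial.C (j : k) * X l : MvPolynomial (Fin n) k)) (fun _ => 1)
      fun j _ => (isHomogeneous_X k i).sub (isHomogeneous_C_mul_X _ _)
    simpa using this
  have hH : H.IsHomogeneous (d l) := by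
    have := (IsHomogeneous.sum Finset.univ
      (fun i => (MvPolynomial.C (e i : k) * X i : MvPolynomial (Fin n) k)) 1
      fun i _ => isHomogeneous_C_mul_X _ _).mul (isHomogeneous_X_pow l (d l - 1))
    rwa [Nat.add_sub_cancel' (hd l)] at this
  let b : CoeffIdx d → Polynomial k := fun v =>
    if v.1 = l then Polynomial.C (coeff v.2.1 (X l ^ d l : MvPolynomial (Fin n) k)) *
      Polynomial.X - Polynomial.C (coeff v.2.1 H)
    else Polynomial.C (coeff v.2.1 (F v.1))
  have hb : ∀ v, (b v).natDegree ≤ if v.1 = l then 1 else 0 := by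
    intro v
    simp only [b]
    split_ifs
    · exact Polynomial.natDegree_sub_le_of_le
        ((Polynomial.natDegree_C_mul_le _ _).trans Polynomial.natDegree_X_le)
        ((Polynomial.natDegree_C _).le.trans zero_le_one)
    · exact (Polynomial.natDegree_C _).le
  have hdeg := h.natDegree_le hb
  have hform : ∀ τ : k, ∀ i, form (Polynomial.evalRingHom τ ∘ b) i =
      if i = l then MvPolynomial.C τ * X l ^ d l - H else F i := by
    intro τ i
    split_ifs with hi
    · subst hi
      refine form_eq_of_coeff ((isHomogeneous_C_mul_X_pow _ _ _).sub hH) fun α => ?_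
      simp only [b, Function.comp_apply, if_true, Polynomial.coe_evalRingHom, Polynomial.eval_sub,
        Polynomial.eval_mul, Polynomial.eval_C, Polynomial.eval_X, coeff_sub, coeff_C_mul]
      rw [mul_comm]
    · refine form_eq_of_coeff (hF i) fun α => ?_
      simp only [b, Function.comp_apply, if_neg hi, Polynomial.coe_evalRingHom, Polynomial.eval_C]
  have heval : ∀ τ : k, Polynomial.eval τ (evalSys b R) = 0 ↔
      Rooted (Polynomial.evalRingHom τ ∘ b) := by
    intro τ
    rw [← hR.evalSys_eq_zero_iff, ← map_evalSys, Polynomial.coe_evalRingHom]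
  have hH1 : ∀ p : Fin n → k, eval p H = (∑ i, (e i : k) * p i) * p l ^ (d l - 1) := by
    intro p; simp [H, map_sum]
  have hpow : ∀ p : Fin n → k, p l ^ d l = p l * p l ^ (d l - 1) := by
    intro p; rw [← pow_succ', Nat.sub_add_cancel (hd l)]
  have hF1 : ∀ (p : Fin n → k) i, eval p (F i) = ∏ j ∈ Finset.range (d i), (p i - j * p l) := by
    intro p i; simp [F, map_prod]
  have hroots : ∀ N < prodOther d l, Polynomial.eval (N : k) (evalSys b R) = 0 := by
    intro N hN
    obtain ⟨J, hJ⟩ := (finPiFinEquiv (n := r)).surjective ⟨N, hN⟩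
    have hJN : N = ∑ i, (J i : ℕ) * ∏ j : Fin i, r (Fin.castLE i.is_lt.le j) := by
      rw [← finPiFinEquiv_apply, hJ]
    rw [heval]
    refine ⟨fun i => if i = l then 1 else ((J i : ℕ) : k), fun h0 => ?_, fun i => ?_⟩
    · simpa using congrFun h0 l
    · rw [hform]
      split_ifs with hi
      · rw [map_sub, map_mul, eval_C, map_pow, eval_X, if_pos rfl, one_pow, mul_one, hH1,
          if_pos rfl, one_pow, mul_one, sub_eq_zero, hJN, Nat.cast_sum]
        refine Finset.sum_congr rfl fun i _ => ?_
        by_cases hil : i = l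
        · have : (J i : ℕ) = 0 := by
            have h1 := (J i).2
            have h2 : r i = 1 := if_pos hil
            omega
          simp [this, e, hil]
        · rw [show e i = ∏ j : Fin i, r (Fin.castLE i.is_lt.le j) from if_neg hil, if_neg hil,
            Nat.cast_mul, mul_comm]
      · rw [hF1]
        have hJi : (J i : ℕ) < d i := (J i).2.trans_eq (if_neg hi)
        refine Finset.prod_eq_zero (Finset.mem_range.2 hJi) ?_
        simp [hi]
  have hne : evalSys b R ≠ 0 := by
    intro h0
    obtain ⟨p, hp0, hp⟩ := (heval (-1)).1 (by rw [h0, Polynomial.eval_zero])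
    have hj : ∀ i, ∃ j : ℕ, i ≠ l → p i = j * p l := by
      intro i
      by_cases hi : i = l
      · exact ⟨0, fun h => absurd hi h⟩
      · have := hp i
        rw [hform, if_neg hi, hF1, Finset.prod_eq_zero_iff] at this
        obtain ⟨j, -, hj⟩ := this
        exact ⟨j, fun _ => sub_eq_zero.1 hj⟩
    choose j hj using hj
    have hpl : p l ≠ 0 := by
      intro hpl
      apply hp0
      funext i
      by_cases hi : i = l
      · rw [hi, hpl]; rfl
      · rw [hj i hi, hpl, mul_zero]; rfl
    have h1 := hp l
    rw [hform, if_pos rfl, map_sub, map_mul, eval_C, map_pow, eval_X, hH1, hpow, ← mul_assoc,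
      ← sub_mul] at h1
    have h2 := (mul_eq_zero.1 h1).resolve_right (pow_ne_zero _ hpl)
    have h3 : ∑ i, (e i : k) * p i = (∑ i, e i * j i : ℕ) * p l := by
      rw [Nat.cast_sum, Finset.sum_mul]
      refine Finset.sum_congr rfl fun i _ => ?_
      by_cases hi : i = l
      · simp [e, hi]
      · rw [hj i hi]; push_cast; ring
    rw [h3, ← sub_mul] at h2
    have h4 := (mul_eq_zero.1 h2).resolve_right hpl
    have h5 : ((∑ i, e i * j i + 1 : ℕ) : k) = 0 := by
      rw [Nat.cast_add, Nat.cast_one]; linear_combination -h4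
    exact Nat.succ_ne_zero _ (Nat.cast_eq_zero.1 h5)
  have := Polynomial.card_le_degree_of_subset_roots
    (p := evalSys b R) (Z := (Finset.range (prodOther d l)).image fun N : ℕ => (N : k)) ?_
  · rw [Finset.card_image_of_injective _ Nat.cast_injective, Finset.card_range] at this
    exact this.trans hdeg
  · intro τ hτ
    obtain ⟨N, hN, rfl⟩ := Finset.mem_image.1 (Finset.mem_def.2 hτ)
    exact (Polynomial.mem_roots hne).2 (hroots N (Finset.mem_range.1 hN))

theorem IsResultant.homogIn {R : CoeffRing d} (hR : IsResultant d R) (hd : ∀ i, 0 < d i)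
    (l : Fin n) : HomogIn l (prodOther d l) R := by
  obtain ⟨x, hx, h⟩ := exists_homogIn_le hR l
  rwa [hx.antisymm (h.prodOther_le hR hd)] at h

end Degrees

/-! ### The Bezoutian of a system -/

section Bezoutian

variable {n : ℕ} {d : Fin n → ℕ} {B C : Type*} [CommRing B] [CommRing C]

/-- The substitution of `Y_l` for `X_l` for the first `k` indices `l`. -/
def hyb (B : Type*) [CommRing B] {n : ℕ} (k : ℕ) :
    MvPolynomial (Fin n) B →ₐ[B] MvPolynomial (Fin n ⊕ Fin n) B :=
  aeval fun l => if l.val < k then X (Sum.inr l) else X (Sum.inl l)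

theorem map_hyb (φ : B →+* C) (k : ℕ) (f : MvPolynomial (Fin n) B) :
    map φ (hyb B k f) = hyb C k (map φ f) := by
  rw [hyb, hyb, map_aeval, aeval_def, eval₂_map, coe_eval₂Hom]
  congr 1
  · ext b
    simp [algebraMap_eq]
  · funext l
    split_ifs <;> simp

/-- The matrix `(Δ_{ij})` of the system `a`. -/
def quotMat (a : CoeffIdx d → B) : Matrix (Fin n) (Fin n) (MvPolynomial (Fin n ⊕ Fin n) B) :=
  Matrix.of fun i j => map (evalSys a) (incrementQuot d i j)

theorem mul_quotMat (a : CoeffIdx d → B) (i j : Fin n) :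
    (X (Sum.inl j) - X (Sum.inr j)) * quotMat a i j =
      hyb B j (form a i) - hyb B (j + 1) (form a i) := by
  have h := congrArg (map (evalSys a)) (mul_incrementQuot d i j)
  have h1 : incrementNum d i j = hyb _ j (form X i) - hyb _ (j + 1) (form X i) := by
    rw [incrementNum, form_X]
    simp only [hyb, Fin.lt_def, Fin.le_def, Nat.lt_succ_iff]
  rw [h1, map_mul, map_sub, map_sub, map_X, map_X, map_hyb, map_hyb, map_form,
    evalSys_comp_X] at h
  exact h

theorem X_sub_X_ne_zero [Nontrivial B] (j : Fin n) :
    (X (Sum.inl j) - X (Sum.inr j) : MvPolynomial (Fin n ⊕ Fin n) B) ≠ 0 := by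
  rw [sub_ne_zero]
  exact fun h => Sum.inl_ne_inr (X_injective h)

/-- The entries of `(Δ_{ij})` are the only solutions of their defining equations. -/
theorem quotMat_eq [IsDomain B] {a : CoeffIdx d → B} {i j : Fin n}
    {q : MvPolynomial (Fin n ⊕ Fin n) B}
    (h : (X (Sum.inl j) - X (Sum.inr j)) * q =
      hyb B j (form a i) - hyb B (j + 1) (form a i)) : quotMat a i j = q :=
  mul_left_cancel₀ (X_sub_X_ne_zero j) ((mul_quotMat a i j).trans h.symm)

/-- The Bezoutian of the system `a`. -/
def bez (a : CoeffIdx d → B) : MvPolynomial (Fin n ⊕ Fin n) B := (quotMat a).det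

theorem map_bezoutian (a : CoeffIdx d → B) : map (evalSys a) (bezoutian d) = bez a := by
  rw [bezoutian, RingHom.map_det]
  rfl

theorem map_bez (φ : B →+* C) (a : CoeffIdx d → B) : map φ (bez a) = bez (φ ∘ a) := by
  rw [← map_bezoutian, ← map_bezoutian, map_map, show φ.comp (evalSys a) = evalSys (φ ∘ a) from
    RingHom.ext (map_evalSys φ a)]

theorem bez_X : bez (X : CoeffIdx d → CoeffRing d) = bezoutian d := by
  rw [← map_bezoutian, show evalSys (X : CoeffIdx d → CoeffRing d) = RingHom.id _ from
    RingHom.ext evalSys_X_left, map_id]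

theorem quotMat_mulVec (a : CoeffIdx d → B) :
    (quotMat a).mulVec (fun j => X (Sum.inl j) - X (Sum.inr j)) =
      fun i => rename Sum.inl (form a i) - rename Sum.inr (form a i) := by
  funext i
  rw [Matrix.mulVec, dotProduct]
  simp only [mul_comm (quotMat a i _), mul_quotMat]
  rw [Fin.sum_univ_eq_sum_range
    (fun k => hyb B k (form a i) - hyb B (k + 1) (form a i)) n, Finset.sum_range_sub']
  congr 1
  · rw [← aeval_X_left_apply (rename Sum.inl (form a i)), aeval_rename]
    simp only [hyb, Nat.not_lt_zero, if_false]
    rfl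
  · rw [← aeval_X_left_apply (rename Sum.inr (form a i)), aeval_rename]
    simp only [hyb, Fin.is_lt, if_true]
    rfl

/-- By Cramer's rule the Bezoutian, multiplied by `X_j - Y_j`, is a combination of the
`f_i(X) - f_i(Y)`. -/
theorem bez_mul_X_sub_X (a : CoeffIdx d → B) (j : Fin n) :
    bez a * (X (Sum.inl j) - X (Sum.inr j)) = ∑ i, (quotMat a).adjugate j i *
      (rename Sum.inl (form a i) - rename Sum.inr (form a i)) := by
  have := congrFun (congrArg (quotMat a).adjugate.mulVec (quotMat_mulVec a)) j
  rw [Matrix.mulVec_mulVec, Matrix.adjugate_mul, Matrix.smul_mulVec, Matrix.one_mulVec] at this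
  exact this

theorem quotMat_scale [IsDomain B] (u : Fin n → B) (a : CoeffIdx d → B) (i j : Fin n) :
    quotMat (scale u a) i j = MvPolynomial.C (u i) * quotMat a i j := by
  apply quotMat_eq
  rw [mul_left_comm, mul_quotMat, form_scale, map_mul, map_mul, mul_sub, hyb, hyb, aeval_C,
    aeval_C, algebraMap_eq]

theorem bez_scale [IsDomain B] (u : Fin n → B) (a : CoeffIdx d → B) :
    bez (scale u a) = MvPolynomial.C (∏ i, u i) * bez a := by
  have : quotMat (scale u a) =
      Matrix.of fun i j => MvPolynomial.C (u i) * quotMat a i j := by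
    ext1 i j
    exact quotMat_scale u a i j
  rw [bez, this, Matrix.det_mul_column, map_prod, bez]

theorem homogeneousComponent_X_sub_X_mul {σ : Type*} (i j : σ) (q : MvPolynomial σ B) (k : ℕ) :
    homogeneousComponent (k + 1) ((X i - X j) * q) = (X i - X j) * homogeneousComponent k q := by
  have h : ∀ i : σ, homogeneousComponent (k + 1) (X i * q) = X i * homogeneousComponent k q := by
    classical
    intro i
    ext β
    rw [coeff_homogeneousComponent, coeff_X_mul', coeff_X_mul', coeff_homogeneousComponent]
    by_cases hi : i ∈ β.support
    · have h1 : Finsupp.single i 1 ≤ β := by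
        rw [Finsupp.single_le_iff]; exact Nat.one_le_iff_ne_zero.2 (Finsupp.mem_support_iff.1 hi)
      have : β.degree = (β - Finsupp.single i 1).degree + 1 := by
        conv_lhs => rw [← tsub_add_cancel_of_le h1]
        rw [map_add, Finsupp.degree_single]
      simp [hi, this]
    · simp [hi]
  rw [sub_mul, sub_mul, map_sub, h, h]

theorem isHomogeneous_of_X_sub_X_mul [IsDomain B] {j : Fin n} {k : ℕ}
    {q : MvPolynomial (Fin n ⊕ Fin n) B}
    (h : ((X (Sum.inl j) - X (Sum.inr j)) * q).IsHomogeneous (k + 1)) : q.IsHomogeneous k := by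
  have h1 : homogeneousComponent (k + 1) ((X (Sum.inl j) - X (Sum.inr j)) * q) = _ :=
    homogeneousComponent_eq_self h
  rw [homogeneousComponent_X_sub_X_mul] at h1
  rw [← mul_left_cancel₀ (X_sub_X_ne_zero j) h1]
  exact homogeneousComponent_isHomogeneous _ _

theorem isHomogeneous_hyb {k e : ℕ} {f : MvPolynomial (Fin n) B} (hf : f.IsHomogeneous e) :
    (hyb B k f).IsHomogeneous e := by
  have := hf.aeval (fun l : Fin n => if l.val < k then
    (X (Sum.inr l) : MvPolynomial (Fin n ⊕ Fin n) B) else X (Sum.inl l)) (n := 1) fun l => by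
      split_ifs <;> exact isHomogeneous_X _ _
  rwa [one_mul] at this

theorem isHomogeneous_bez [IsDomain B] (hd : ∀ i, 0 < d i) (a : CoeffIdx d → B) :
    (bez a).IsHomogeneous (∑ i, (d i - 1)) := by
  rw [bez, Matrix.det_apply]
  refine IsHomogeneous.sum _ _ _ fun σ _ => ?_
  rw [Units.smul_def, zsmul_eq_mul, ← zero_add (∑ i, (d i - 1)),
    ← Equiv.sum_comp σ (fun i => d i - 1)]
  refine IsHomogeneous.mul ?_ (IsHomogeneous.prod _ _ _ fun j _ => ?_)
  · rw [show (((Equiv.Perm.sign σ : ℤ) : MvPolynomial (Fin n ⊕ Fin n) B)) =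
      MvPolynomial.C ((Equiv.Perm.sign σ : ℤ) : B) by simp]
    exact isHomogeneous_C _ _
  · apply isHomogeneous_of_X_sub_X_mul (j := j)
    rw [mul_quotMat, Nat.sub_add_cancel (hd _)]
    exact (isHomogeneous_hyb (form_isHomogeneous a _)).sub
      (isHomogeneous_hyb (form_isHomogeneous a _))

theorem critDegree_eq (hd : ∀ i, 0 < d i) : critDegree d = (∑ i, (d i - 1) : ℕ) := by
  rw [critDegree, Nat.cast_sum]
  refine Finset.sum_congr rfl fun i _ => ?_
  have := hd i
  omega

/-- The coefficient of `X^λ Y^γ` in the Bezoutian of the system `a`. -/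
def bezCoeff (a : CoeffIdx d → B) (lam γ : Fin n →₀ ℕ) : B :=
  coeff (Finsupp.sumElim lam γ) (bez a)

theorem map_bezCoeff (φ : B →+* C) (a : CoeffIdx d → B) (lam γ : Fin n →₀ ℕ) :
    φ (bezCoeff a lam γ) = bezCoeff (φ ∘ a) lam γ := by
  rw [bezCoeff, ← coeff_map, map_bez, bezCoeff]

theorem bezCoeff_scale [IsDomain B] (u : Fin n → B) (a : CoeffIdx d → B)
    (lam γ : Fin n →₀ ℕ) : bezCoeff (scale u a) lam γ = (∏ i, u i) * bezCoeff a lam γ := by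
  rw [bezCoeff, bez_scale, coeff_C_mul, bezCoeff]

/-- Evaluation of the left variables. -/
def evalLeft (p : Fin n → B) : MvPolynomial (Fin n ⊕ Fin n) B →ₐ[B] MvPolynomial (Fin n) B :=
  aeval (Sum.elim (fun i => MvPolynomial.C (p i)) X)

theorem degree_sumElim (lam γ : Fin n →₀ ℕ) :
    (Finsupp.sumElim lam γ).degree = lam.degree + γ.degree := by
  simp [Finsupp.degree_eq_sum, Fintype.sum_sum_type]

theorem evalLeft_monomial_sumElim (p : Fin n → B) (lam γ : Fin n →₀ ℕ) (b : B) :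
    evalLeft p (monomial (Finsupp.sumElim lam γ) b) = monomial γ (b * pw p lam) := by
  rw [evalLeft, aeval_monomial, Finsupp.prod_sumElim]
  have h1 : lam.prod ((fun i k => Sum.elim (fun i => MvPolynomial.C (p i)) X i ^ k) ∘ Sum.inl) =
      (MvPolynomial.C (pw p lam) : MvPolynomial (Fin n) B) := by
    rw [Finsupp.prod_fintype _ _ (by simp), pw, map_prod]
    simp
  have h2 : γ.prod ((fun i k => Sum.elim (fun i => MvPolynomial.C (p i)) X i ^ k) ∘ Sum.inr) =
      (monomial γ 1 : MvPolynomial (Fin n) B) := by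
    rw [monomial_eq, MvPolynomial.C_1, one_mul]
    rfl
  rw [h1, h2, algebraMap_eq, ← mul_assoc, ← MvPolynomial.C_mul, C_mul_monomial, mul_one]

theorem coeff_evalLeft {f : MvPolynomial (Fin n ⊕ Fin n) B} {D : ℕ} (hf : f.IsHomogeneous D)
    (p : Fin n → B) {t : ℤ} {γ : Fin n →₀ ℕ} (hγ : t + γ.degree = D) :
    coeff γ (evalLeft p f) = ∑ lam : Mon n t, pw p lam.1 * coeff (Finsupp.sumElim lam.1 γ) f := by
  classical
  conv_lhs => rw [← support_sum_monomial_coeff f]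
  conv_rhs => enter [2, lam, 2]; rw [← support_sum_monomial_coeff f]
  simp only [map_sum, coeff_sum, Finset.mul_sum]
  rw [Finset.sum_comm]
  refine Finset.sum_congr rfl fun μ hμ => ?_
  obtain ⟨⟨lam, γ'⟩, rfl⟩ := (Finsupp.sumFinsuppEquivProdFinsupp
    (α := Fin n) (β := Fin n) (γ := ℕ)).symm.surjective μ
  change coeff γ (evalLeft p (monomial (Finsupp.sumElim lam γ') _)) =
    ∑ x : Mon n t, pw p x.1 * coeff (Finsupp.sumElim x.1 γ) (monomial (Finsupp.sumElim lam γ') _)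
  rw [evalLeft_monomial_sumElim, coeff_monomial]
  simp only [coeff_monomial]
  have hinj : ∀ x : Fin n →₀ ℕ, Finsupp.sumElim lam γ' = Finsupp.sumElim x γ ↔
      lam = x ∧ γ' = γ := by
    intro x
    refine ⟨fun h => ⟨?_, ?_⟩, fun h => by rw [h.1, h.2]⟩
    · ext i; exact DFunLike.congr_fun h (Sum.inl i)
    · ext i; exact DFunLike.congr_fun h (Sum.inr i)
  have hdeg : lam.degree + γ'.degree = D := by
    by_contra h
    exact (mem_support_iff.1 hμ) (hf.coeff_eq_zero (by
      change (Finsupp.sumElim lam γ').degree ≠ D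
      rwa [degree_sumElim]))
  split_ifs with h
  · subst h
    rw [Finset.sum_eq_single (⟨lam, by omega⟩ : Mon n t)]
    · simp [mul_comm]
    · intro x _ hx
      rw [if_neg, mul_zero]
      exact fun h' => hx (Subtype.ext ((hinj _).1 h').1.symm)
    · simp
  · rw [Finset.sum_eq_zero]
    intro x _
    rw [if_neg fun h' => h ((hinj _).1 h').2, mul_zero]

theorem evalLeft_rename_inl (p : Fin n → B) (f : MvPolynomial (Fin n) B) :
    evalLeft p (rename Sum.inl f) = MvPolynomial.C (eval p f) := by
  rw [evalLeft, aeval_rename]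
  induction f using MvPolynomial.induction_on with
  | C a => simp
  | add f g hf hg => rw [map_add, hf, hg, map_add, MvPolynomial.C_add]
  | mul_X f i hf => rw [map_mul, hf, map_mul, eval_X, MvPolynomial.C_mul, aeval_X]; rfl

theorem evalLeft_rename_inr (p : Fin n → B) (f : MvPolynomial (Fin n) B) :
    evalLeft p (rename Sum.inr f) = f := by
  rw [evalLeft, aeval_rename,
    show Sum.elim (fun i => MvPolynomial.C (p i)) X ∘ Sum.inr = X from rfl,
    aeval_X_left_apply]

theorem evalLeft_bez_mul_mem (a : CoeffIdx d → B) {p : Fin n → B}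
    (hp : ∀ i, eval p (form a i) = 0) (j : Fin n) :
    evalLeft p (bez a) * (MvPolynomial.C (p j) - X j) ∈ Ideal.span (Set.range (form a)) := by
  have := congrArg (evalLeft p) (bez_mul_X_sub_X a j)
  rw [map_mul, map_sub] at this
  rw [show evalLeft p (X (Sum.inl j)) = MvPolynomial.C (p j) by simp [evalLeft],
    show evalLeft p (X (Sum.inr j)) = X j by simp [evalLeft]] at this
  rw [this, map_sum]
  refine Ideal.sum_mem _ fun i _ => ?_
  rw [map_mul, map_sub, evalLeft_rename_inl, evalLeft_rename_inr, hp, MvPolynomial.C_0, zero_sub]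
  exact Ideal.mul_mem_left _ _ (neg_mem (Ideal.subset_span ⟨i, rfl⟩))

/-- If `p` is a common zero, the components of `Δ(p, Y)` are in the ideal of the forms: modulo this
ideal `Δ(p, Y)` is divisible by all powers of a variable, because it is annihilated by
`p_j - Y_j`. -/
theorem homogeneousComponent_evalLeft_bez_mem {K : Type*} [Field K] {a : CoeffIdx d → K}
    {p : Fin n → K} (hp0 : p ≠ 0) (hp : ∀ i, eval p (form a i) = 0) (e : ℕ) :
    homogeneousComponent e (evalLeft p (bez a)) ∈ fullSpan a e := by
  classical
  obtain ⟨l, hl⟩ := Function.ne_iff.1 hp0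
  rw [Pi.zero_apply] at hl
  set P := evalLeft p (bez a)
  set I := Ideal.span (Set.range (form a))
  have h1 : P - MvPolynomial.C (p l)⁻¹ * X l * P ∈ I := by
    have := I.mul_mem_left (MvPolynomial.C (p l)⁻¹) (evalLeft_bez_mul_mem a hp l)
    convert this using 1
    have h2 : (MvPolynomial.C (p l)⁻¹ * MvPolynomial.C (p l) : MvPolynomial (Fin n) K) = 1 := by
      rw [← MvPolynomial.C_mul, inv_mul_cancel₀ hl, MvPolynomial.C_1]
    linear_combination (-P) * h2
  have h2 : ∀ N : ℕ, P - (MvPolynomial.C (p l)⁻¹ * X l) ^ N * P ∈ I := by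
    intro N
    induction N with
    | zero => simp
    | succ N ih =>
      have := I.add_mem ih (I.mul_mem_left ((MvPolynomial.C (p l)⁻¹ * X l) ^ N) h1)
      convert this using 1
      ring
  have h3 := homogeneousComponent_mem_fullSpan (h2 (e + 1)) e
  have h4 : homogeneousComponent e ((MvPolynomial.C (p l)⁻¹ * X l) ^ (e + 1) * P) = 0 := by
    ext β
    rw [coeff_homogeneousComponent, coeff_zero]
    split_ifs with hβ
    · rw [mul_pow, mul_assoc, ← map_pow, coeff_C_mul, X_pow_eq_monomial, coeff_monomial_mul',
        if_neg, mul_zero]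
      intro hle
      have := Finsupp.degree_mono hle
      rw [Finsupp.degree_single] at this
      omega
    · rfl
  rwa [map_sub, h4, sub_zero] at h3

end Bezoutian

/-! ### Rows and columns of the matrices -/

section Reindexing

variable {n : ℕ} {d : Fin n → ℕ}

/-- The complementary exponent `(d_i - 1 - γ_i)_i`. -/
def complMon (d : Fin n → ℕ) (γ : Fin n →₀ ℕ) : Fin n →₀ ℕ :=
  Finsupp.equivFunOnFinite.symm fun i => d i - 1 - γ i

theorem complMon_apply (γ : Fin n →₀ ℕ) (i : Fin n) : complMon d γ i = d i - 1 - γ i := rfl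

theorem degree_complMon {γ : Fin n →₀ ℕ} (h : ∀ i, γ i < d i) :
    ((complMon d γ).degree : ℤ) + γ.degree = critDegree d := by
  rw [critDegree, Finsupp.degree_eq_sum, Finsupp.degree_eq_sum, Nat.cast_sum, Nat.cast_sum,
    ← Finset.sum_add_distrib]
  refine Finset.sum_congr rfl fun i _ => ?_
  have := h i
  rw [complMon_apply]
  omega

theorem complMon_complMon {γ : Fin n →₀ ℕ} (h : ∀ i, γ i < d i) :
    complMon d (complMon d γ) = γ := by
  ext i
  have := h i
  rw [complMon_apply, complMon_apply]
  omega

theorem complMon_lt {γ : Fin n →₀ ℕ} (h : ∀ i, γ i < d i) (i : Fin n) : complMon d γ i < d i := by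
  have := h i
  rw [complMon_apply]
  omega

/-- Complementation is a bijection between the reduced monomials of complementary degrees. -/
def redEquiv (u v : ℤ) (huv : u + v = critDegree d) : Red d u ≃ Red d v where
  toFun γ := ⟨⟨complMon d γ.1.1, by
    have := degree_complMon γ.2
    have h2 := γ.1.2
    omega⟩, complMon_lt γ.2⟩
  invFun γ := ⟨⟨complMon d γ.1.1, by
    have := degree_complMon γ.2
    have h2 := γ.1.2
    omega⟩, complMon_lt γ.2⟩
  left_inv γ := Subtype.ext (Subtype.ext (complMon_complMon γ.2))
  right_inv γ := Subtype.ext (Subtype.ext (complMon_complMon γ.2))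

variable (d)

/-- A monomial is either reduced or divisible by some `X_i^{d_i}`. -/
def monEquiv (u : ℤ) : Red d u ⊕ Exc d u ≃ Mon n u :=
  (Equiv.sumComm _ _).trans <| (Equiv.sumCongr (Equiv.refl _) (Equiv.subtypeEquivRight
    fun γ => by simp only [not_exists, not_le])).trans
    (Equiv.sumCompl fun γ : Mon n u => ∃ i, d i ≤ γ.1 i)

/-- A common index set for the rows and columns of `M_t`: the monomials of `S_t`, reduced or not,
and the monomials of `S_{t_n - t}` that are not reduced. -/
abbrev HIdx (t : ℤ) : Type := (Red d t ⊕ Exc d t) ⊕ Exc d (critDegree d - t)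

instance instDecidableEqHIdx (t : ℤ) : DecidableEq (HIdx d t) :=
  @instDecidableEqSum _ _ (inferInstance : DecidableEq (Red d t ⊕ Exc d t)) inferInstance

instance instFintypeHIdx (t : ℤ) : Fintype (HIdx d t) := inferInstance

/-- Rows of `M_t`, in which the columns of a Sylvester matrix are indexed by monomials. -/
abbrev CRow (t : ℤ) : Type := Mon n t ⊕ Exc d (critDegree d - t)

/-- Columns of `M_t`, in which the columns of a Sylvester matrix are indexed by monomials. -/
abbrev CCol (t : ℤ) : Type := Mon n (critDegree d - t) ⊕ Exc d t

/-- The matching of the common index set with the rows. -/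
def rowEquiv (t : ℤ) : HIdx d t ≃ CRow d t := Equiv.sumCongr (monEquiv d t) (Equiv.refl _)

/-- The matching of the common index set with the columns; a reduced monomial corresponds to the
dual of the complementary monomial. -/
def colEquiv (t : ℤ) : HIdx d t ≃ CCol d t :=
  (Equiv.sumAssoc _ _ _).trans <|
    (Equiv.sumCongr (Equiv.refl _) (Equiv.sumComm _ _)).trans <|
    (Equiv.sumAssoc _ _ _).symm.trans <|
    Equiv.sumCongr ((Equiv.sumCongr (redEquiv t (critDegree d - t) (by ring))
      (Equiv.refl _)).trans (monEquiv d (critDegree d - t))) (Equiv.refl _)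

theorem colEquiv_red {t : ℤ} (γ : Red d t) : colEquiv d t (Sum.inl (Sum.inl γ)) =
    Sum.inl (redEquiv t (critDegree d - t) (by ring) γ).1 := rfl

theorem colEquiv_exc {t : ℤ} (γ : Exc d t) :
    colEquiv d t (Sum.inl (Sum.inr γ)) = Sum.inr γ := rfl

theorem colEquiv_exc' {t : ℤ} (γ : Exc d (critDegree d - t)) :
    colEquiv d t (Sum.inr γ) = Sum.inl γ.1 := rfl

/-- The matching of the columns and the rows of `E_u`. -/
def extEquiv (u : ℤ) : ExtCol d u ≃ ExtRow d u :=
  ((excEquiv d u).subtypeEquiv (q := fun γ : Exc d u =>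
    ∃ i j : Fin n, i ≠ j ∧ d i ≤ γ.1.1 i ∧ d j ≤ γ.1.1 j) fun c => by
    have key : ∀ i, i ≠ c.1 → d i ≤ (excEquiv d u c).1.1 i → d i ≤ c.2.1.1 i := fun i hi h => by
      rwa [excEquiv_coe, Finsupp.add_apply, Finsupp.single_eq_of_ne hi] at h
    constructor
    · rintro ⟨i, hi, h⟩
      refine ⟨i, c.1, hi, ?_, ?_⟩
      · rw [excEquiv_coe, Finsupp.add_apply]; omega
      · rw [excEquiv_coe, Finsupp.add_apply, Finsupp.single_eq_same]; omega
    · rintro ⟨i, j, hij, hi, hj⟩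
      by_cases h : i = c.1
      · exact ⟨j, fun h' => hij (h.trans h'.symm), key j (fun h' => hij (h.trans h'.symm)) hj⟩
      · exact ⟨i, h, key i h hi⟩).trans
    (Equiv.subtypeSubtypeEquivSubtype
      (p := fun γ : Mon n u => ∃ i, d i ≤ γ.1 i)
      (q := fun γ : Mon n u => ∃ i j : Fin n, i ≠ j ∧ d i ≤ γ.1 i ∧ d j ≤ γ.1 j)
      fun ⟨i, _, _, h, _⟩ => ⟨i, h⟩)

end Reindexing

section Matrices

variable {n : ℕ} {d : Fin n → ℕ} {B C : Type*} [CommRing B] [CommRing C]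

theorem associated_det_submatrix {ι r c : Type*} [Fintype ι] [DecidableEq ι] [Fintype r]
    [DecidableEq r] (M : Matrix r c B) (f : ι ≃ r) (g : ι ≃ c) (e : r ≃ c) :
    Associated (M.submatrix id e).det (M.submatrix f g).det := by
  have h : M.submatrix f g = ((M.submatrix id e).submatrix id
      ((f.symm.trans g).trans e.symm : Equiv.Perm r)).submatrix f f := by
    ext i j
    simp
  rw [h, Matrix.det_submatrix_equiv_self, Matrix.det_permute']
  exact ⟨Units.map (Int.castRingHom B).toMonoidHom (Equiv.Perm.sign _), mul_comm _ _⟩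

/-- The matrix `M_t` of a system, in which the columns of a Sylvester matrix are indexed by
monomials. -/
def core (a : CoeffIdx d → B) (t : ℤ) : Matrix (CRow d t) (CCol d t) B :=
  Matrix.fromBlocks (Matrix.of fun lam γ => bezCoeff a lam.1 γ.1)
    (Matrix.of fun lam μ => entry a (firstExc μ.2) lam.1 μ.1.1)
    (Matrix.of fun ν γ => entry a (firstExc ν.2) γ.1 ν.1.1) 0

/-- The matrix `M_t` of a system, with a common index set for the rows and columns. -/
def hat (a : CoeffIdx d → B) (t : ℤ) : Matrix (HIdx d t) (HIdx d t) B :=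
  (core a t).submatrix (rowEquiv d t) (colEquiv d t)

theorem map_core (φ : B →+* C) (a : CoeffIdx d → B) (t : ℤ) :
    (core a t).map φ = core (φ ∘ a) t := by
  ext (r | r) (c | c)
  · exact map_bezCoeff _ _ _ _
  · exact map_entry _ _ _ _ _
  · exact map_entry _ _ _ _ _
  · exact map_zero φ

theorem map_det_hat (φ : B →+* C) (a : CoeffIdx d → B) (t : ℤ) :
    φ (hat a t).det = (hat (φ ∘ a) t).det := by
  rw [RingHom.map_det, RingHom.mapMatrix_apply, hat, ← Matrix.submatrix_map, map_core, hat]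

theorem nonempty_mRow_equiv (t : ℤ) : Nonempty (MRow d t ≃ MCol d t) :=
  ⟨(Equiv.sumCongr (Equiv.refl _) (excEquiv d _)).trans <| (rowEquiv d t).symm.trans <|
    (colEquiv d t).trans (Equiv.sumCongr (Equiv.refl _) (excEquiv d _).symm)⟩

theorem associated_detM (t : ℤ) (e : MRow d t ≃ MCol d t) :
    Associated (detM d t e) (hat (X : CoeffIdx d → CoeffRing d) t).det := by
  have := associated_det_submatrix (matM d t)
    ((rowEquiv d t).trans (Equiv.sumCongr (Equiv.refl _) (excEquiv d _).symm))
    ((colEquiv d t).trans (Equiv.sumCongr (Equiv.refl _) (excEquiv d _).symm)) e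
  refine this.trans (.of_eq (congrArg Matrix.det ?_))
  have hcore : core X t = (matM d t).submatrix (Equiv.sumCongr (Equiv.refl _) (excEquiv d _).symm)
      (Equiv.sumCongr (Equiv.refl _) (excEquiv d _).symm) := by
    ext1 (r | r) (c | c)
    · change bezCoeff X _ _ = bezoutBlock d t _ _
      rw [bezCoeff, bez_X]
      rfl
    · rfl
    · rfl
    · rfl
  rw [hat, hcore]
  rfl

theorem exists_exceeding_of_ext {u : ℤ} (s : ExtRow d u) : ∃ i, d i ≤ s.1.1 i :=
  s.2.imp fun _ ⟨_, _, h, _⟩ => h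

/-- The matrix `E_u` of a system, with the columns indexed by monomials. -/
def extMat (a : CoeffIdx d → B) (u : ℤ) : Matrix (ExtRow d u) (ExtRow d u) B :=
  mac a (fun s => s.1.1) (fun s => firstExc (exists_exceeding_of_ext s))

theorem map_det_extMat (φ : B →+* C) (a : CoeffIdx d → B) (u : ℤ) :
    φ (extMat a u).det = (extMat (φ ∘ a) u).det := map_det_mac _ _ _ _

theorem det_extMat_powSys (u : ℤ) : (extMat (powSys d B) u).det = 1 := by
  rw [extMat, mac_pow (fun s => form_powSys _) (fun s s' h => Subtype.ext (Subtype.ext h))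
    (fun s => le_firstExc _), Matrix.det_one]

theorem nonempty_eeRow_equiv (t : ℤ) : Nonempty (EERow d t ≃ EECol d t) :=
  ⟨(Equiv.sumCongr (Equiv.refl _) (extEquiv d _)).trans <| (Equiv.sumComm _ _).trans
    (Equiv.sumCongr (Equiv.refl _) (extEquiv d _).symm)⟩

theorem associated_detE (t : ℤ) (e : EERow d t ≃ EECol d t) :
    Associated (detE d t e) ((extMat (X : CoeffIdx d → CoeffRing d) t).det *
      (extMat (X : CoeffIdx d → CoeffRing d) (critDegree d - t)).det) := by
  have := associated_det_submatrix (matE d t)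
    (Equiv.sumCongr (Equiv.refl _) (extEquiv d _).symm)
    ((Equiv.sumComm _ _).trans (Equiv.sumCongr (Equiv.refl _) (extEquiv d _).symm)) e
  refine this.trans (.of_eq ?_)
  rw [← Matrix.det_transpose (extMat X (critDegree d - t)),
    ← Matrix.det_fromBlocks_zero₂₁ _ ((bezoutBlock d t).submatrix Subtype.val Subtype.val) _]
  congr 1
  ext1 (r | r) (c | c) <;> rfl

end Matrices

/-! ### The resultant divides the determinant of `M_t` -/

section Divides

variable {n : ℕ} {d : Fin n → ℕ}

theorem exists_pw_ne_zero {K : Type*} [Field K] {p : Fin n → K} (hp : p ≠ 0) {u : ℤ}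
    (hu : 0 ≤ u) : ∃ γ : Mon n u, pw p γ.1 ≠ 0 := by
  classical
  obtain ⟨l, hl⟩ := Function.ne_iff.1 hp
  refine ⟨⟨Finsupp.single l u.toNat, by simp [hu]⟩, ?_⟩
  rw [pw, Finset.prod_ne_zero_iff]
  intro i _
  rw [Finsupp.single_apply]
  split_ifs with h
  · exact pow_ne_zero _ (h ▸ hl)
  · simp

theorem sum_pw_mul_entry {B : Type*} [CommRing B] {a : CoeffIdx d → B} {p : Fin n → B}
    (hp : ∀ i, eval p (form a i) = 0) {u : ℤ} (μ : Exc d u) :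
    ∑ γ : Mon n u, pw p γ.1 * entry a (firstExc μ.2) γ.1 μ.1.1 = 0 :=
  sum_pw_mul_coeff_eq_zero (hp _) (by
    have := degree_sub_single (le_firstExc μ.2)
    have h2 := μ.1.2
    omega)

/-- At a system with a common zero `p` the vector of the monomials of degree `t` at `p` can be
completed to a linear relation between the rows of `M_t`. -/
theorem det_hat_eq_zero {K : Type*} [Field K] (hd : ∀ i, 0 < d i) {a : CoeffIdx d → K}
    (ha : Rooted a) (hG : ∀ j w, partDet a j w ≠ 0) (t : ℤ) : (hat a t).det = 0 := by
  classical
  obtain ⟨p, hp0, hp⟩ := ha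
  rcases lt_or_ge t 0 with ht | ht
  · -- there is no monomial of degree `t`; the monomials of degree `t_n - t` at `p` give a linear
    -- relation between the columns
    have hcrit : 0 ≤ critDegree d := by rw [critDegree_eq hd]; positivity
    obtain ⟨γ₀, hγ₀⟩ := exists_pw_ne_zero hp0 (u := critDegree d - t) (by omega)
    have hE : IsEmpty (Mon n t) := ⟨fun γ => by have := γ.2; omega⟩
    let v : CCol d t → K := Sum.elim (fun γ => pw p γ.1) 0
    rw [← Matrix.exists_mulVec_eq_zero_iff]
    refine ⟨v ∘ colEquiv d t, fun h => hγ₀ ?_, ?_⟩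
    · have := congrFun h ((colEquiv d t).symm (Sum.inl γ₀))
      simpa [v] using this
    · rw [hat, Matrix.submatrix_mulVec_equiv]
      have : v ∘ colEquiv d t ∘ (colEquiv d t).symm = v := by
        funext x; simp
      rw [Function.comp_assoc, this]
      have h0 : (core a t).mulVec v = 0 := by
        funext r
        rcases r with r | r
        · exact hE.elim r
        · rw [Matrix.mulVec, dotProduct, Fintype.sum_sum_type]
          simp only [v, Sum.elim_inl, Sum.elim_inr, Pi.zero_apply, mul_zero,
            Finset.sum_const_zero, add_zero]
          rw [← sum_pw_mul_entry hp r]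
          exact Finset.sum_congr rfl fun _ _ => mul_comm _ _
      rw [h0]
      rfl
  · obtain ⟨γ₀, hγ₀⟩ := exists_pw_ne_zero hp0 ht
    obtain ⟨w, hw⟩ : ∃ w : Exc d (critDegree d - t) → K, ∀ κ : Mon n (critDegree d - t),
        ∑ lam : Mon n t, pw p lam.1 * bezCoeff a lam.1 κ.1 +
          ∑ ν, w ν * entry a (firstExc ν.2) κ.1 ν.1.1 = 0 := by
      rcases lt_or_ge (critDegree d - t) 0 with ht' | ht'
      · exact ⟨0, fun κ => by have := κ.2; omega⟩
      · obtain ⟨e, he⟩ := Int.eq_ofNat_of_zero_le ht'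
        have h1 := homogeneousComponent_evalLeft_bez_mem hp0 hp e
        have h2 := fullSpan_le_sylSpan (fun j => hG j _) h1
        obtain ⟨c, hc⟩ := (Submodule.mem_span_range_iff_exists_fun K).1 h2
        rw [he]
        refine ⟨fun ν => -c ((excEquiv d e).symm ν), fun κ => ?_⟩
        have h3 := congrArg (coeff κ.1) hc
        have hκ : κ.1.degree = e := by exact_mod_cast κ.2
        rw [coeff_homogeneousComponent, if_pos hκ, coeff_evalLeft (isHomogeneous_bez hd a) p
          (t := t) (by rw [← critDegree_eq hd]; omega), coeff_sum] at h3
        rw [show ∑ lam : Mon n t, pw p lam.1 * bezCoeff a lam.1 κ.1 = _ from h3.symm,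
          ← Equiv.sum_comp (excEquiv d e).symm, ← Finset.sum_add_distrib]
        refine Finset.sum_eq_zero fun ν _ => ?_
        rw [coeff_smul, smul_eq_mul, neg_mul]
        exact add_neg_cancel _
    let v : CRow d t → K := Sum.elim (fun γ => pw p γ.1) w
    rw [← Matrix.exists_vecMul_eq_zero_iff]
    refine ⟨v ∘ rowEquiv d t, fun h => hγ₀ ?_, ?_⟩
    · have := congrFun h ((rowEquiv d t).symm (Sum.inl γ₀))
      simpa [v] using this
    · rw [hat, Matrix.submatrix_vecMul_equiv]
      have : v ∘ rowEquiv d t ∘ (rowEquiv d t).symm = v := by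
        funext x; simp
      rw [Function.comp_assoc, this]
      have h0 : Matrix.vecMul v (core a t) = 0 := by
        funext c
        rw [Matrix.vecMul, dotProduct, Fintype.sum_sum_type]
        rcases c with c | c
        · exact hw c
        · simp only [v, Sum.elim_inl, Sum.elim_inr, core, Matrix.fromBlocks_apply₁₂,
            Matrix.fromBlocks_apply₂₂, Matrix.zero_apply, mul_zero, Finset.sum_const_zero,
            add_zero]
          exact sum_pw_mul_entry hp c
      rw [h0]
      rfl

theorem IsResultant.dvd_det_hat {R : CoeffRing d} (hR : IsResultant d R) (hd : ∀ i, 0 < d i)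
    (l : Fin n) (hl : ∀ i, i ≤ l) (t : ℤ) : R ∣ (hat X t).det := by
  classical
  -- for `f_i = X_i^{d_i}`, `i ≠ l`, and `f_l = 0` the resultant vanishes, but not the `partDet`
  have hdvd : ∀ j w, ¬ R ∣ partDet (X : CoeffIdx d → CoeffRing d) j w := by
    rintro j w ⟨S, hS⟩
    let k := AlgebraicClosure ℚ
    let b : CoeffIdx d → k := setForm (powSys d k) l 0
    have h1 := congrArg (evalSys b) hS
    rw [map_partDet, evalSys_comp_X, partDet_eq_one, map_mul,
      (hR.evalSys_eq_zero_iff b).2, zero_mul] at h1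
    · exact one_ne_zero h1
    · refine ⟨Pi.single l 1, fun h => one_ne_zero (α := k) (by simpa using congrFun h l), ?_⟩
      intro i
      by_cases hi : i = l
      · subst hi
        rw [form_setForm_self _ (isHomogeneous_zero _ _ _), map_zero]
      · rw [form_setForm_of_ne _ _ hi, form_powSys, map_pow, eval_X, Pi.single_eq_of_ne hi,
          zero_pow (hd i).ne']
    · intro i hi
      rw [form_setForm_of_ne _ _ (hi.trans_le (hl j)).ne, form_powSys]
  obtain ⟨K, _, _, a, ha⟩ := exists_generic_zero hR.prime
  rw [← ha, map_det_hat, evalSys_comp_X]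
  refine det_hat_eq_zero hd ((hR.evalSys_eq_zero_iff a).1 ((ha R).2 dvd_rfl)) (fun j w h => ?_) t
  rw [← evalSys_comp_X a, ← map_partDet, ha] at h
  exact hdvd j w h

end Divides

/-! ### The degree of the determinant of `M_t` in the last form -/

section LastDegree

variable {n : ℕ} {d : Fin n → ℕ} {B : Type*} [CommRing B]

/-- The monomials that contribute to the degree of `det M_t` in the coefficients of the `l`-th
form. -/
abbrev DegIdx (d : Fin n → ℕ) (l : Fin n) (t : ℤ) : Type :=
  (Red d t ⊕ {μ : Exc d t // firstExc μ.2 = l}) ⊕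
    {ν : Exc d (critDegree d - t) // firstExc ν.2 = l}

/-- If the `l`-th form is multiplied by `T`, then `M_t` changes by factors of its rows and columns:
all rows of `S_t` and the rows of `X^γ f_l` are multiplied by `T`, and the columns of `X^γ f_i`,
`i ≠ l`, are divided by `T`. -/
theorem det_hat_scale [IsDomain B] (l : Fin n) {T : B} (hT : T ≠ 0) (a : CoeffIdx d → B)
    (t : ℤ) : (hat (scale (fun i => if i = l then T else 1) a) t).det =
      T ^ Fintype.card (DegIdx d l t) * (hat a t).det := by
  classical
  let u : Fin n → B := fun i => if i = l then T else 1
  let rf : CRow d t → B := Sum.elim (fun _ => T) fun ν => if firstExc ν.2 = l then T else 1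
  let cf : CCol d t → B := Sum.elim (fun _ => 1) fun μ => if firstExc μ.2 = l then 1 else T
  have hu : ∏ i, u i = T := by simp [u]
  have hcore : ∀ r c, cf c * core (scale u a) t r c = rf r * core a t r c := by
    rintro (r | r) (c | c)
    · simp only [core, Matrix.fromBlocks_apply₁₁, Matrix.of_apply, bezCoeff_scale, hu, cf, rf,
        Sum.elim_inl, one_mul]
    · simp only [core, Matrix.fromBlocks_apply₁₂, Matrix.of_apply, entry_scale, cf, rf,
        Sum.elim_inl, Sum.elim_inr, u]
      split_ifs <;> ring
    · simp only [core, Matrix.fromBlocks_apply₂₁, Matrix.of_apply, entry_scale, cf, rf,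
        Sum.elim_inl, Sum.elim_inr, u, one_mul]
    · simp [core]
  have h1 : (∏ s, cf (colEquiv d t s)) * (hat (scale u a) t).det =
      (∏ s, rf (rowEquiv d t s)) * (hat a t).det := by
    rw [← Matrix.det_mul_row, ← Matrix.det_mul_column]
    congr 1
    ext i j
    exact hcore _ _
  have hc : ∏ s, cf (colEquiv d t s) = ∏ μ : Exc d t, if firstExc μ.2 = l then 1 else T := by
    rw [Fintype.prod_sum_type, Fintype.prod_sum_type]
    simp only [colEquiv_red, colEquiv_exc, colEquiv_exc', cf, Sum.elim_inl, Sum.elim_inr,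
      Finset.prod_const_one, one_mul, mul_one]
  have hr : ∏ s, rf (rowEquiv d t s) = (∏ μ : Exc d t, if firstExc μ.2 = l then 1 else T) *
      T ^ Fintype.card (DegIdx d l t) := by
    have h2 : ∏ _μ : Exc d t, T = (∏ μ : Exc d t, if firstExc μ.2 = l then 1 else T) *
        ∏ μ : Exc d t, if firstExc μ.2 = l then T else 1 := by
      rw [← Finset.prod_mul_distrib]
      refine Finset.prod_congr rfl fun μ _ => ?_
      split_ifs <;> simp
    have h3 : ∀ v, ∏ μ : Exc d v, (if firstExc μ.2 = l then T else 1) =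
        T ^ Fintype.card {μ : Exc d v // firstExc μ.2 = l} := by
      intro v
      rw [Finset.prod_ite, Finset.prod_const, Finset.prod_const_one, mul_one,
        Fintype.card_subtype]
    rw [Fintype.prod_sum_type, Fintype.prod_sum_type]
    change (∏ _γ : Red d t, T) * (∏ _μ : Exc d t, T) *
      (∏ ν : Exc d (critDegree d - t), if firstExc ν.2 = l then T else 1) = _
    rw [h2, h3, h3, Finset.prod_const, Fintype.card_sum, Fintype.card_sum, pow_add, pow_add,
      Finset.card_univ]
    ring
  rw [hc, hr, mul_assoc] at h1
  refine mul_left_cancel₀ (Finset.prod_ne_zero_iff.2 fun μ _ => ?_) h1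
  split_ifs
  · exact one_ne_zero
  · exact hT

theorem homogIn_det_hat (l : Fin n) (t : ℤ) : HomogIn l (Fintype.card (DegIdx d l t))
    (hat (X : CoeffIdx d → CoeffRing d) t).det := by
  rw [HomogIn, map_det_hat, evalSys_comp_X, scaleSys, det_hat_scale l Polynomial.X_ne_zero,
    ← map_det_hat, mul_comm]

/-- The exponent of a monomial that contributes to the degree, or, in degree `t_n - t`, the
complementary exponent, which is negative at `l`. -/
def degExp (d : Fin n → ℕ) (l : Fin n) (t : ℤ) : DegIdx d l t → Fin n → ℤ
  | Sum.inl (Sum.inl γ) => fun i => γ.1.1 i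
  | Sum.inl (Sum.inr μ) => fun i => μ.1.1.1 i
  | Sum.inr ν => fun i => d i - 1 - ν.1.1.1 i

theorem sum_degExp (l : Fin n) (t : ℤ) (s : DegIdx d l t) : ∑ i, degExp d l t s i = t := by
  rcases s with (s | s) | s
  · simp only [degExp]
    have := s.1.2
    rw [Finsupp.degree_eq_sum] at this
    push_cast at this
    exact this
  · simp only [degExp]
    have := s.1.1.2
    rw [Finsupp.degree_eq_sum] at this
    push_cast at this
    exact this
  · simp only [degExp]
    have := s.1.1.2
    rw [Finsupp.degree_eq_sum] at this
    push_cast at this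
    rw [Finset.sum_sub_distrib, this, critDegree]
    ring

theorem degExp_bounds (l : Fin n) (hl : ∀ i, i ≤ l) (t : ℤ) (s : DegIdx d l t) {i : Fin n}
    (hi : i ≠ l) : 0 ≤ degExp d l t s i ∧ degExp d l t s i < d i := by
  have hlt : i < l := lt_of_le_of_ne (hl i) hi
  rcases s with (s | s) | s
  · have := s.2 i
    simp only [degExp]
    omega
  · have := lt_of_lt_firstExc s.1.2 (hlt.trans_eq s.2.symm)
    simp only [degExp]
    omega
  · have := lt_of_lt_firstExc s.1.2 (hlt.trans_eq s.2.symm)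
    simp only [degExp]
    omega

theorem degExp_injective (l : Fin n) (t : ℤ) : Function.Injective (degExp d l t) := by
  have hexc : ∀ {u : ℤ} (s : {μ : Exc d u // firstExc μ.2 = l}), d l ≤ s.1.1.1 l := fun s => by
    have h1 := le_firstExc s.1.2
    rwa [s.2] at h1
  intro s s' h
  have hl := congrFun h l
  rcases s with (s | s) | s <;> rcases s' with (s' | s') | s'
  · congr 2
    refine Subtype.ext (Subtype.ext (Finsupp.ext fun i => ?_))
    have := congrFun h i
    simp only [degExp] at this
    omega
  · have h1 := s.2 l
    have h2 := hexc s'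
    simp only [degExp] at hl
    omega
  · have h2 := hexc s'
    simp only [degExp] at hl
    omega
  · have h1 := s'.2 l
    have h2 := hexc s
    simp only [degExp] at hl
    omega
  · congr 2
    refine Subtype.ext (Subtype.ext (Subtype.ext (Finsupp.ext fun i => ?_)))
    have := congrFun h i
    simp only [degExp] at this
    omega
  · have h2 := hexc s'
    simp only [degExp] at hl
    omega
  · have h2 := hexc s
    simp only [degExp] at hl
    omega
  · have h2 := hexc s
    simp only [degExp] at hl
    omega
  · congr 1
    refine Subtype.ext (Subtype.ext (Subtype.ext (Finsupp.ext fun i => ?_)))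
    have := congrFun h i
    simp only [degExp] at this
    omega

/-- An element of `DegIdx d l t` is determined by the exponents at the places `i ≠ l`, which are
less than `d i`, since the sum of all exponents is `t`. -/
theorem card_degIdx_le (l : Fin n) (hl : ∀ i, i ≤ l) (t : ℤ) :
    Fintype.card (DegIdx d l t) ≤ prodOther d l := by
  classical
  have hlt : ∀ s i, (if i = l then 0 else (degExp d l t s i).toNat) <
      if i = l then 1 else d i := by
    intro s i
    split_ifs with hi
    · exact one_pos
    · have := degExp_bounds l hl t s hi
      omega
  have := Fintype.card_le_of_injective (β := ∀ i : Fin n, Fin (if i = l then 1 else d i))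
    (fun s i => ⟨_, hlt s i⟩) ?_
  · simpa [prodOther] using this
  · intro s s' hss
    have hi : ∀ i, i ≠ l → degExp d l t s i = degExp d l t s' i := by
      intro i hi
      have h1 := congrArg Fin.val (congrFun hss i)
      simp only [if_neg hi] at h1
      have h2 := degExp_bounds l hl t s hi
      have h3 := degExp_bounds l hl t s' hi
      omega
    refine degExp_injective l t (funext fun i => ?_)
    by_cases hil : i = l
    · have h1 := (sum_degExp l t s).trans (sum_degExp l t s').symm
      rw [← Finset.add_sum_erase _ _ (Finset.mem_univ l),
        ← Finset.add_sum_erase _ (degExp d l t s') (Finset.mem_univ l),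
        Finset.sum_congr rfl fun i h => hi i (Finset.ne_of_mem_erase h)] at h1
      rw [hil]
      exact add_right_cancel h1
    · exact hi i hil

/-- The quotient of `det M_t` by the resultant does not involve the last form: the degree of the
determinant in its coefficients is at most that of the resultant. -/
theorem homogIn_zero_of_det_hat_eq {R q : CoeffRing d} (hR : IsResultant d R)
    (hd : ∀ i, 0 < d i) (l : Fin n) (hl : ∀ i, i ≤ l) {t : ℤ} (h : (hat X t).det = R * q) :
    HomogIn l 0 q := by
  by_cases hq : q = 0
  · simp [HomogIn, hq]
  have hR0 := hR.prime.ne_zero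
  have h1 := homogIn_det_hat (d := d) l t
  rw [h] at h1
  obtain ⟨y, -, hy⟩ := h1.of_dvd (mul_ne_zero hR0 hq) (dvd_mul_left q R)
  have hx := hR.homogIn hd l
  rw [HomogIn, map_mul, hx, hy] at h1
  have h2 := congrArg Polynomial.natDegree h1
  rw [show Polynomial.C R * Polynomial.X ^ prodOther d l * (Polynomial.C q * Polynomial.X ^ y) =
    Polynomial.C (R * q) * Polynomial.X ^ (prodOther d l + y) by
      rw [Polynomial.C_mul, pow_add]; ring,
    Polynomial.natDegree_C_mul_X_pow _ _ (mul_ne_zero hR0 hq),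
    Polynomial.natDegree_C_mul_X_pow _ _ (mul_ne_zero hR0 hq)] at h2
  have h3 := card_degIdx_le (d := d) l hl t
  obtain rfl : y = 0 := by omega
  exact hy

theorem HomogIn.evalSys_eq {l : Fin n} {F : CoeffRing d} (h : HomogIn l 0 F)
    {a a' : CoeffIdx d → B} (haa' : ∀ v, v.1 ≠ l → a v = a' v) : evalSys a F = evalSys a' F := by
  have key : ∀ b : CoeffIdx d → B,
      evalSys b F = evalSys (scale (fun i => if i = l then 0 else 1) b) F := by
    intro b
    have := congrArg (Polynomial.eval₂RingHom (evalSys b) 0) h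
    rw [map_evalSys, pow_zero, mul_one, Polynomial.coe_eval₂RingHom, Polynomial.eval₂_C] at this
    rw [← this]
    congr 2
    funext v
    simp only [Function.comp_apply, scaleSys, scale, Polynomial.eval₂_mul, Polynomial.eval₂_C,
      evalSys_X]
    split_ifs <;> simp
  rw [key a, key a']
  congr 2
  funext v
  by_cases hv : v.1 = l
  · simp [scale, hv]
  · simp [scale, hv, haa' v hv]

theorem HomogIn.evalSys_scale_powSys {l : Fin n} {x : ℕ} {F : CoeffRing d} (h : HomogIn l x F)
    (hF : evalSys (powSys d ℤ) F = 1) :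
    evalSys (scale (fun i => if i = l then Polynomial.X else 1) (powSys d (Polynomial ℤ))) F =
      Polynomial.X ^ x := by
  have := congrArg (Polynomial.mapRingHom (evalSys (powSys d ℤ))) h
  rw [map_evalSys, map_mul, map_pow, Polynomial.coe_mapRingHom, Polynomial.map_C,
    Polynomial.map_X, hF, Polynomial.C_1, one_mul] at this
  rw [← this]
  congr 2
  funext v
  have h2 : powSys d (Polynomial ℤ) v = Polynomial.C (powSys d ℤ v) :=
    (congrFun (comp_powSys (d := d) (Polynomial.C : ℤ →+* Polynomial ℤ)) v).symm
  simp only [Function.comp_apply, scaleSys, scale, Polynomial.map_mul, Polynomial.map_C,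
    evalSys_X, h2]
  split_ifs <;> simp

end LastDegree

/-! ### Separating the last variable -/

section LastVariable

variable {m : ℕ} {B C : Type*} [CommRing B] [CommRing C]

/-- The exponent `(γ_1, …, γ_m, k)`. -/
def snocMon (γ : Fin m →₀ ℕ) (k : ℕ) : Fin (m + 1) →₀ ℕ :=
  Finsupp.equivFunOnFinite.symm (Fin.snoc (α := fun _ => ℕ) γ k)

/-- The exponent `(γ_1, …, γ_m)` obtained from `(γ_1, …, γ_{m+1})`. -/
def initMon (γ : Fin (m + 1) →₀ ℕ) : Fin m →₀ ℕ :=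
  Finsupp.equivFunOnFinite.symm fun i => γ i.castSucc

theorem snocMon_castSucc (γ : Fin m →₀ ℕ) (k : ℕ) (i : Fin m) : snocMon γ k i.castSucc = γ i := by
  simp [snocMon]

theorem snocMon_last (γ : Fin m →₀ ℕ) (k : ℕ) : snocMon γ k (Fin.last m) = k := by
  simp [snocMon]

theorem initMon_apply (γ : Fin (m + 1) →₀ ℕ) (i : Fin m) : initMon γ i = γ i.castSucc := rfl

theorem initMon_snocMon (γ : Fin m →₀ ℕ) (k : ℕ) : initMon (snocMon γ k) = γ :=
  Finsupp.ext fun i => snocMon_castSucc γ k i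

theorem finsupp_ext_last {γ γ' : Fin (m + 1) →₀ ℕ} (h : initMon γ = initMon γ')
    (hl : γ (Fin.last m) = γ' (Fin.last m)) : γ = γ' := by
  ext i
  refine Fin.lastCases hl (fun i => ?_) i
  exact DFunLike.congr_fun h i

theorem snocMon_initMon {γ : Fin (m + 1) →₀ ℕ} {k : ℕ} (h : γ (Fin.last m) = k) :
    snocMon (initMon γ) k = γ :=
  finsupp_ext_last (initMon_snocMon _ _) ((snocMon_last _ _).trans h.symm)

theorem degree_eq_initMon (γ : Fin (m + 1) →₀ ℕ) :
    γ.degree = (initMon γ).degree + γ (Fin.last m) := by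
  rw [Finsupp.degree_eq_sum, Finsupp.degree_eq_sum, Fin.sum_univ_castSucc]
  rfl

theorem degree_snocMon (γ : Fin m →₀ ℕ) (k : ℕ) : (snocMon γ k).degree = γ.degree + k := by
  rw [degree_eq_initMon, initMon_snocMon, snocMon_last]

theorem snocMon_zero (γ : Fin m →₀ ℕ) : snocMon γ 0 = γ.mapDomain Fin.castSucc := by
  ext i
  refine Fin.lastCases ?_ (fun i => ?_) i
  · rw [snocMon_last, Finsupp.mapDomain_of_notMem_range]
    rintro ⟨j, hj⟩
    exact (Fin.castSucc_lt_last j).ne hj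
  · rw [snocMon_castSucc, Finsupp.mapDomain_apply (Fin.castSucc_injective m)]

variable {d : Fin (m + 1) → ℕ}

/-- The degrees of all forms but the last. -/
abbrev lowDeg (d : Fin (m + 1) → ℕ) : Fin m → ℕ := fun i => d i.castSucc

theorem critDegree_succ (d : Fin (m + 1) → ℕ) :
    critDegree d = critDegree (lowDeg d) + (d (Fin.last m) - 1) :=
  Fin.sum_univ_castSucc _

/-- The coefficients of the forms in `X_1, …, X_m` obtained from the first `m` forms of a system in
`X_1, …, X_{m+1}` by the substitution of `0` for the last variable. -/
def restrict (a : CoeffIdx d → B) : CoeffIdx (lowDeg d) → B := fun v =>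
  a ⟨v.1.castSucc, ⟨snocMon v.2.1 0, by rw [degree_snocMon]; exact v.2.2⟩⟩

theorem comp_restrict (φ : B →+* C) (a : CoeffIdx d → B) : φ ∘ restrict a = restrict (φ ∘ a) := rfl

/-- The substitution of `0` for the last variable. -/
abbrev killLast (B : Type*) [CommRing B] (m : ℕ) :
    MvPolynomial (Fin (m + 1)) B →ₐ[B] MvPolynomial (Fin m) B :=
  killCompl (Fin.castSucc_injective m)

theorem killLast_form (a : CoeffIdx d → B) (i : Fin m) :
    killLast B m (form a i.castSucc) = form (restrict a) i := by
  ext β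
  rw [coeff_killCompl, ← snocMon_zero]
  by_cases hβ : β.degree = d i.castSucc
  · rw [coeff_form (restrict a) i ⟨β, by exact_mod_cast hβ⟩]
    exact coeff_form a i.castSucc ⟨snocMon β 0, by rw [degree_snocMon]; exact_mod_cast hβ⟩
  · rw [(form_isHomogeneous (restrict a) i).coeff_eq_zero hβ,
      (form_isHomogeneous a i.castSucc).coeff_eq_zero]
    rwa [degree_snocMon]

theorem coeff_form_castSucc (a : CoeffIdx d → B) (i : Fin m) {β : Fin (m + 1) →₀ ℕ}
    (hβ : β (Fin.last m) = 0) :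
    coeff β (form a i.castSucc) = coeff (initMon β) (form (restrict a) i) := by
  rw [← killLast_form, coeff_killCompl, ← snocMon_zero, snocMon_initMon hβ]

theorem killLast_X_castSucc (i : Fin m) : killLast B m (X i.castSucc) = X i := by
  rw [← rename_X, killCompl_rename_app]

theorem killLast_X_last : killLast B m (X (Fin.last m)) = 0 := by
  refine killCompl_monomial_eq_zero_of_notMem_range _ 1 (a := Fin.last m) (by simp) ?_
  rintro ⟨j, hj⟩
  exact (Fin.castSucc_lt_last j).ne hj

/-! ### Macaulay matrices of a system whose last form is a power -/

theorem entry_castSucc_last_le {a : CoeffIdx d → B} {i : Fin m} {r s : Fin (m + 1) →₀ ℕ}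
    (h : entry a i.castSucc r s ≠ 0) : s (Fin.last m) ≤ r (Fin.last m) := by
  rw [entry, coeff_monomial_mul'] at h
  have h1 : s - Finsupp.single i.castSucc (d i.castSucc) ≤ r := by
    by_contra h'
    exact h (if_neg h')
  have h2 := h1 (Fin.last m)
  rwa [Finsupp.tsub_apply, Finsupp.single_eq_of_ne (Fin.castSucc_lt_last i).ne',
    Nat.sub_zero] at h2

theorem entry_last_le {a : CoeffIdx d → B} (ha : form a (Fin.last m) =
    X (Fin.last m) ^ d (Fin.last m)) {c : Fin (m + 1)} {r s : Fin (m + 1) →₀ ℕ}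
    (hs : d c ≤ s c) (h : entry a c r s ≠ 0) : s (Fin.last m) ≤ r (Fin.last m) := by
  revert hs h
  refine Fin.lastCases (fun hs h => ?_) (fun i _ h => ?_) c
  · rw [entry_pow ha hs] at h
    by_cases hrs : r = s
    · rw [hrs]
    · exact absurd (if_neg hrs) h
  · exact entry_castSucc_last_le h

theorem entry_castSucc (a : CoeffIdx d → B) (i : Fin m) {r s : Fin (m + 1) →₀ ℕ}
    (hrs : r (Fin.last m) = s (Fin.last m)) :
    entry a i.castSucc r s = entry (restrict a) i (initMon r) (initMon s) := by
  have h0 : (s - Finsupp.single i.castSucc (d i.castSucc)) (Fin.last m) = s (Fin.last m) := by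
    rw [Finsupp.tsub_apply, Finsupp.single_eq_of_ne (Fin.castSucc_lt_last i).ne', Nat.sub_zero]
  have h1 : initMon (s - Finsupp.single i.castSucc (d i.castSucc)) =
      initMon s - Finsupp.single i (d i.castSucc) := by
    classical
    ext j
    simp [initMon_apply, Finsupp.single_apply]
  have h2 : s - Finsupp.single i.castSucc (d i.castSucc) ≤ r ↔
      initMon s - Finsupp.single i (d i.castSucc) ≤ initMon r := by
    rw [← h1]
    refine ⟨fun h j => h j.castSucc, fun h j => ?_⟩
    refine Fin.lastCases ?_ (fun j => ?_) j
    · rw [h0, hrs]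
    · exact h j
  rw [entry, entry, coeff_monomial_mul', coeff_monomial_mul']
  simp only [h2]
  split_ifs with h
  · rw [coeff_form_castSucc]
    · rw [← h1]
      congr 2
      ext j
      simp [initMon_apply]
    · rw [Finsupp.tsub_apply, h0, hrs, Nat.sub_self]
  · rfl

theorem exists_exceeding_of_init {γ : Fin (m + 1) →₀ ℕ} {k : ℕ} (hk : γ (Fin.last m) = k)
    (hkd : k < d (Fin.last m)) : (∃ i, d i ≤ γ i) ↔ ∃ i, lowDeg d i ≤ initMon γ i := by
  constructor
  · rintro ⟨i, hi⟩
    revert hi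
    refine Fin.lastCases (fun hi => ?_) (fun i hi => ⟨i, hi⟩) i
    omega
  · rintro ⟨i, hi⟩
    exact ⟨i.castSucc, hi⟩

theorem firstExc_castSucc {γ : Fin (m + 1) →₀ ℕ} (h : ∃ i, d i ≤ γ i)
    (h' : ∃ i, lowDeg d i ≤ initMon γ i) : firstExc h = (firstExc h').castSucc := by
  refine firstExc_eq h (le_firstExc h') fun i hi => ?_
  revert hi
  refine Fin.lastCases (fun hi => ?_) (fun i hi => ?_) i
  · exact absurd hi (Fin.le_last _).not_gt
  · exact lt_of_lt_firstExc h' (Fin.castSucc_lt_castSucc_iff.1 hi)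

/-- Between monomials with the same exponent of the last variable the Macaulay matrix is that of
the restricted system. -/
theorem entry_firstExc_init (a : CoeffIdx d → B) {r s : Fin (m + 1) →₀ ℕ}
    (h : ∃ i, d i ≤ s i) (h' : ∃ i, lowDeg d i ≤ initMon s i)
    (hrs : r (Fin.last m) = s (Fin.last m)) :
    entry a (firstExc h) r s = entry (restrict a) (firstExc h') (initMon r) (initMon s) := by
  rw [firstExc_castSucc h h', entry_castSucc a _ hrs]

/-! ### The Bezoutian of a system whose last form is a power -/

theorem mapDomain_sumMap_sumElim (lam γ : Fin m →₀ ℕ) :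
    (Finsupp.sumElim lam γ).mapDomain (Sum.map Fin.castSucc Fin.castSucc) =
      Finsupp.sumElim (snocMon lam 0) (snocMon γ 0) := by
  have hinj : Function.Injective (Sum.map (Fin.castSucc (n := m)) (Fin.castSucc (n := m))) :=
    (Fin.castSucc_injective m).sumMap (Fin.castSucc_injective m)
  have key : ∀ x : Fin (m + 1) ⊕ Fin (m + 1),
      x ∉ Set.range (Sum.map (Fin.castSucc (n := m)) (Fin.castSucc (n := m))) →
      (Finsupp.sumElim lam γ).mapDomain (Sum.map Fin.castSucc Fin.castSucc) x = 0 :=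
    fun x hx => Finsupp.mapDomain_of_notMem_range _ _ hx
  ext (i | i)
  · refine Fin.lastCases ?_ (fun i => ?_) i
    · rw [key, Finsupp.sumElim_inl, snocMon_last]
      rintro ⟨j | j, hj⟩
      · exact (Fin.castSucc_lt_last j).ne (Sum.inl_injective hj)
      · exact Sum.inr_ne_inl hj
    · rw [Finsupp.sumElim_inl, snocMon_castSucc]
      exact Finsupp.mapDomain_apply hinj _ (Sum.inl i)
  · refine Fin.lastCases ?_ (fun i => ?_) i
    · rw [key, Finsupp.sumElim_inr, snocMon_last]
      rintro ⟨j | j, hj⟩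
      · exact Sum.inl_ne_inr hj
      · exact (Fin.castSucc_lt_last j).ne (Sum.inr_injective hj)
    · rw [Finsupp.sumElim_inr, snocMon_castSucc]
      exact Finsupp.mapDomain_apply hinj _ (Sum.inr i)

/-- The substitution of `0` for the last variable of each of the two systems of variables. -/
abbrev killLast₂ (B : Type*) [CommRing B] (m : ℕ) :
    MvPolynomial (Fin (m + 1) ⊕ Fin (m + 1)) B →ₐ[B] MvPolynomial (Fin m ⊕ Fin m) B :=
  killCompl ((Fin.castSucc_injective m).sumMap (Fin.castSucc_injective m))

theorem killLast₂_X_castSucc (x : Fin m ⊕ Fin m) :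
    killLast₂ B m (X (Sum.map Fin.castSucc Fin.castSucc x)) = X x := by
  rw [← rename_X, killCompl_rename_app]

theorem killLast₂_hyb (k : ℕ) (f : MvPolynomial (Fin (m + 1)) B) :
    killLast₂ B m (hyb B k f) = hyb B k (killLast B m f) := by
  induction f using MvPolynomial.induction_on with
  | C b => simp [hyb, algHom_C, algebraMap_eq]
  | add f g hf hg => simp only [map_add, hf, hg]
  | mul_X f i hf =>
    simp only [map_mul, hf]
    congr 1
    refine Fin.lastCases ?_ (fun i => ?_) i
    · rw [killLast_X_last, map_zero, hyb, aeval_X]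
      split_ifs
      · refine killCompl_monomial_eq_zero_of_notMem_range _ 1 (a := Sum.inr (Fin.last m))
          (by simp) ?_
        rintro ⟨j | j, hj⟩ <;> simp [Fin.castSucc_ne_last] at hj
      · refine killCompl_monomial_eq_zero_of_notMem_range _ 1 (a := Sum.inl (Fin.last m))
          (by simp) ?_
        rintro ⟨j | j, hj⟩ <;> simp [Fin.castSucc_ne_last] at hj
    · rw [killLast_X_castSucc, hyb, hyb, aeval_X, aeval_X, Fin.val_castSucc]
      split_ifs
      · exact killLast₂_X_castSucc (Sum.inr i)
      · exact killLast₂_X_castSucc (Sum.inl i)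

/-- The part of the matrix `(Δ_{ij})` without the last form and the last variable. -/
def lowQuotMat (a : CoeffIdx d → B) :
    Matrix (Fin m) (Fin m) (MvPolynomial (Fin (m + 1) ⊕ Fin (m + 1)) B) :=
  (quotMat a).submatrix Fin.castSucc Fin.castSucc

theorem killLast₂_det_lowQuotMat [IsDomain B] (a : CoeffIdx d → B) :
    killLast₂ B m (lowQuotMat a).det = bez (restrict a) := by
  rw [AlgHom.map_det, bez]
  congr 1
  ext1 i j
  refine (quotMat_eq ?_).symm
  have := congrArg (killLast₂ B m) (mul_quotMat a i.castSucc j.castSucc)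
  rw [map_mul, map_sub, map_sub, killLast₂_hyb, killLast₂_hyb, killLast_form] at this
  rw [show killLast₂ B m (X (Sum.inl j.castSucc)) = X (Sum.inl j) from
    killLast₂_X_castSucc (Sum.inl j), show killLast₂ B m (X (Sum.inr j.castSucc)) =
    X (Sum.inr j) from killLast₂_X_castSucc (Sum.inr j)] at this
  exact this

/-- Polynomials in which the last of the variables `Y` does not occur. -/
abbrev noLast (B : Type*) [CommRing B] (m : ℕ) :
    Subalgebra B (MvPolynomial (Fin (m + 1) ⊕ Fin (m + 1)) B) :=
  supported B {x | x ≠ Sum.inr (Fin.last m)}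

theorem mem_noLast_iff {p : MvPolynomial (Fin (m + 1) ⊕ Fin (m + 1)) B} :
    p ∈ noLast B m ↔ degreeOf (Sum.inr (Fin.last m)) p = 0 := by
  rw [mem_supported, ← not_ne_iff, ← mem_vars_iff_degreeOf_ne_zero]
  exact ⟨fun h hx => h hx rfl, fun h x hx hxl => h (hxl ▸ hx)⟩

theorem hyb_mem_noLast {k : ℕ} (hk : k ≤ m) (f : MvPolynomial (Fin (m + 1)) B) :
    hyb B k f ∈ noLast B m := by
  induction f using MvPolynomial.induction_on with
  | C b => simpa [hyb] using (noLast B m).algebraMap_mem b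
  | add f g hf hg => rw [map_add]; exact add_mem hf hg
  | mul_X f i hf =>
    rw [map_mul]
    refine mul_mem hf ?_
    rw [hyb, aeval_X]
    split_ifs with hi
    · refine Algebra.subset_adjoin ⟨_, fun h => ?_, rfl⟩
      obtain rfl : i = Fin.last m := Sum.inr_injective h
      simp at hi
      omega
    · exact Algebra.subset_adjoin ⟨_, Sum.inl_ne_inr, rfl⟩

theorem det_lowQuotMat_mem_noLast [IsDomain B] (a : CoeffIdx d → B) :
    (lowQuotMat a).det ∈ noLast B m := by
  rw [Matrix.det_apply]
  refine sum_mem fun σ _ => ?_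
  rw [Units.smul_def]
  refine zsmul_mem (prod_mem fun j _ => ?_) _
  have h1 := mul_quotMat a (σ j).castSucc j.castSucc
  have h2 : hyb B j (form a (σ j).castSucc) - hyb B (j + 1) (form a (σ j).castSucc) ∈
      noLast B m := sub_mem (hyb_mem_noLast j.2.le _) (hyb_mem_noLast j.2 _)
  rw [Fin.val_castSucc] at h1
  rw [← h1, mem_noLast_iff] at h2
  rw [mem_noLast_iff]
  change degreeOf _ (quotMat a (σ j).castSucc j.castSucc) = 0
  by_cases h0 : quotMat a (σ j).castSucc j.castSucc = 0
  · rw [h0, degreeOf_zero]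
  · rw [degreeOf_mul_eq (X_sub_X_ne_zero _) h0] at h2
    omega

/-- The Bezoutian of `X^e` in one variable. -/
def powQuot (B : Type*) [CommRing B] (m e : ℕ) : MvPolynomial (Fin (m + 1) ⊕ Fin (m + 1)) B :=
  ∑ i ∈ Finset.range e, X (Sum.inl (Fin.last m)) ^ i * X (Sum.inr (Fin.last m)) ^ (e - 1 - i)

theorem bez_eq_mul [IsDomain B] {a : CoeffIdx d → B} (ha : form a (Fin.last m) =
    X (Fin.last m) ^ d (Fin.last m)) :
    bez a = powQuot B m (d (Fin.last m)) * (lowQuotMat a).det := by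
  have h1 : ∀ j : Fin m, quotMat a (Fin.last m) j.castSucc = 0 := by
    intro j
    refine quotMat_eq ?_
    rw [ha, map_pow, map_pow, hyb, hyb, aeval_X, aeval_X, if_neg, if_neg, sub_self, mul_zero]
    · simp
    · simp
  have h2 : quotMat a (Fin.last m) (Fin.last m) = powQuot B m (d (Fin.last m)) := by
    refine quotMat_eq ?_
    rw [ha, map_pow, map_pow, hyb, hyb, aeval_X, aeval_X, if_neg (by simp), if_pos (by simp),
      mul_comm, powQuot, geom_sum₂_mul]
  have h3 : (quotMat a).submatrix (Fin.last m).succAbove (Fin.last m).succAbove =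
      lowQuotMat a := by
    rw [lowQuotMat, Fin.succAbove_last]
  rw [bez, Matrix.det_succ_row (quotMat a) (Fin.last m), Fin.sum_univ_castSucc,
    Finset.sum_eq_zero fun j _ => by rw [h1, mul_zero, zero_mul], zero_add, h2, h3,
    Even.neg_one_pow ⟨_, rfl⟩, one_mul]

theorem powQuot_term (i j : ℕ) : (X (Sum.inl (Fin.last m)) ^ i * X (Sum.inr (Fin.last m)) ^ j :
    MvPolynomial (Fin (m + 1) ⊕ Fin (m + 1)) B) =
    monomial (Finsupp.sumElim (Finsupp.single (Fin.last m) i) (Finsupp.single (Fin.last m) j))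
      1 := by
  rw [X_pow_eq_monomial, X_pow_eq_monomial, monomial_mul, one_mul]
  congr 1
  classical
  ext (x | x)
  all_goals simp

theorem coeff_noLast {p : MvPolynomial (Fin (m + 1) ⊕ Fin (m + 1)) B} (hp : p ∈ noLast B m)
    {lam γ : Fin (m + 1) →₀ ℕ} (h : coeff (Finsupp.sumElim lam γ) p ≠ 0) :
    γ (Fin.last m) = 0 :=
  mem_support_notMem_vars_zero (mem_support_iff.2 h)
    (v := Sum.inr (Fin.last m)) fun hx => mem_supported.1 hp hx rfl

theorem sumElim_le_iff {lam γ lam' γ' : Fin m →₀ ℕ} :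
    Finsupp.sumElim lam γ ≤ Finsupp.sumElim lam' γ' ↔ lam ≤ lam' ∧ γ ≤ γ' :=
  ⟨fun h => ⟨fun i => h (Sum.inl i), fun i => h (Sum.inr i)⟩,
    fun h => fun | Sum.inl i => h.1 i | Sum.inr i => h.2 i⟩

theorem sumElim_sub (lam γ lam' γ' : Fin m →₀ ℕ) :
    Finsupp.sumElim lam γ - Finsupp.sumElim lam' γ' =
      Finsupp.sumElim (lam - lam') (γ - γ') := by
  ext (i | i) <;> simp

theorem single_le_iff_last {i : ℕ} {γ : Fin (m + 1) →₀ ℕ} :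
    Finsupp.single (Fin.last m) i ≤ γ ↔ i ≤ γ (Fin.last m) :=
  ⟨fun h => by simpa using h (Fin.last m), single_le_of_le⟩

theorem sub_single_last (γ : Fin (m + 1) →₀ ℕ) (i : ℕ) :
    γ - Finsupp.single (Fin.last m) i = snocMon (initMon γ) (γ (Fin.last m) - i) := by
  refine finsupp_ext_last ?_ ?_
  · ext j
    simp [initMon_apply, snocMon_castSucc, (Fin.castSucc_lt_last j).ne]
  · simp [snocMon_last]

theorem bezCoeff_eq_sum [IsDomain B] {a : CoeffIdx d → B} (ha : form a (Fin.last m) =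
    X (Fin.last m) ^ d (Fin.last m)) (lam γ : Fin (m + 1) →₀ ℕ) :
    bezCoeff a lam γ = ∑ i ∈ Finset.range (d (Fin.last m)),
      if i ≤ lam (Fin.last m) ∧ d (Fin.last m) - 1 - i ≤ γ (Fin.last m) then
        coeff (Finsupp.sumElim (snocMon (initMon lam) (lam (Fin.last m) - i))
          (snocMon (initMon γ) (γ (Fin.last m) - (d (Fin.last m) - 1 - i)))) (lowQuotMat a).det
      else 0 := by
  rw [bezCoeff, bez_eq_mul ha, powQuot, Finset.sum_mul, coeff_sum]
  refine Finset.sum_congr rfl fun i _ => ?_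
  rw [powQuot_term, coeff_monomial_mul', sumElim_sub, sub_single_last, sub_single_last, one_mul]
  simp only [sumElim_le_iff, single_le_iff_last]

theorem bezCoeff_ne_zero_last [IsDomain B] {a : CoeffIdx d → B} (ha : form a (Fin.last m) =
    X (Fin.last m) ^ d (Fin.last m)) {lam γ : Fin (m + 1) →₀ ℕ} (h : bezCoeff a lam γ ≠ 0) :
    (d (Fin.last m) : ℤ) - 1 - γ (Fin.last m) ≤ lam (Fin.last m) := by
  rw [bezCoeff_eq_sum ha] at h
  obtain ⟨i, hi, hne⟩ := Finset.exists_ne_zero_of_sum_ne_zero h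
  rw [Finset.mem_range] at hi
  rw [ne_eq, ite_eq_right_iff, not_forall] at hne
  obtain ⟨h1, h2⟩ := hne
  have := coeff_noLast (det_lowQuotMat_mem_noLast a) h2
  rw [snocMon_last] at this
  omega

theorem bezCoeff_restrict [IsDomain B] {a : CoeffIdx d → B} (ha : form a (Fin.last m) =
    X (Fin.last m) ^ d (Fin.last m)) {lam γ : Fin (m + 1) →₀ ℕ}
    (h : lam (Fin.last m) + γ (Fin.last m) + 1 = d (Fin.last m)) :
    bezCoeff a lam γ = bezCoeff (restrict a) (initMon lam) (initMon γ) := by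
  rw [bezCoeff_eq_sum ha, Finset.sum_eq_single (lam (Fin.last m)), if_pos (by omega), Nat.sub_self,
    show γ (Fin.last m) - (d (Fin.last m) - 1 - lam (Fin.last m)) = 0 by omega,
    ← mapDomain_sumMap_sumElim, ← coeff_killCompl ((Fin.castSucc_injective m).sumMap
      (Fin.castSucc_injective m)), killLast₂_det_lowQuotMat, bezCoeff]
  · intro i hi hne
    rw [Finset.mem_range] at hi
    refine if_neg fun h' => ?_
    omega
  · intro hmem
    rw [Finset.mem_range] at hmem
    omega

end LastVariable

/-! ### Block triangular matrices -/

section Blocks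

variable {ι κ B : Type*} [CommRing B] [Fintype ι] [DecidableEq ι] [Fintype κ] [DecidableEq κ]

/-- The determinant of the diagonal block of the indices of weight `k`. -/
def blockDet (M : Matrix ι ι B) (w : ι → ℤ) (k : ℤ) : B := (M.toSquareBlock w k).det

theorem det_eq_prod_blockDet (M : Matrix ι ι B) (w : ι → ℤ) (h : ∀ r s, M r s ≠ 0 → w s ≤ w r)
    {S : Finset ℤ} (hS : ∀ s, w s ∈ S) : M.det = ∏ k ∈ S, blockDet M w k := by
  have h1 : M.transpose.BlockTriangular w := fun i j hij => by
    by_contra h'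
    exact hij.not_ge (h j i h')
  rw [← Matrix.det_transpose, h1.det]
  have h2 : ∀ k, (M.transpose.toSquareBlock w k).det = blockDet M w k := fun k =>
    Matrix.det_transpose (M.toSquareBlock w k)
  simp only [h2]
  refine Finset.prod_subset (fun k hk => ?_) fun k _ hk => ?_
  · obtain ⟨s, -, rfl⟩ := Finset.mem_image.1 hk
    exact hS s
  · have : IsEmpty {s // w s = k} :=
      ⟨fun s => hk (Finset.mem_image.2 ⟨s.1, Finset.mem_univ _, s.2⟩)⟩
    exact Matrix.det_isEmpty

theorem blockDet_eq_one {M : Matrix ι ι B} {w : ι → ℤ} {k : ℤ} (h : ∀ s, w s ≠ k) :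
    blockDet M w k = 1 := by
  have : IsEmpty {s // w s = k} := ⟨fun s => h s.1 s.2⟩
  exact Matrix.det_isEmpty

theorem blockDet_transpose (M : Matrix ι ι B) (w : ι → ℤ) (k : ℤ) :
    blockDet M.transpose w k = blockDet M w k :=
  Matrix.det_transpose (M.toSquareBlock w k)

/-- Columns that agree with those of the identity matrix may be deleted, with the corresponding
rows. -/
theorem det_eq_det_submatrix_of_columns (M : Matrix ι ι B) {e : κ → ι}
    (he : Function.Injective e)
    (h : ∀ s, s ∉ Set.range e → ∀ r, M r s = if r = s then 1 else 0) :
    M.det = (M.submatrix e e).det := by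
  classical
  let f : κ ≃ {s // ∃ x, e x = s} := Equiv.ofBijective (fun x => ⟨e x, x, rfl⟩)
    ⟨fun x y hxy => he (congrArg Subtype.val hxy), fun ⟨_, x, hx⟩ => ⟨x, Subtype.ext hx⟩⟩
  have h1 : M.toSquareBlockProp (fun s => ¬ ∃ x, e x = s) = 1 := by
    ext r s
    rw [Matrix.toSquareBlockProp_def, Matrix.of_apply, h _ s.2, Matrix.one_apply]
    simp only [Subtype.ext_iff]
  have h2 : M.submatrix e e = (M.toSquareBlockProp (fun s => ∃ x, e x = s)).submatrix f f := rfl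
  rw [h2, Matrix.det_submatrix_equiv_self, Matrix.twoBlockTriangular_det' M
    (fun s => ∃ x, e x = s), h1, Matrix.det_one, mul_one]
  intro i hi j hj
  rw [h j hj, if_neg]
  rintro rfl
  exact hj hi

theorem blockDet_eq_det_submatrix (M : Matrix ι ι B) (w : ι → ℤ) (k : ℤ) {e : κ → ι}
    (he : Function.Injective e) (hw : ∀ x, w (e x) = k)
    (h : ∀ s, w s = k → s ∉ Set.range e → ∀ r, w r = k → M r s = if r = s then 1 else 0) :
    blockDet M w k = (M.submatrix e e).det := by
  rw [blockDet, det_eq_det_submatrix_of_columns (M.toSquareBlock w k)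
    (e := fun x => ⟨e x, hw x⟩) (fun x y hxy => he (congrArg Subtype.val hxy))]
  · rfl
  · intro s hs r
    rw [Matrix.toSquareBlock_def, Matrix.of_apply, h s.1 s.2 (fun ⟨x, hx⟩ =>
      hs ⟨x, Subtype.ext hx⟩) r.1 r.2]
    simp only [Subtype.ext_iff]

end Blocks

/-! ### The blocks of `M_t` and `E_u` for a system whose last form is a power -/

section Recursion

variable {m : ℕ} {d : Fin (m + 1) → ℕ} {B : Type*} [CommRing B]

/-- The monomial `X^γ X_{m+1}^k`. -/
def snocDeg {u v : ℤ} (k : ℕ) (h : v + k = u) (γ : Mon m v) : Mon (m + 1) u :=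
  ⟨snocMon γ.1 k, by rw [degree_snocMon]; have := γ.2; push_cast; omega⟩

theorem snocDeg_injective {u v : ℤ} (k : ℕ) (h : v + k = u) :
    Function.Injective (snocDeg (m := m) k h) := fun γ γ' hγ => Subtype.ext <| by
  rw [← initMon_snocMon γ.1 k, ← initMon_snocMon γ'.1 k]
  exact congrArg (fun x => initMon x.1) hγ

theorem exists_snocDeg {u v : ℤ} {k : ℕ} (h : v + k = u) (β : Mon (m + 1) u)
    (hβ : β.1 (Fin.last m) = k) : ∃ γ : Mon m v, snocDeg k h γ = β ∧ γ.1 = initMon β.1 :=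
  ⟨⟨initMon β.1, by
    have h1 := degree_eq_initMon β.1
    have h2 := β.2
    omega⟩, Subtype.ext (snocMon_initMon hβ), rfl⟩

theorem lt_snocMon {γ : Fin m →₀ ℕ} {k : ℕ} (hk : k < d (Fin.last m))
    (h : ∀ i, γ i < lowDeg d i) (i : Fin (m + 1)) : snocMon γ k i < d i := by
  refine Fin.lastCases ?_ (fun i => ?_) i
  · rwa [snocMon_last]
  · rw [snocMon_castSucc]
    exact h i

theorem exceeding_snocMon {γ : Fin m →₀ ℕ} {k : ℕ} (h : ∃ i, lowDeg d i ≤ γ i) :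
    ∃ i, d i ≤ snocMon γ k i := by
  obtain ⟨i, hi⟩ := h
  exact ⟨i.castSucc, by rwa [snocMon_castSucc]⟩

/-- The reduced monomial `X^γ X_{m+1}^k`. -/
def snocRed {u v : ℤ} (k : ℕ) (h : v + k = u) (hk : k < d (Fin.last m))
    (γ : Red (lowDeg d) v) : Red d u := ⟨snocDeg k h γ.1, lt_snocMon hk γ.2⟩

/-- The monomial `X^γ X_{m+1}^k`, for `X^γ` divisible by some `X_i^{d_i}`. -/
def snocExc {u v : ℤ} (k : ℕ) (h : v + k = u) (γ : Exc (lowDeg d) v) : Exc d u :=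
  ⟨snocDeg k h γ.1, exceeding_snocMon γ.2⟩

/-- The monomial `X^γ X_{m+1}^k`, for a row `X^γ` of the matrix `E_v`. -/
def snocExt {u v : ℤ} (k : ℕ) (h : v + k = u) (γ : ExtRow (lowDeg d) v) : ExtRow d u :=
  ⟨snocDeg k h γ.1, by
    obtain ⟨i, j, hij, hi, hj⟩ := γ.2
    exact ⟨i.castSucc, j.castSucc, fun h => hij (Fin.castSucc_injective m h),
      (snocMon_castSucc _ _ _).symm ▸ hi, (snocMon_castSucc _ _ _).symm ▸ hj⟩⟩

/-- The weight of a row of `E_u`. -/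
def extWt {u : ℤ} (s : ExtRow d u) : ℤ := s.1.1 (Fin.last m)

theorem extWt_nonneg {u : ℤ} (s : ExtRow d u) : 0 ≤ extWt s := Int.natCast_nonneg _

theorem apply_le_of_degree {n : ℕ} {u : ℤ} (γ : Mon n u) (i : Fin n) : (γ.1 i : ℤ) ≤ u := by
  have h1 := Finsupp.le_degree i γ.1
  have h2 := γ.2
  omega

theorem det_extMat_eq_prod {a : CoeffIdx d → B} (ha : form a (Fin.last m) =
    X (Fin.last m) ^ d (Fin.last m)) (u : ℤ) {S : Finset ℤ} (hS : Finset.Icc 0 u ⊆ S) :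
    (extMat a u).det = ∏ k ∈ S, blockDet (extMat a u) extWt k := by
  refine det_eq_prod_blockDet _ _ (fun r s h => ?_) fun s => hS (Finset.mem_Icc.2
    ⟨extWt_nonneg s, apply_le_of_degree _ _⟩)
  exact Int.ofNat_le.2 (entry_last_le ha (le_firstExc (exists_exceeding_of_ext s)) h)

theorem blockDet_extMat (a : CoeffIdx d → B) {u v : ℤ} {k : ℕ} (h : v + k = u)
    (hk : k < d (Fin.last m)) :
    blockDet (extMat a u) extWt k = (extMat (restrict a) v).det := by
  rw [blockDet_eq_det_submatrix (extMat a u) extWt k (e := snocExt k h)]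
  · congr 1
    ext1 r s
    refine (entry_firstExc_init a (exists_exceeding_of_ext (snocExt k h s))
      (by
        change ∃ i, lowDeg d i ≤ initMon (snocMon s.1.1 k) i
        rw [initMon_snocMon]; exact exists_exceeding_of_ext s) ?_).trans ?_
    · exact (snocMon_last _ _).trans (snocMon_last _ _).symm
    · change entry (restrict a) _ (initMon (snocMon r.1.1 k)) (initMon (snocMon s.1.1 k)) = _
      simp only [initMon_snocMon]
      congr 2
      exact initMon_snocMon _ _
  · intro γ γ' hγ
    exact Subtype.ext (snocDeg_injective k h (congrArg Subtype.val hγ))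
  · intro x
    exact congrArg Nat.cast (snocMon_last _ _)
  · intro s hs hr
    have hs' : s.1.1 (Fin.last m) = k := Int.ofNat_inj.1 hs
    obtain ⟨γ, h1, h2⟩ := exists_snocDeg h s.1 hs'
    obtain ⟨i, j, hij, hi, hj⟩ := s.2
    refine absurd ⟨⟨γ, ?_⟩, Subtype.ext h1⟩ hr
    have hne : ∀ i, d i ≤ s.1.1 i → ∃ i', i = Fin.castSucc i' ∧ lowDeg d i' ≤ γ.1 i' := by
      intro i
      refine Fin.lastCases (fun hi => by omega) (fun i hi => ?_) i
      exact ⟨i, rfl, by rw [h2]; exact hi⟩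
    obtain ⟨i', rfl, hi'⟩ := hne i hi
    obtain ⟨j', rfl, hj'⟩ := hne j hj
    exact ⟨i', j', fun h => hij (congrArg _ h), hi', hj'⟩

/-- The weight of a row of `M_t`, and of the corresponding column: the exponent of the last
variable, or, in degree `t_n - t`, the complementary exponent. -/
def hatWt {t : ℤ} : HIdx d t → ℤ
  | Sum.inl (Sum.inl γ) => γ.1.1 (Fin.last m)
  | Sum.inl (Sum.inr μ) => μ.1.1 (Fin.last m)
  | Sum.inr ν => d (Fin.last m) - 1 - ν.1.1 (Fin.last m)

/-- The weight of a row of `M_t`. -/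
def rowWt {t : ℤ} : CRow d t → ℤ :=
  Sum.elim (fun lam => lam.1 (Fin.last m)) fun ν => d (Fin.last m) - 1 - ν.1.1 (Fin.last m)

/-- The weight of a column of `M_t`. -/
def colWt {t : ℤ} : CCol d t → ℤ :=
  Sum.elim (fun γ => d (Fin.last m) - 1 - γ.1 (Fin.last m)) fun μ => μ.1.1 (Fin.last m)

theorem rowWt_rowEquiv {t : ℤ} (s : HIdx d t) : rowWt (rowEquiv d t s) = hatWt s := by
  rcases s with (s | s) | s <;> rfl

theorem colWt_colEquiv {t : ℤ} (s : HIdx d t) : colWt (colEquiv d t s) = hatWt s := by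
  rcases s with (s | s) | s
  · have := s.2 (Fin.last m)
    change (d (Fin.last m) : ℤ) - 1 - (complMon d s.1.1 (Fin.last m) : ℕ) = s.1.1 (Fin.last m)
    rw [complMon_apply]
    omega
  · rfl
  · rfl

theorem det_hat_eq_prod [IsDomain B] {a : CoeffIdx d → B} (ha : form a (Fin.last m) =
    X (Fin.last m) ^ d (Fin.last m)) (t : ℤ) {S : Finset ℤ} (hS : Finset.Icc 0 t ⊆ S)
    (hS' : Finset.Icc (d (Fin.last m) - 1 - (critDegree d - t)) (d (Fin.last m) - 1) ⊆ S) :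
    (hat a t).det = ∏ k ∈ S, blockDet (hat a t) hatWt k := by
  refine det_eq_prod_blockDet _ _ (fun r s h => ?_) fun s => ?_
  · rw [← rowWt_rowEquiv r, ← colWt_colEquiv s]
    rw [hat, Matrix.submatrix_apply] at h
    revert h
    rcases rowEquiv d t r with r | r <;> rcases colEquiv d t s with c | c <;> intro h
    · exact bezCoeff_ne_zero_last ha h
    · exact Int.ofNat_le.2 (entry_last_le ha (le_firstExc c.2) h)
    · exact sub_le_sub_left (Int.ofNat_le.2 (entry_last_le ha (le_firstExc r.2) h)) _
    · exact absurd rfl h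
  · rcases s with (s | s) | s
    · exact hS (Finset.mem_Icc.2 ⟨Int.natCast_nonneg _, apply_le_of_degree _ _⟩)
    · exact hS (Finset.mem_Icc.2 ⟨Int.natCast_nonneg _, apply_le_of_degree _ _⟩)
    · refine hS' (Finset.mem_Icc.2 ⟨sub_le_sub_left (apply_le_of_degree _ _) _, ?_⟩)
      exact sub_le_self _ (Int.natCast_nonneg _)

/-- The part of the common index set that belongs to the weight `k`. -/
def snocHIdx {t v : ℤ} (k : ℕ) (hk : k < d (Fin.last m)) (h : v + k = t) :
    HIdx (lowDeg d) v → HIdx d t :=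
  Sum.map (Sum.map (snocRed k h hk) (snocExc k h)) (snocExc (d (Fin.last m) - 1 - k) (by
    rw [critDegree_succ]
    omega))

theorem snocHIdx_injective {t v : ℤ} (k : ℕ) (hk : k < d (Fin.last m)) (h : v + k = t) :
    Function.Injective (snocHIdx (d := d) k hk h) :=
  Function.Injective.sumMap (Function.Injective.sumMap
    (fun _ _ hγ => Subtype.ext (snocDeg_injective k h (congrArg Subtype.val hγ)))
    (fun _ _ hγ => Subtype.ext (snocDeg_injective k h (congrArg Subtype.val hγ))))
    (fun _ _ hγ => Subtype.ext (snocDeg_injective (d (Fin.last m) - 1 - k)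
      (by rw [critDegree_succ]; omega) (congrArg Subtype.val hγ)))

theorem complMon_snocMon (γ : Fin m →₀ ℕ) (k : ℕ) :
    initMon (complMon d (snocMon γ k)) = complMon (lowDeg d) γ := by
  ext i
  rw [initMon_apply, complMon_apply, complMon_apply, snocMon_castSucc]

theorem blockDet_hat_of_lt [IsDomain B] {a : CoeffIdx d → B} (ha : form a (Fin.last m) =
    X (Fin.last m) ^ d (Fin.last m)) {t v : ℤ} {k : ℕ} (hk : k < d (Fin.last m))
    (h : v + k = t) : blockDet (hat a t) hatWt k = (hat (restrict a) v).det := by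
  rw [blockDet_eq_det_submatrix (hat a t) hatWt k (snocHIdx_injective k hk h)]
  · congr 1
    have hB : ∀ {lam γ : Fin m →₀ ℕ} {lam' γ' : Fin (m + 1) →₀ ℕ}, initMon lam' = lam →
        initMon γ' = γ → lam' (Fin.last m) = k → γ' (Fin.last m) = d (Fin.last m) - 1 - k →
        bezCoeff a lam' γ' = bezCoeff (restrict a) lam γ := by
      rintro _ _ lam' γ' rfl rfl h1 h2
      exact bezCoeff_restrict ha (by omega)
    have hE : ∀ {r s : Fin m →₀ ℕ} {r' s' : Fin (m + 1) →₀ ℕ} (hr : initMon r' = r)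
        (hs : initMon s' = s) (hs1 : ∃ i, lowDeg d i ≤ s i) (hs2 : ∃ i, d i ≤ s' i)
        (_ : r' (Fin.last m) = s' (Fin.last m)),
        entry a (firstExc hs2) r' s' = entry (restrict a) (firstExc hs1) r s := by
      rintro _ _ r' s' rfl rfl hs1 hs2 h1
      exact entry_firstExc_init a hs2 hs1 h1
    have hlast : ∀ (γ : Fin m →₀ ℕ) k, snocMon γ k (Fin.last m) = k := snocMon_last
    have hinit : ∀ (γ : Fin m →₀ ℕ) k, initMon (snocMon γ k) = γ := initMon_snocMon
    have hcl : ∀ γ : Fin m →₀ ℕ, complMon d (snocMon γ k) (Fin.last m) =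
        d (Fin.last m) - 1 - k := fun γ => by rw [complMon_apply, snocMon_last]
    ext1 r s
    rcases r with (r | r) | r <;> rcases s with (s | s) | s
    · exact hB (hinit _ _) (complMon_snocMon _ _) (hlast _ _) (hcl _)
    · exact hE (hinit _ _) (hinit _ _) s.2 _ ((hlast _ _).trans (hlast _ _).symm)
    · exact hB (hinit _ _) (hinit _ _) (hlast _ _) (hlast _ _)
    · exact hB (hinit _ _) (complMon_snocMon _ _) (hlast _ _) (hcl _)
    · exact hE (hinit _ _) (hinit _ _) s.2 _ ((hlast _ _).trans (hlast _ _).symm)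
    · exact hB (hinit _ _) (hinit _ _) (hlast _ _) (hlast _ _)
    · exact hE (complMon_snocMon _ _) (hinit _ _) r.2 _ ((hcl _).trans (hlast _ _).symm)
    · rfl
    · exact hE (hinit _ _) (hinit _ _) r.2 _ ((hlast _ _).trans (hlast _ _).symm)
  · rintro ((x | x) | x)
    · exact congrArg Nat.cast (snocMon_last _ _)
    · exact congrArg Nat.cast (snocMon_last _ _)
    · change (d (Fin.last m) : ℤ) - 1 -
        (snocMon x.1.1 (d (Fin.last m) - 1 - k) (Fin.last m) : ℕ) = k
      rw [snocMon_last]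
      omega
  · intro s hs hr
    refine absurd ?_ hr
    rcases s with (s | s) | s
    · obtain ⟨γ, h1, h2⟩ := exists_snocDeg h s.1 (Int.ofNat_inj.1 hs)
      refine ⟨Sum.inl (Sum.inl ⟨γ, fun i => ?_⟩),
        congrArg (fun x => Sum.inl (Sum.inl x)) (Subtype.ext h1)⟩
      rw [h2]
      exact s.2 i.castSucc
    · have hs' : s.1.1 (Fin.last m) = k := Int.ofNat_inj.1 hs
      obtain ⟨γ, h1, h2⟩ := exists_snocDeg h s.1 hs'
      exact ⟨Sum.inl (Sum.inr ⟨γ, h2 ▸ (exists_exceeding_of_init hs' hk).1 s.2⟩),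
        congrArg (fun x => Sum.inl (Sum.inr x)) (Subtype.ext h1)⟩
    · have hs' : s.1.1 (Fin.last m) = d (Fin.last m) - 1 - k := by
        change (d (Fin.last m) : ℤ) - 1 - s.1.1 (Fin.last m) = k at hs
        omega
      obtain ⟨γ, h1, h2⟩ := exists_snocDeg (v := critDegree (lowDeg d) - v) (by
        rw [critDegree_succ]
        omega) s.1 hs'
      exact ⟨Sum.inr ⟨γ, h2 ▸ (exists_exceeding_of_init hs' (by omega)).1 s.2⟩,
        congrArg Sum.inr (Subtype.ext h1)⟩

/-- A monomial that is divisible by `X_{m+1}^{d_{m+1}}`, but is not a row of `E_u`, is divisible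
by no other `X_i^{d_i}`. -/
theorem firstExc_eq_last {u : ℤ} {γ : Mon (m + 1) u} (h : ∃ i, d i ≤ γ.1 i)
    (hl : d (Fin.last m) ≤ γ.1 (Fin.last m))
    (hext : ¬ ∃ i j : Fin (m + 1), i ≠ j ∧ d i ≤ γ.1 i ∧ d j ≤ γ.1 j) :
    firstExc h = Fin.last m :=
  firstExc_eq h hl fun i hi => not_le.1 fun h' => hext ⟨i, _, hi.ne, h', hl⟩

/-- The rows of `E_u` of weight `k`. -/
abbrev ExtBlock (d : Fin (m + 1) → ℕ) (u k : ℤ) : Type := {s : ExtRow d u // extWt s = k}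

theorem blockDet_hat_of_ge {a : CoeffIdx d → B} (ha : form a (Fin.last m) =
    X (Fin.last m) ^ d (Fin.last m)) {t k : ℤ} (hk : d (Fin.last m) ≤ k) :
    blockDet (hat a t) hatWt k = blockDet (extMat a t) extWt k := by
  have hwt : ∀ s : HIdx d t, hatWt s = k →
      ∃ μ : Exc d t, s = Sum.inl (Sum.inr μ) ∧ μ.1.1 (Fin.last m) = k := by
    rintro ((s | s) | s) hs
    · have := s.2 (Fin.last m)
      change (s.1.1 (Fin.last m) : ℤ) = k at hs
      omega
    · exact ⟨s, rfl, hs⟩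
    · change (d (Fin.last m) : ℤ) - 1 - s.1.1 (Fin.last m) = k at hs
      omega
  rw [blockDet_eq_det_submatrix (hat a t) hatWt k (e := fun x : ExtBlock d t k =>
    Sum.inl (Sum.inr ⟨x.1.1, exists_exceeding_of_ext x.1⟩))]
  · rfl
  · intro x y hxy
    have h1 := congrArg Subtype.val (Sum.inr_injective (Sum.inl_injective hxy))
    exact Subtype.ext (Subtype.ext h1)
  · exact fun x => x.2
  · intro s hs hr r hr'
    obtain ⟨μ, rfl, hμ⟩ := hwt s hs
    obtain ⟨lam, rfl, hlam⟩ := hwt r hr'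
    have hl : d (Fin.last m) ≤ μ.1.1 (Fin.last m) := by omega
    change entry a (firstExc μ.2) lam.1.1 μ.1.1 = _
    rw [firstExc_eq_last μ.2 hl fun hext => hr ⟨⟨⟨μ.1, hext⟩, hμ⟩, rfl⟩, entry_pow ha hl]
    simp only [Sum.inl.injEq, Sum.inr.injEq, Subtype.ext_iff]

theorem blockDet_hat_of_neg {a : CoeffIdx d → B} (ha : form a (Fin.last m) =
    X (Fin.last m) ^ d (Fin.last m)) {t k : ℤ} (hk : k < 0) :
    blockDet (hat a t) hatWt k =
      blockDet (extMat a (critDegree d - t)) extWt (d (Fin.last m) - 1 - k) := by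
  have hwt : ∀ s : HIdx d t, hatWt s = k → ∃ ν : Exc d (critDegree d - t), s = Sum.inr ν ∧
      ν.1.1 (Fin.last m) = d (Fin.last m) - 1 - k := by
    rintro ((s | s) | s) hs
    · change (s.1.1 (Fin.last m) : ℤ) = k at hs
      omega
    · change (s.1.1 (Fin.last m) : ℤ) = k at hs
      omega
    · change (d (Fin.last m) : ℤ) - 1 - s.1.1 (Fin.last m) = k at hs
      exact ⟨s, rfl, by omega⟩
  rw [← blockDet_transpose, blockDet_eq_det_submatrix (hat a t).transpose hatWt k
    (e := fun x : ExtBlock d (critDegree d - t) (d (Fin.last m) - 1 - k) =>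
      Sum.inr ⟨x.1.1, exists_exceeding_of_ext x.1⟩)]
  · rfl
  · intro x y hxy
    have h1 := congrArg Subtype.val (Sum.inr_injective hxy)
    exact Subtype.ext (Subtype.ext h1)
  · intro x
    have := x.2
    change (d (Fin.last m) : ℤ) - 1 - extWt x.1 = k
    omega
  · intro s hs hr r hr'
    obtain ⟨μ, rfl, hμ⟩ := hwt s hs
    obtain ⟨lam, rfl, hlam⟩ := hwt r hr'
    have hl : d (Fin.last m) ≤ μ.1.1 (Fin.last m) := by omega
    change entry a (firstExc μ.2) lam.1.1 μ.1.1 = _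
    rw [firstExc_eq_last μ.2 hl fun hext => hr ⟨⟨⟨μ.1, hext⟩, hμ⟩, rfl⟩, entry_pow ha hl]
    simp only [Sum.inr.injEq, Subtype.ext_iff]

/-- For a system whose last form is `X_{m+1}^{d_{m+1}}`, a factorization of the determinants of
the matrices `M_t` of the restricted system implies one for the system itself: the matrices are
block triangular with respect to the exponent of the last variable. -/
theorem associated_det_hat_of_restrict [IsDomain B] {a : CoeffIdx d → B}
    (ha : form a (Fin.last m) = X (Fin.last m) ^ d (Fin.last m)) {ρ : B}
    (hρ : ∀ v, Associated (hat (restrict a) v).det (ρ * ((extMat (restrict a) v).det *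
      (extMat (restrict a) (critDegree (lowDeg d) - v)).det))) (t : ℤ) :
    Associated (hat a t).det (ρ ^ d (Fin.last m) * ((extMat a t).det *
      (extMat a (critDegree d - t)).det)) := by
  set e : ℤ := ((d (Fin.last m) : ℕ) : ℤ) with he
  have hblock : ∀ k : ℤ, Associated (blockDet (hat a t) hatWt k)
      ((if k ∈ Finset.Ico 0 e then ρ else 1) * (blockDet (extMat a t) extWt k *
        blockDet (extMat a (critDegree d - t)) extWt (e - 1 - k))) := by
    intro k
    rcases lt_or_ge k 0 with hk | hk
    · rw [if_neg (by rw [Finset.mem_Ico]; omega), blockDet_hat_of_neg ha hk,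
        blockDet_eq_one (M := extMat a t) fun s => by
          have := extWt_nonneg s
          omega, one_mul, one_mul]
    rcases lt_or_ge k e with hk' | hk'
    · obtain ⟨k, rfl⟩ := Int.eq_ofNat_of_zero_le hk
      have hkd : k < d (Fin.last m) := by omega
      rw [if_pos (by rw [Finset.mem_Ico]; omega), blockDet_hat_of_lt ha hkd
        (sub_add_cancel t (k : ℤ)), blockDet_extMat a (sub_add_cancel t (k : ℤ)) hkd,
        show e - 1 - k = ((d (Fin.last m) - 1 - k : ℕ) : ℤ) by omega,
        blockDet_extMat a (v := critDegree (lowDeg d) - (t - k))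
          (by rw [critDegree_succ]; omega) (by omega)]
      exact hρ _
    · rw [if_neg (by rw [Finset.mem_Ico]; omega), blockDet_hat_of_ge ha hk',
        blockDet_eq_one (M := extMat a (critDegree d - t)) fun s => by
          have := extWt_nonneg s; omega, one_mul, mul_one]
  obtain ⟨K, hK1, hK2⟩ : ∃ K : ℤ, t ≤ K ∧ critDegree d - t ≤ K ∧ 0 ≤ K :=
    ⟨max t (max (critDegree d - t) 0), le_max_left _ _,
      le_max_of_le_right (le_max_left _ _), le_max_of_le_right (le_max_right _ _)⟩
  -- an interval of weights that is symmetric with respect to complementation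
  set S := Finset.Icc (-K - 1) (e + K) with hS
  have h0 : 0 ≤ e := Int.natCast_nonneg _
  rw [det_hat_eq_prod ha t (S := S) (Finset.Icc_subset_Icc (by omega) (by omega))
    (Finset.Icc_subset_Icc (by omega) (by omega))]
  refine (Associated.prod S _ _ fun k _ => hblock k).trans (.of_eq ?_)
  rw [Finset.prod_mul_distrib, Finset.prod_mul_distrib,
    det_extMat_eq_prod ha t (S := S) (Finset.Icc_subset_Icc (by omega) (by omega)),
    det_extMat_eq_prod ha (critDegree d - t) (S := S)
      (Finset.Icc_subset_Icc (by omega) (by omega))]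
  congr 1
  · rw [Finset.prod_ite, Finset.prod_const, Finset.prod_const_one, mul_one,
      Finset.filter_mem_eq_inter, Finset.inter_eq_right.2, Int.card_Ico, sub_zero, he,
      Int.toNat_natCast]
    intro k hk
    rw [Finset.mem_Ico] at hk
    rw [Finset.mem_Icc]
    omega
  · congr 1
    refine Finset.prod_nbij' (fun k => e - 1 - k) (fun k => e - 1 - k) ?_ ?_ ?_ ?_ ?_
    · intro k hk
      rw [Finset.mem_Icc] at hk ⊢
      omega
    · intro k hk
      rw [Finset.mem_Icc] at hk ⊢
      omega
    · intro k _
      ring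
    · intro k _
      ring
    · intro k _
      rfl

end Recursion

/-! ### The resultant of a system whose last form is a power -/

section Specialization

variable {m : ℕ} {d : Fin (m + 1) → ℕ} {B : Type*} [CommRing B]

/-- The system `a` with the last form replaced by the power `X_{m+1}^{d_{m+1}}`. -/
def powLast (a : CoeffIdx d → B) : CoeffIdx d → B :=
  setForm a (Fin.last m) (X (Fin.last m) ^ d (Fin.last m))

theorem form_powLast_last (a : CoeffIdx d → B) :
    form (powLast a) (Fin.last m) = X (Fin.last m) ^ d (Fin.last m) :=
  form_setForm_self a (isHomogeneous_X_pow _ _)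

theorem form_powLast_of_ne (a : CoeffIdx d → B) {i : Fin (m + 1)} (hi : i ≠ Fin.last m) :
    form (powLast a) i = form a i := form_setForm_of_ne _ _ hi

theorem comp_powLast {C : Type*} [CommRing C] (φ : B →+* C) (a : CoeffIdx d → B) :
    φ ∘ powLast a = powLast (φ ∘ a) := by
  rw [powLast, comp_setForm, map_pow, map_X, powLast]

theorem powLast_apply_of_ne (a : CoeffIdx d → B) {v : CoeffIdx d} (hv : v.1 ≠ Fin.last m) :
    powLast a v = a v := if_neg hv

theorem restrict_powLast (a : CoeffIdx d → B) : restrict (powLast a) = restrict a :=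
  funext fun v => powLast_apply_of_ne a (Fin.castSucc_lt_last v.1).ne

theorem powLast_apply_last (a : CoeffIdx d → B) (α : Mon (m + 1) (d (Fin.last m))) :
    powLast a ⟨Fin.last m, α⟩ = powSys d B ⟨Fin.last m, α⟩ := if_pos rfl

theorem powLast_eq_self {a : CoeffIdx d → B}
    (h : ∀ α, a ⟨Fin.last m, α⟩ = powSys d B ⟨Fin.last m, α⟩) : powLast a = a := by
  funext ⟨i, α⟩
  by_cases hi : i = Fin.last m
  · subst hi
    rw [h, powLast_apply_last]
  · exact powLast_apply_of_ne a hi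

theorem restrict_powSys : restrict (powSys d B) = powSys (lowDeg d) B := by
  classical
  funext v
  simp only [restrict, powSys, sysOf, coeff_X_pow]
  congr 1
  refine propext ⟨fun h => ?_, fun h => ?_⟩
  · rw [← initMon_snocMon v.2.1 0, ← h]
    ext j
    simp [initMon_apply, Finsupp.single_apply]
  · rw [← h]
    refine finsupp_ext_last ?_ ?_
    · rw [initMon_snocMon]
      ext j
      simp [initMon_apply, Finsupp.single_apply]
    · rw [snocMon_last, Finsupp.single_eq_of_ne (Fin.castSucc_lt_last v.1).ne']

/-- A common zero of a system whose last form is a power of the last variable lies in the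
hyperplane where this variable is zero. -/
theorem rooted_restrict {K : Type*} [Field K] {a : CoeffIdx d → K} (hd : d (Fin.last m) ≠ 0)
    (h : Rooted (powLast a)) : Rooted (restrict a) := by
  obtain ⟨p, hp0, hp⟩ := h
  have hl : p (Fin.last m) = 0 := by
    have := hp (Fin.last m)
    rw [form_powLast_last, map_pow, eval_X] at this
    exact pow_eq_zero_iff hd |>.1 this
  have hkill : ∀ f : MvPolynomial (Fin (m + 1)) K,
      eval (fun i => p (Fin.castSucc i)) (killLast K m f) = eval p f := by
    intro f
    induction f using MvPolynomial.induction_on with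
    | C b => rw [killCompl_C, eval_C, eval_C]
    | add f g hf hg => simp only [map_add, hf, hg]
    | mul_X f i hf =>
      rw [map_mul, map_mul, map_mul, hf, eval_X]
      congr 1
      refine Fin.lastCases ?_ (fun i => ?_) i
      · rw [killLast_X_last, map_zero, hl]
      · rw [killLast_X_castSucc, eval_X]
  refine ⟨fun i => p i.castSucc, fun h0 => hp0 (funext fun i => ?_), fun i => ?_⟩
  · exact Fin.lastCases hl (fun i => congrFun h0 i) i
  · rw [← killLast_form, hkill, ← form_powLast_of_ne a (Fin.castSucc_lt_last i).ne]
    exact hp _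

/-- The coefficients of the first `m` forms that do not vanish under restriction. -/
def restrictIdx (v : CoeffIdx (lowDeg d)) : CoeffIdx d :=
  ⟨v.1.castSucc, ⟨snocMon v.2.1 0, by rw [degree_snocMon]; exact v.2.2⟩⟩

theorem evalSys_restrict_X (F : CoeffRing (lowDeg d)) :
    evalSys (restrict (X : CoeffIdx d → CoeffRing d)) F = rename restrictIdx F := by
  refine Eq.trans ?_ (map_eq_evalSys (rename (R := ℤ) (restrictIdx (d := d))).toRingHom F).symm
  congr 2
  funext v
  exact (rename_X (R := ℤ) restrictIdx v).symm

/-- A polynomial that is prime remains so if further indeterminates are adjoined. -/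
theorem prime_rename_of_injective {σ τ R : Type*} [CommRing R] {f : σ → τ}
    (hf : Function.Injective f) {p : MvPolynomial σ R} (hp : Prime p) : Prime (rename f p) := by
  have h1 : rename f p = rename ((↑) : Set.range f → τ)
      (renameEquiv R (Equiv.ofInjective f hf) p) := by
    rw [renameEquiv_apply, rename_rename]
    rfl
  rw [h1, prime_rename_iff]
  exact (MulEquiv.prime_iff (renameEquiv R (Equiv.ofInjective f hf))).2 hp

theorem prime_evalSys_restrict {F : CoeffRing (lowDeg d)} (hF : Prime F) :
    Prime (evalSys (restrict (X : CoeffIdx d → CoeffRing d)) F) := by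
  rw [evalSys_restrict_X]
  refine prime_rename_of_injective (fun v v' h => ?_) hF
  obtain ⟨i, α⟩ := v
  obtain ⟨i', α'⟩ := v'
  obtain rfl : i = i' := Fin.castSucc_injective m (congrArg Sigma.fst h)
  have h2 : snocMon α.1 0 = snocMon α'.1 0 :=
    congrArg (fun w : CoeffIdx d => w.2.1) h
  rw [Sigma.mk.injEq]
  refine ⟨rfl, heq_of_eq (Subtype.ext ?_)⟩
  rw [← initMon_snocMon α.1 0, h2, initMon_snocMon]

/-- Every prime factor of the resultant of the specialized system divides the resultant of the
first `m` forms restricted to the hyperplane `X_{m+1} = 0`. -/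
theorem IsResultant.dvd_of_prime_dvd {R : CoeffRing d} (hR : IsResultant d R)
    {R' : CoeffRing (lowDeg d)} (hR' : IsResultant (lowDeg d) R') (hd : d (Fin.last m) ≠ 0)
    {q : CoeffRing d} (hq : Prime q) (h : q ∣ evalSys (powLast (B := CoeffRing d) X) R) :
    q ∣ evalSys (restrict (X : CoeffIdx d → CoeffRing d)) R' := by
  obtain ⟨K, _, _, b, hb⟩ := exists_generic_zero hq
  rw [← hb, map_evalSys, comp_powLast, evalSys_comp_X, hR.evalSys_eq_zero_iff] at h
  rw [← hb, map_evalSys, comp_restrict, evalSys_comp_X, hR'.evalSys_eq_zero_iff]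
  exact rooted_restrict hd h

theorem prodOther_castSucc (d : Fin (m + 1) → ℕ) (j : Fin m) :
    prodOther d j.castSucc = prodOther (lowDeg d) j * d (Fin.last m) := by
  rw [prodOther, prodOther, Fin.prod_univ_castSucc, if_neg (Fin.castSucc_lt_last j).ne']
  simp only [Fin.castSucc_inj]

theorem prodOther_pos {n : ℕ} {d : Fin n → ℕ} (hd : ∀ i, 0 < d i) (l : Fin n) :
    0 < prodOther d l :=
  Finset.prod_pos fun i _ => by
    split_ifs
    · exact one_pos
    · exact hd i

/-- The multiplicativity of the resultant in the last form, in the case of a power of the last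
variable. -/
theorem IsResultant.associated_evalSys_powLast {R : CoeffRing d} (hR : IsResultant d R)
    {R' : CoeffRing (lowDeg d)} (hR' : IsResultant (lowDeg d) R') (hd : ∀ i, 0 < d i)
    (j : Fin m) : Associated (evalSys (powLast (B := CoeffRing d) X) R)
      (evalSys (restrict (X : CoeffIdx d → CoeffRing d)) R' ^ d (Fin.last m)) := by
  set ρ := evalSys (restrict (X : CoeffIdx d → CoeffRing d)) R'
  have hρ : Prime ρ := prime_evalSys_restrict hR'.prime
  -- at the system of powers the left-hand side is `1`
  have hF0 : evalSys (powLast (B := CoeffRing d) X) R ≠ 0 := by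
    intro h
    have h1 := congrArg (evalSys (powSys d ℤ)) h
    rw [map_evalSys, comp_powLast, evalSys_comp_X, powLast_eq_self fun _ => rfl,
      hR.evalSys_powSys, map_zero] at h1
    exact one_ne_zero h1
  obtain ⟨e, c, hc, hec⟩ := WfDvdMonoid.max_power_factor hF0 hρ.irreducible
  have hcu : IsUnit c := by
    by_contra hcu
    have hc0 : c ≠ 0 := fun h => hc (h ▸ dvd_zero _)
    obtain ⟨q, hq, hqc⟩ := WfDvdMonoid.exists_irreducible_factor hcu hc0
    have h1 := hR.dvd_of_prime_dvd hR' (hd _).ne' hq.prime (hec ▸ hqc.mul_left _)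
    exact hc ((hq.associated_of_dvd hρ.irreducible h1).symm.dvd.trans hqc)
  -- the exponent is determined by the degree in the coefficients of another form
  let s : Fin (m + 1) → Polynomial ℤ := fun i => if i = j.castSucc then Polynomial.X else 1
  let θ := evalSys (scale s (powSys d (Polynomial ℤ)))
  have h1 : θ (evalSys (powLast (B := CoeffRing d) X) R) =
      Polynomial.X ^ prodOther d j.castSucc := by
    rw [map_evalSys, comp_powLast, evalSys_comp_X, powLast_eq_self,
      (hR.homogIn hd _).evalSys_scale_powSys (hR.evalSys_powSys ℤ)]
    intro α
    simp only [scale, s]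
    rw [if_neg (Fin.castSucc_lt_last j).ne', one_mul]
  have h2 : θ ρ = Polynomial.X ^ prodOther (lowDeg d) j := by
    rw [map_evalSys, comp_restrict, evalSys_comp_X, ← (hR'.homogIn (fun i => hd _)
      j).evalSys_scale_powSys (hR'.evalSys_powSys ℤ)]
    congr 2
    funext v
    change s v.1.castSucc * restrict (powSys d (Polynomial ℤ)) v = _
    rw [restrict_powSys, scale]
    simp only [s, Fin.castSucc_inj]
  have h3 : prodOther d j.castSucc = prodOther (lowDeg d) j * e := by
    have h4 := congrArg Polynomial.natDegree (congrArg θ hec)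
    have h5 : (θ c).natDegree = 0 := Polynomial.natDegree_eq_zero_of_isUnit (hcu.map θ)
    have h6 : θ c ≠ 0 := (hcu.map θ).ne_zero
    rwa [map_mul, map_pow, h1, h2, ← pow_mul, Polynomial.natDegree_mul
      (pow_ne_zero _ Polynomial.X_ne_zero) h6, h5, Polynomial.natDegree_X_pow,
      Polynomial.natDegree_X_pow, add_zero] at h4
  rw [prodOther_castSucc] at h3
  rw [Nat.eq_of_mul_eq_mul_left (prodOther_pos (fun i => hd _) j) h3, hec]
  exact (associated_mul_unit_right _ _ hcu).symm

end Specialization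

/-! ### The factorization of the determinant of `M_t` -/

section Factorization

theorem firstExc_ne_last {m : ℕ} {d : Fin (m + 1) → ℕ} {u : ℤ} (s : ExtRow d u) :
    firstExc (exists_exceeding_of_ext s) ≠ Fin.last m := by
  obtain ⟨i, j, hij, hi, hj⟩ := s.2
  intro h
  have h1 := firstExc_le (exists_exceeding_of_ext s) hi
  have h2 := firstExc_le (exists_exceeding_of_ext s) hj
  rw [h, Fin.last_le_iff] at h1 h2
  exact hij (h1.trans h2.symm)

theorem extMat_powLast {m : ℕ} {d : Fin (m + 1) → ℕ} {B : Type*} [CommRing B]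
    (a : CoeffIdx d → B) (u : ℤ) : extMat (powLast a) u = extMat a u :=
  mac_congr fun s => form_powLast_of_ne a (firstExc_ne_last s)

theorem det_extMat_ne_zero {n : ℕ} {d : Fin n → ℕ} (u : ℤ) :
    (extMat (X : CoeffIdx d → CoeffRing d) u).det ≠ 0 := by
  intro h
  have h1 := congrArg (evalSys (powSys d ℤ)) h
  rw [map_det_extMat, evalSys_comp_X, det_extMat_powSys, map_zero] at h1
  exact one_ne_zero h1

theorem det_hat_of_isEmpty {d : Fin 0 → ℕ} {B : Type*} [CommRing B] (a : CoeffIdx d → B)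
    (t : ℤ) : (hat a t).det = 1 := by
  have hE : ∀ u, IsEmpty (Exc d u) := fun u => ⟨fun γ => γ.2.choose.elim0⟩
  have hat_eq : hat a t = 1 := by
    ext1 r s
    rcases r with (r | r) | r
    · rcases s with (s | s) | s
      · obtain rfl : r = s := Subtype.ext (Subtype.ext (Finsupp.ext fun i => i.elim0))
        rw [Matrix.one_apply_eq]
        change coeff _ (bez a) = 1
        rw [bez, Matrix.det_isEmpty, coeff_one, if_pos]
        ext (i | i) <;> exact i.elim0
      · exact (hE _).elim s
      · exact (hE _).elim s
    · exact (hE _).elim r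
    · exact (hE _).elim r
  rw [hat_eq, Matrix.det_one]

theorem det_extMat_of_isEmpty {d : Fin 0 → ℕ} {B : Type*} [CommRing B] (a : CoeffIdx d → B)
    (u : ℤ) : (extMat a u).det = 1 := by
  have : IsEmpty (ExtRow d u) := ⟨fun γ => γ.2.choose.elim0⟩
  exact Matrix.det_isEmpty

/-- The quotient of `det M_t` by the resultant does not involve the last form, so it can be
computed for a system whose last form is a power. -/
theorem IsResultant.associated_det_hat_of_restrict {m : ℕ} {d : Fin (m + 1) → ℕ}
    (hd : ∀ i, 0 < d i) {R : CoeffRing d} (hR : IsResultant d R) {ρ : CoeffRing d} (hρ0 : ρ ≠ 0)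
    (hRρ : Associated (evalSys (powLast (B := CoeffRing d) X) R) (ρ ^ d (Fin.last m)))
    (hρ : ∀ v, Associated (hat (restrict (X : CoeffIdx d → CoeffRing d)) v).det
      (ρ * ((extMat (restrict (X : CoeffIdx d → CoeffRing d)) v).det *
        (extMat (restrict (X : CoeffIdx d → CoeffRing d)) (critDegree (lowDeg d) - v)).det)))
    (t : ℤ) : Associated (hat X t).det (R * ((extMat (X : CoeffIdx d → CoeffRing d) t).det *
      (extMat (X : CoeffIdx d → CoeffRing d) (critDegree d - t)).det)) := by
  obtain ⟨q, hq⟩ := hR.dvd_det_hat hd (Fin.last m) Fin.le_last t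
  have hq0 := homogIn_zero_of_det_hat_eq hR hd (Fin.last m) Fin.le_last hq
  have h1 : evalSys (powLast (B := CoeffRing d) X) q = q := by
    rw [hq0.evalSys_eq fun v hv => powLast_apply_of_ne X hv, evalSys_X_left]
  have h2 := MacaulayBezout.associated_det_hat_of_restrict
    (form_powLast_last (X : CoeffIdx d → CoeffRing d)) (ρ := ρ)
    (fun v => by rw [restrict_powLast]; exact hρ v) t
  have h3 := congrArg (evalSys (powLast (B := CoeffRing d) X)) hq
  rw [map_det_hat, evalSys_comp_X, map_mul, h1] at h3
  rw [h3, extMat_powLast, extMat_powLast] at h2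
  have h4 := h2.of_mul_left hRρ fun h0 => pow_ne_zero _ hρ0 (hRρ.eq_zero_iff.1 h0)
  rw [hq]
  exact h4.mul_left R

theorem IsResultant.associated_det_hat {m : ℕ} : ∀ {d : Fin (m + 1) → ℕ}, (∀ i, 0 < d i) →
    ∀ {R : CoeffRing d}, IsResultant d R → ∀ t : ℤ, Associated (hat X t).det
      (R * ((extMat (X : CoeffIdx d → CoeffRing d) t).det *
        (extMat (X : CoeffIdx d → CoeffRing d) (critDegree d - t)).det)) := by
  induction m with
  | zero =>
    intro d hd R hR
    refine hR.associated_det_hat_of_restrict hd one_ne_zero ?_ fun v => ?_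
    · have h1 : powLast (B := CoeffRing d) X = powSys d (CoeffRing d) := by
        funext ⟨i, α⟩
        obtain rfl : i = Fin.last 0 := Fin.ext (by omega)
        exact powLast_apply_last _ _
      rw [h1, hR.evalSys_powSys, one_pow]
    · rw [det_hat_of_isEmpty, det_extMat_of_isEmpty, det_extMat_of_isEmpty, one_mul, one_mul]
  | succ m ih =>
    intro d hd R hR
    obtain ⟨R', hR'⟩ := exists_isResultant m.succ_pos (d := lowDeg d) fun i => hd _
    refine hR.associated_det_hat_of_restrict hd (prime_evalSys_restrict hR'.prime).ne_zero
      (hR.associated_evalSys_powLast hR' hd 0) fun v => ?_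
    have := (ih (fun i => hd _) hR' v).map
      (evalSys (restrict (X : CoeffIdx d → CoeffRing d)))
    rwa [map_mul, map_mul, map_det_hat, map_det_extMat, map_det_extMat, evalSys_comp_X] at this

theorem eq_or_eq_neg_of_associated {σ : Type*} {f g : MvPolynomial σ ℤ} (h : Associated f g) :
    f = g ∨ f = -g := by
  obtain ⟨u, rfl⟩ := h.symm
  obtain ⟨r, hr, hu⟩ := isUnit_iff_eq_C_of_isReduced.1 u.isUnit
  rcases Int.isUnit_iff.1 hr with rfl | rfl
  · left
    rw [hu, MvPolynomial.C_1, mul_one]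
  · right
    rw [hu, MvPolynomial.C_neg, MvPolynomial.C_1, mul_neg_one]

variable {n : ℕ} {d : Fin n → ℕ}

theorem isResultant_resultant (hn : 0 < n) (hd : ∀ i, 0 < d i) : IsResultant d (resultant d) := by
  have hex := exists_isResultant hn hd
  rw [resultant, dif_pos hex]
  exact hex.choose_spec

theorem detE_ne_zero (t : ℤ) (e : EERow d t ≃ EECol d t) : detE d t e ≠ 0 := fun h => by
  have := associated_detE _ e
  rw [h, Associated.comm, associated_zero_iff_eq_zero] at this
  exact mul_ne_zero (det_extMat_ne_zero _) (det_extMat_ne_zero _) this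

theorem detM_eq_resultant_mul_detE (hn : 0 < n) (hd : ∀ i, 0 < d i) (t : ℤ)
    (e : MRow d t ≃ MCol d t) (e' : EERow d t ≃ EECol d t) :
    detM d t e = resultant d * detE d t e' ∨ detM d t e = -(resultant d * detE d t e') := by
  obtain ⟨m, rfl⟩ : ∃ m, n = m + 1 := ⟨n - 1, by omega⟩
  exact eq_or_eq_neg_of_associated ((associated_detM _ e).trans
    (((isResultant_resultant hn hd).associated_det_hat hd t).trans
      ((associated_detE _ e').symm.mul_left _)))

end Factorization

end MacaulayBezout

end

theorem mainTheorem1 {n : ℕ} (hn : 0 < n) (d : Fin n → ℕ) (hd : ∀ i, 0 < d i) (t : ℕ) :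
    -- both matrices are square
    Nonempty (MacaulayBezout.MRow d t ≃ MacaulayBezout.MCol d t) ∧
    Nonempty (MacaulayBezout.EERow d t ≃ MacaulayBezout.EECol d t) ∧
    -- whatever the orders of the monomial bases that are used to form the determinants
    ∀ (e : MacaulayBezout.MRow d t ≃ MacaulayBezout.MCol d t)
      (e' : MacaulayBezout.EERow d t ≃ MacaulayBezout.EECol d t),
      MacaulayBezout.detM d t e ≠ 0 ∧ MacaulayBezout.detE d t e' ≠ 0 ∧
      (algebraMap (MacaulayBezout.CoeffRing d) (FractionRing (MacaulayBezout.CoeffRing d))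
          (MacaulayBezout.resultant d) =
        algebraMap _ _ (MacaulayBezout.detM d t e) / algebraMap _ _ (MacaulayBezout.detE d t e') ∨
       algebraMap (MacaulayBezout.CoeffRing d) (FractionRing (MacaulayBezout.CoeffRing d))
          (MacaulayBezout.resultant d) =
        -(algebraMap _ _ (MacaulayBezout.detM d t e) /
            algebraMap _ _ (MacaulayBezout.detE d t e'))) := by
  refine ⟨MacaulayBezout.nonempty_mRow_equiv _, MacaulayBezout.nonempty_eeRow_equiv _,
    fun e e' => ?_⟩
  have hR := (MacaulayBezout.isResultant_resultant hn hd).prime.ne_zero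
  have hE := MacaulayBezout.detE_ne_zero _ e'
  have hM := MacaulayBezout.detM_eq_resultant_mul_detE hn hd _ e e'
  have hE' : algebraMap _ (FractionRing (MacaulayBezout.CoeffRing d))
      (MacaulayBezout.detE d t e') ≠ 0 :=
    (map_ne_zero_iff _ (IsFractionRing.injective _ _)).2 hE
  refine ⟨fun h => ?_, hE, ?_⟩
  · rw [h, zero_eq_neg, eq_comm, or_self] at hM
    exact mul_ne_zero hR hE hM
  · rcases hM with h | h
    · left
      rw [h, map_mul, mul_div_cancel_right₀ _ hE']
    · right
      rw [h, map_neg, map_mul, neg_div, neg_neg, mul_div_cancel_right₀ _ hE']
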